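/- Let $\alpha,\gamma\in(0,1]$, $x\in(0,1)$, $\delta\in(0,1)$, and let $C^\alpha=C^\alpha[0,1]$ be the set of $f:[0,1]\to\mathbb R$ with $\sup_{s\ne t}|f(s)-f(t)|/|s-t|^\alpha<\infty$. For $n\ge 1$ let $x_i=i/(n+1/2)$, $i=1,\dots,n$, and, for $f_0\in C^\alpha$, let $P_{f_0}$ be the law of $\mathbf y=(y_1,\dots,y_n)$, where $y_i=f_0(x_i)+\varepsilon_i$ with $\varepsilon_i$ i.i.d. $N(0,1)$. Consider the rescaled Brownian motion prior of regularity $\gamma$, i.e. the centred Gaussian process with covariance kernel $k(s,t)=(n+1/2)^{\frac{1-2\gamma}{1+2\gamma}}\min(s,t)$. Let $\mu_1\ge\dots\ge\mu_n$ be the eigenvalues of $\mathbf K_{nn}=(k(x_i,x_j))_{i,j}$ with orthonormal eigenvectors $\mathbf v_1,\dots,\mathbf v_n$. Consider the sparse variational Gaussian process regression (SGPR) with the first $m=m_n$ eigenvector inducing variables $u_j=\sum_{i=1}^n v_j^i f(x_i)$ (all $n$ of them if $m_n>n$), that is, the Gaussian process with mean and covariance functions $$\nu_m(s)=\mathbf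 K_{sm}(\mathbf K_{mm}+\mathbf K_{mn}\mathbf K_{nm})^{-1}\mathbf K_{mn}\mathbf y,$$ $$k_m(s,t)=k(s,t)-\mathbf K_{sm}\mathbf K_{mm}^{-1}\mathbf K_{mt}+\mathbf K_{sm}(\mathbf K_{mm}+\mathbf K_{mn}\mathbf K_{nm})^{-1}\mathbf K_{mt},$$ where $\mathbf K_{sm}=\mathbf K_{ms}^T=(\mathrm{cov}(f(s),u_j))_j$, $\mathbf K_{mm}=(\mathrm{cov}(u_i,u_j))_{i,j}$ and $\mathbf K_{nm}=\mathbf K_{mn}^T=(\mathrm{cov}(f(x_i),u_j))_{i,j}$, with covariances taken under the prior. Let $z_{1-\delta}$ be defined by $P(|N(0,1)|\le z_{1-\delta})=1-\delta$, put $\sigma_m(x)^2=k_m(x,x)$ and $$C_m^\delta(x)=[\nu_m(x)-z_{1-\delta}\sigma_m(x),\ \nu_m(x)+z_{1-\delta}\sigma_m(x)],\qquad q_m^\delta(f_0)=P_{f_0}\big(f_0(x)\in C_m^\delta(x)\big).$$ Write $p_\delta=P(|N(0,1/2)|\le z_{1-\delta})$, where $N(0,1/2)$ has variance $1/2$. Suppose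 that $m_n\gg n^{\frac{1}{1+2\gamma}\left(\frac{2+\alpha}{1+\alpha}\right)}$, meaning that the ratio of the two sides tends to infinity. Then $p_\delta>1-\delta$ and, as $n\to\infty$: (i) if $\alpha>\gamma$, then $q_{m_n}^\delta(f_0)\to p_\delta$ for every $f_0\in C^\alpha$; (ii) if $\alpha=\gamma$, then for each $p\in(0,p_\delta]$ there exists $f_0\in C^\alpha$ such that $q_{m_n}^\delta(f_0)\to p$; (iii) if $\alpha<\gamma$, then there exists $f_0\in C^\alpha$ such that $q_{m_n}^\delta(f_0)\to 0$. -/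

import Mathlib

open Filter Topology MeasureTheory ProbabilityTheory
open scoped NNReal Matrix

namespace SparseGP

noncomputable section

/-- The Hölder class `C^α[0,1]`: functions `f : [0,1] → ℝ` with
`sup_{s ≠ t} |f s - f t| / |s - t|^α < ∞` (used for `0 < α ≤ 1`). -/
def holderClass (α : ℝ) : Set (unitInterval → ℝ) :=
  {f | MemHolder α.toNNReal f}

/-! ### Sparse variational Gaussian process regression

`k` is the covariance kernel of a centred Gaussian process prior on `f : X → ℝ`,
`d : Fin n → X` are the design points, `s2` is the noise variance `σ²`. The inducing variables are
`u_j = ∑ i, W i j * f (d i)`, for `j` in a finite index set `ι`. -/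

section General

variable {X ι : Type*} {n : ℕ}

/-- `[K_nn]_{i i'} = k(x_i, x_i')`. -/
def kernelMatrix (k : X → X → ℝ) (d : Fin n → X) : Matrix (Fin n) (Fin n) ℝ :=
  Matrix.of fun i i' => k (d i) (d i')

/-- The vector `K_xm` with entries `cov(f(x), u_j) = ∑ i, W i j * k(x, x_i)`. -/
def covAt (k : X → X → ℝ) (d : Fin n → X) (W : Matrix (Fin n) ι ℝ) (x : X) : ι → ℝ :=
  fun j => ∑ i, W i j * k x (d i)

/-- The matrix `K_nm` with entries `cov(f(x_i), u_j)`; its transpose is `K_mn`. -/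
def covDataInducing (k : X → X → ℝ) (d : Fin n → X) (W : Matrix (Fin n) ι ℝ) :
    Matrix (Fin n) ι ℝ :=
  Matrix.of fun i j => covAt k d W (d i) j

/-- The matrix `K_mm` with entries
`cov(u_j, u_j') = ∑ i, ∑ i', W i j * W i' j' * k(x_i, x_i')`. -/
def covInducing (k : X → X → ℝ) (d : Fin n → X) (W : Matrix (Fin n) ι ℝ) :
    Matrix ι ι ℝ :=
  Matrix.of fun j j' => ∑ i, ∑ i', W i j * W i' j' * k (d i) (d i')

variable [Fintype ι] [DecidableEq ι]

/-- The mean function of the SGPR given the data `y`,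
`ν_m(x) = K_xm (σ² K_mm + K_mn K_nm)⁻¹ K_mn y`. -/
def sgprMean (s2 : ℝ≥0) (k : X → X → ℝ) (d : Fin n → X) (W : Matrix (Fin n) ι ℝ)
    (y : Fin n → ℝ) (x : X) : ℝ :=
  covAt k d W x ⬝ᵥ
    (((s2 : ℝ) • covInducing k d W + (covDataInducing k d W)ᵀ * covDataInducing k d W)⁻¹ *ᵥ
      ((covDataInducing k d W)ᵀ *ᵥ y))

/-- The covariance function of the SGPR,
`k_m(x,x') = k(x,x') - K_xm K_mm⁻¹ K_mx' + K_xm (K_mm + σ⁻² K_mn K_nm)⁻¹ K_mx'`. -/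
def sgprCov (s2 : ℝ≥0) (k : X → X → ℝ) (d : Fin n → X) (W : Matrix (Fin n) ι ℝ)
    (x x' : X) : ℝ :=
  k x x' - covAt k d W x ⬝ᵥ ((covInducing k d W)⁻¹ *ᵥ covAt k d W x')
    + covAt k d W x ⬝ᵥ
      ((covInducing k d W +
        (s2 : ℝ)⁻¹ • ((covDataInducing k d W)ᵀ * covDataInducing k d W))⁻¹ *ᵥ covAt k d W x')

/-- The pointwise credible interval `[ν_m(x) - z σ_m(x), ν_m(x) + z σ_m(x)]`, where
`σ_m(x)² = k_m(x,x)`. -/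
def credibleSet (s2 : ℝ≥0) (k : X → X → ℝ) (d : Fin n → X) (W : Matrix (Fin n) ι ℝ)
    (z : ℝ) (y : Fin n → ℝ) (x : X) : Set ℝ :=
  Set.Icc (sgprMean s2 k d W y x - z * √(sgprCov s2 k d W x x))
    (sgprMean s2 k d W y x + z * √(sgprCov s2 k d W x x))

/-- The law `P_f` of the data `y_i = f(x_i) + ε_i`, with `ε_i` i.i.d. `N(0, σ²)`. -/
def dataLaw (s2 : ℝ≥0) (d : Fin n → X) (f : X → ℝ) : Measure (Fin n → ℝ) :=
  Measure.pi fun i => gaussianReal (f (d i)) s2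

end General

/-- `v 0, v 1, …` is an orthonormal basis of `ℝⁿ` of eigenvectors of `K` with eigenvalues
`μ 0 ≥ μ 1 ≥ …`. -/
structure IsOrderedEigenbasis {n : ℕ} (K : Matrix (Fin n) (Fin n) ℝ) (μ : Fin n → ℝ)
    (v : Fin n → EuclideanSpace ℝ (Fin n)) : Prop where
  antitone : Antitone μ
  orthonormal : Orthonormal ℝ v
  eigen : ∀ j, K *ᵥ (v j).ofLp = μ j • (v j).ofLp

/-- The weights of the inducing variables `u_j = ∑ i, v_j^i f(x_i)` for the first `m` of the
vectors `v_j` (for all `n` of them if `m ≥ n`). -/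
def eigenWeights {n : ℕ} (v : Fin n → EuclideanSpace ℝ (Fin n)) (m : ℕ) :
    Matrix (Fin n) {j : Fin n // (j : ℕ) < m} ℝ :=
  Matrix.of fun i j => v j i

/-! ### Rescaled Brownian motion and regular design on `[0,1]` -/

/-- The covariance kernel `k(x,x') = c_n min(x,x')` of the rescaled Brownian motion `√c_n B`,
where `c_n = (n + 1/2)^((1 - 2γ)/(1 + 2γ))`. -/
def rbmKernel (n : ℕ) (γ : ℝ) (x x' : unitInterval) : ℝ :=
  ((n : ℝ) + 1 / 2) ^ ((1 - 2 * γ) / (1 + 2 * γ)) * min (x : ℝ) (x' : ℝ)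

/-- The design points `x_i = i / (n + 1/2)`, `i = 1, …, n`; here `i` is counted from `0`. -/
def designPoint (n : ℕ) (i : Fin n) : unitInterval :=
  ⟨((i : ℕ) + 1 : ℝ) / ((n : ℝ) + 1 / 2), by
    have h : ((i : ℕ) + 1 : ℝ) ≤ n := by exact_mod_cast i.isLt
    exact ⟨by positivity, (div_le_one (by positivity)).2 (by linarith)⟩⟩

/-- The frequentist coverage `P_f (f(x) ∈ C_m(x))` of the SGPR credible interval with critical
value `z`, for the rescaled Brownian motion prior of regularity `γ`, the design above, noise
variance `1`, and inducing variables given by the first `m` of the vectors `v`. -/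
def coverage (n : ℕ) (γ : ℝ) (v : Fin n → EuclideanSpace ℝ (Fin n)) (m : ℕ) (z : ℝ)
    (f : unitInterval → ℝ) (x : unitInterval) : ℝ :=
  (dataLaw 1 (designPoint n) f).real
    {y | f x ∈ credibleSet 1 (rbmKernel n γ) (designPoint n) (eigenWeights v m) z y x}

/-- `P(|N(0,s)| ≤ z)`, where `s` is the variance. -/
def gaussianAbsLe (s : ℝ≥0) (z : ℝ) : ℝ :=
  (gaussianReal 0 s).real {u | |u| ≤ z}

end

end SparseGP

open SparseGP

/-!
The covariance matrix of the prior at the design points is `q (min(i, l))`, which inverts a second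
difference operator with a Dirichlet condition at `0` and a Neumann condition at the right end
(`sum_min_mul_second_difference`). Its eigenvectors are therefore sines, its spectrum is simple, and
the given eigenbasis is the explicit one up to signs (`SparseGP.IsOrderedEigenbasis.eq_rbm`).

In this basis `K_mm` and `K_mn K_nm` are diagonal. The SGPR mean at `x` is a linear form in the
data, so it is Gaussian with some bias `b` and variance `τ²`, and the coverage is the probability
that a normal variable with mean `b / σ` and standard deviation `τ / σ` lies in `[-z, z]`
(`real_dataLaw_mem_credibleSet`). Everything reduces to the limits of `τ / σ` and `b / σ`.

For the posterior built on all eigenvectors, the weights of the mean solve `(K + 1) w = k_x`. The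
two-sided geometric kernel of ratio `ρ`, where `(1 - ρ)² = q ρ`, solves this equation up to
exponentially small boundary terms, and since `K ≥ 0` the true weights are that close to it
(`abs_meanWeights_sub_interpKernel_le`). With `J = (n + 1/2)^(1/(1+2γ))` the inverse bandwidth and
`θ = J / (n + 1/2)`, sums of geometric series give `σ² ~ θ / 2` and `τ² ~ θ / 4`, whence the
variance `1/2` in the limit, while the bias is of order `J^(-α)` on `C^α`, against
`σ ~ J^(-γ) / √2`. The function `(u - x)₊^α` attains this order: its bias times `J^α` converges
to `Γ(α + 1) / 2`, by a Riemann sum (`tendsto_sum_pow_mul_rpow`).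

Dropping the eigenvectors beyond the first `m` changes both variances by a relative `O((J / m)³)`.
It changes the bias by `O(J² / m^(1+α))`, because the sine coefficients of a function in `C^α` decay
like `j^(-α)` (`abs_sum_mul_sin_rbmFreq_le`); the growth condition on `m` is exactly what makes this
negligible with respect to `J^(-α)`.

Multiples of `(u - x)₊^α` then give the last two cases: for `α = γ` the limit of `b / σ` can be
given any value, and the intermediate value theorem reaches every `p` in `(0, p_δ]`; for `α < γ` the
ratio tends to infinity.
-/

open SparseGP

/-! ### The normal distribution -/

theorem pi_gaussianReal_map_sum_mul {n : ℕ} (a w : Fin n → ℝ) :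
    (Measure.pi fun i => gaussianReal (a i) 1).map (fun y => w ⬝ᵥ y) =
      gaussianReal (w ⬝ᵥ a) (Real.toNNReal (w ⬝ᵥ w)) := by
  have hm : Measurable fun y : Fin n → ℝ => w ⬝ᵥ y := by
    unfold dotProduct; fun_prop
  have : IsProbabilityMeasure
      ((Measure.pi fun i => gaussianReal (a i) 1).map (fun y => w ⬝ᵥ y)) :=
    Measure.isProbabilityMeasure_map hm.aemeasurable
  have hw : 0 ≤ w ⬝ᵥ w := Finset.sum_nonneg fun i _ => mul_self_nonneg _
  apply Measure.ext_of_charFun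
  ext t
  rw [charFun_apply_real, integral_map hm.aemeasurable (by fun_prop)]
  have h1 : ∀ y : Fin n → ℝ, Complex.exp (t * ((w ⬝ᵥ y : ℝ) : ℂ) * Complex.I) =
      ∏ i, Complex.exp ((t * w i : ℝ) * (y i : ℂ) * Complex.I) := by
    intro y
    rw [← Complex.exp_sum]
    congr 1
    simp only [dotProduct, Complex.ofReal_sum, Finset.mul_sum, Finset.sum_mul]
    refine Finset.sum_congr rfl fun i _ => ?_
    push_cast; ring
  simp_rw [h1]
  rw [integral_fintype_prod_eq_prod
    (f := fun i (u : ℝ) => Complex.exp ((t * w i : ℝ) * (u : ℂ) * Complex.I))]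
  simp_rw [← charFun_apply_real, charFun_gaussianReal]
  rw [← Complex.exp_sum, Real.coe_toNNReal _ hw]
  congr 1
  simp only [dotProduct, Complex.ofReal_sum, Finset.mul_sum, Finset.sum_mul, Finset.sum_div,
    ← Finset.sum_sub_distrib]
  refine Finset.sum_congr rfl fun i _ => ?_
  push_cast; ring

/-- The distribution function of the standard normal law. -/
noncomputable def stdNormalCDF : ℝ → ℝ := cdf (gaussianReal 0 1)

theorem continuous_stdNormalCDF : Continuous stdNormalCDF := by
  rw [continuous_iff_continuousAt]
  intro t
  have := nullSingletonClass_gaussianReal (μ := 0) (v := 1) one_ne_zero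
  have h : (cdf (gaussianReal 0 1)).measure {t} = 0 := by
    rw [measure_cdf]; simp
  rw [StieltjesFunction.measure_singleton, ENNReal.ofReal_eq_zero] at h
  have hl := (cdf (gaussianReal 0 1)).mono.leftLim_le (le_refl t)
  have he : Function.leftLim (cdf (gaussianReal 0 1)) t = cdf (gaussianReal 0 1) t := by linarith
  have h1 : ContinuousWithinAt (cdf (gaussianReal 0 1)) (Set.Iio t) t :=
    (monotone_cdf _).continuousWithinAt_Iio_iff_leftLim_eq.2 he
  exact continuousAt_iff_continuous_left'_right'.2
    ⟨h1, ((cdf (gaussianReal 0 1)).right_continuous t).mono Set.Ioi_subset_Ici_self⟩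

theorem gaussianReal_real_Icc {a b : ℝ} (hab : a ≤ b) :
    (gaussianReal 0 1).real (Set.Icc a b) = stdNormalCDF b - stdNormalCDF a := by
  have := nullSingletonClass_gaussianReal (μ := 0) (v := 1) one_ne_zero
  have h : (gaussianReal 0 1) (Set.Icc a b) =
      ENNReal.ofReal (stdNormalCDF b - stdNormalCDF a) := by
    rw [← Ioc_ae_eq_Icc.measure_eq]
    conv_lhs => rw [← measure_cdf (gaussianReal 0 1)]
    exact StieltjesFunction.measure_Ioc _ _ _
  rw [measureReal_def, h]
  exact ENNReal.toReal_ofReal (sub_nonneg.2 (monotone_cdf _ hab))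

theorem gaussianReal_real_abs_sub_le (a b : ℝ) {τ c : ℝ} (hτ : 0 < τ) (hc : 0 ≤ c) :
    (gaussianReal b (Real.toNNReal (τ ^ 2))).real {u | |u - a| ≤ c} =
      stdNormalCDF ((c - (b - a)) / τ) - stdNormalCDF ((-c - (b - a)) / τ) := by
  have h1 : gaussianReal b (Real.toNNReal (τ ^ 2)) =
      ((gaussianReal 0 1).map (fun u => τ * u)).map (fun u => u + b) := by
    rw [gaussianReal_map_const_mul, gaussianReal_map_add_const]
    congr 1
    · simp
    · rw [mul_one]; apply NNReal.eq; simp [Real.coe_toNNReal _ (sq_nonneg τ)]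
  have hS : MeasurableSet {u : ℝ | |u - a| ≤ c} := measurableSet_le (by fun_prop) (by fun_prop)
  rw [h1, Measure.map_map (by fun_prop) (by fun_prop),
    map_measureReal_apply (by fun_prop) hS, ← gaussianReal_real_Icc (by gcongr; linarith)]
  congr 1
  ext u
  simp only [Set.mem_preimage, Function.comp, Set.mem_ofPred_eq, Set.mem_Icc, abs_le,
    div_le_iff₀ hτ, le_div_iff₀ hτ]
  constructor <;> rintro ⟨h, h'⟩ <;> constructor <;> linarith

theorem gaussianAbsLe_sq {τ z : ℝ} (hτ : 0 < τ) (hz : 0 ≤ z) :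
    gaussianAbsLe (Real.toNNReal (τ ^ 2)) z =
      stdNormalCDF (z / τ) - stdNormalCDF (-z / τ) := by
  simpa [gaussianAbsLe] using gaussianReal_real_abs_sub_le 0 0 hτ hz

theorem gaussianAbsLe_half {z : ℝ} (hz : 0 ≤ z) :
    gaussianAbsLe (1 / 2) z = stdNormalCDF (z * √2) - stdNormalCDF (-z * √2) := by
  have h := gaussianAbsLe_sq (τ := 1 / √2) (by positivity) hz
  rw [div_pow, Real.sq_sqrt (by norm_num), Real.toNNReal_div (by norm_num)] at h
  simpa using h

theorem gaussianAbsLe_one {z : ℝ} (hz : 0 ≤ z) :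
    gaussianAbsLe 1 z = stdNormalCDF z - stdNormalCDF (-z) := by
  simpa using gaussianAbsLe_sq one_pos hz

theorem pos_of_gaussianAbsLe_pos {s : ℝ≥0} (hs : s ≠ 0) {z : ℝ} (h : 0 < gaussianAbsLe s z) :
    0 < z := by
  by_contra! hz
  have := nullSingletonClass_gaussianReal (μ := 0) (v := s) hs
  have h0 : gaussianReal 0 s {u | |u| ≤ z} = 0 := by
    refine measure_mono_null (t := {0}) (fun u hu => ?_) (measure_singleton 0)
    exact abs_eq_zero.1 (le_antisymm (le_trans hu hz) (abs_nonneg u))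
  simp [gaussianAbsLe, measureReal_def, h0] at h

theorem strictMono_stdNormalCDF : StrictMono stdNormalCDF := by
  intro a b hab
  have h : 0 < (gaussianReal 0 1).real (Set.Icc a b) := by
    refine ENNReal.toReal_pos (fun h0 => ?_) (measure_ne_top _ _)
    have := gaussianReal_absolutelyContinuous' 0 one_ne_zero h0
    simp [Real.volume_Icc] at this
    linarith
  rw [gaussianReal_real_Icc hab.le] at h
  linarith

theorem gaussianAbsLe_one_lt_half {z : ℝ} (hz : 0 < z) :
    gaussianAbsLe 1 z < gaussianAbsLe (1 / 2) z := by
  rw [gaussianAbsLe_one hz.le, gaussianAbsLe_half hz.le]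
  have h2 : z < z * √2 := lt_mul_of_one_lt_right hz (by
    rw [Real.lt_sqrt] <;> norm_num)
  have h3 := strictMono_stdNormalCDF h2
  have h4 := strictMono_stdNormalCDF (neg_lt_neg h2)
  rw [neg_mul]
  linarith

/-- The probability that a normal variable with mean `β` and standard deviation `1 / r` lies in
`[-z, z]`. -/
noncomputable def normalIntervalProb (z β r : ℝ) : ℝ :=
  stdNormalCDF ((z - β) * r) - stdNormalCDF ((-z - β) * r)

theorem continuous_normalIntervalProb (z r : ℝ) :
    Continuous fun β => normalIntervalProb z β r := by
  unfold normalIntervalProb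
  have := continuous_stdNormalCDF
  fun_prop

theorem tendsto_normalIntervalProb {z β₀ r₀ : ℝ} {β r : ℕ → ℝ} (hβ : Tendsto β atTop (𝓝 β₀))
    (hr : Tendsto r atTop (𝓝 r₀)) :
    Tendsto (fun n => normalIntervalProb z (β n) (r n)) atTop
      (𝓝 (normalIntervalProb z β₀ r₀)) := by
  unfold normalIntervalProb
  refine Tendsto.sub ?_ ?_ <;>
  exact (continuous_stdNormalCDF.tendsto _).comp ((tendsto_const_nhds.sub hβ).mul hr)

theorem tendsto_normalIntervalProb_zero {ι : Type*} {l : Filter ι} {z r₀ : ℝ} {β r : ι → ℝ}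
    (hβ : Tendsto β l atTop) (hr : Tendsto r l (𝓝 r₀)) (hr₀ : 0 < r₀) :
    Tendsto (fun n => normalIntervalProb z (β n) (r n)) l (𝓝 0) := by
  have h : ∀ c : ℝ, Tendsto (fun n => stdNormalCDF ((c - β n) * r n)) l (𝓝 0) := fun c =>
    (tendsto_cdf_atBot _).comp
      ((tendsto_atBot_add_const_left _ c (tendsto_neg_atTop_atBot.comp hβ)).atBot_mul_pos hr₀ hr)
  simpa [normalIntervalProb] using (h z).sub (h (-z))

theorem exists_normalIntervalProb_eq {z r p : ℝ} (hr : 0 < r) (hp : 0 < p)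
    (hp' : p ≤ normalIntervalProb z 0 r) : ∃ β, normalIntervalProb z β r = p := by
  have h0 := tendsto_normalIntervalProb_zero (z := z) tendsto_id
    (tendsto_const_nhds (x := r) (f := atTop)) hr
  obtain ⟨β, hβ⟩ := (h0.eventually (gt_mem_nhds hp)).exists
  exact mem_range_of_exists_le_of_exists_ge (continuous_normalIntervalProb z r)
    ⟨β, le_of_lt hβ⟩ ⟨0, hp'⟩

theorem gaussianAbsLe_half_eq {z : ℝ} (hz : 0 ≤ z) :
    gaussianAbsLe (1 / 2) z = normalIntervalProb z 0 √2 := by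
  rw [gaussianAbsLe_half hz, normalIntervalProb, sub_zero, sub_zero]

/-! ### The SGPR in an eigenbasis of the prior covariance matrix -/

section Eigenbasis

variable {n : ℕ} {K : Matrix (Fin n) (Fin n) ℝ} {μ : Fin n → ℝ}
  {v : Fin n → EuclideanSpace ℝ (Fin n)}

theorem dotProduct_of_orthonormal (hv : Orthonormal ℝ v) (j j' : Fin n) :
    (v j).ofLp ⬝ᵥ (v j').ofLp = if j = j' then 1 else 0 := by
  have h := orthonormal_iff_ite.1 hv j j'
  rw [← h, EuclideanSpace.inner_eq_star_dotProduct, star_trivial, dotProduct_comm]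

theorem sum_dotProduct_mul_apply (hv : Orthonormal ℝ v) (f : Fin n → ℝ) (i : Fin n) :
    ∑ j, ((v j).ofLp ⬝ᵥ f) * v j i = f i := by
  have h1 : (Matrix.of fun j i => v j i) * (Matrix.of fun j i => v j i)ᵀ =
      (1 : Matrix (Fin n) (Fin n) ℝ) := by
    ext j j'
    rw [Matrix.mul_apply', Matrix.one_apply, ← dotProduct_of_orthonormal hv]
    rfl
  have h2 := congrArg (fun M => (M *ᵥ f) i) (mul_eq_one_comm.1 h1)
  simp only [← Matrix.mulVec_mulVec, Matrix.one_mulVec] at h2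
  rw [← h2]
  exact Finset.sum_congr rfl fun j _ => mul_comm _ _

theorem sum_dotProduct_mul_dotProduct (hv : Orthonormal ℝ v) (f g : Fin n → ℝ) :
    ∑ j, ((v j).ofLp ⬝ᵥ f) * ((v j).ofLp ⬝ᵥ g) = f ⬝ᵥ g := by
  simp_rw [dotProduct.eq_1 _ g, Finset.mul_sum]
  rw [Finset.sum_comm]
  refine Finset.sum_congr rfl fun i _ => ?_
  rw [← sum_dotProduct_mul_apply hv f i, Finset.sum_mul]
  exact Finset.sum_congr rfl fun j _ => by ring

/-- A symmetric matrix with simple spectrum has only one ordered orthonormal eigenbasis, up to the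
signs of the eigenvectors. -/
theorem SparseGP.IsOrderedEigenbasis.eq_of_strictAnti (hK : Kᵀ = K) (hv : IsOrderedEigenbasis K μ v)
    {lam : Fin n → ℝ} {e : Fin n → EuclideanSpace ℝ (Fin n)} (he : Orthonormal ℝ e)
    (heig : ∀ j, K *ᵥ (e j).ofLp = lam j • (e j).ofLp) (hlam : StrictAnti lam) :
    μ = lam ∧ ∀ j, ∃ c : ℝ, |c| = 1 ∧ ∀ i, v j i = c * e j i := by
  have hsym : ∀ i j, (lam i - μ j) * ((e i).ofLp ⬝ᵥ (v j).ofLp) = 0 := by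
    intro i j
    have h : (e i).ofLp ⬝ᵥ K *ᵥ (v j).ofLp = K *ᵥ (e i).ofLp ⬝ᵥ (v j).ofLp := by
      rw [Matrix.dotProduct_mulVec, ← Matrix.mulVec_transpose, hK]
    rw [hv.eigen, heig, dotProduct_smul, smul_dotProduct, smul_eq_mul, smul_eq_mul] at h
    linarith
  have hex : ∀ j, ∃ i, (e i).ofLp ⬝ᵥ (v j).ofLp ≠ 0 := by
    intro j
    by_contra! h
    have h1 := sum_dotProduct_mul_dotProduct he (v j).ofLp (v j).ofLp
    rw [dotProduct_of_orthonormal hv.orthonormal] at h1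
    simp [h] at h1
  choose π hπ using hex
  have hμ : ∀ j, μ j = lam (π j) := fun j => by
    have := (mul_eq_zero.1 (hsym (π j) j)).resolve_right (hπ j)
    linarith
  have hz : ∀ i j, i ≠ π j → (e i).ofLp ⬝ᵥ (v j).ofLp = 0 := fun i j hij => by
    refine (mul_eq_zero.1 (hsym i j)).resolve_left fun h => hij (hlam.injective ?_)
    rw [← hμ]; linarith
  have hexp : ∀ j i, v j i = ((e (π j)).ofLp ⬝ᵥ (v j).ofLp) * e (π j) i := by
    intro j i
    rw [← sum_dotProduct_mul_apply he (v j).ofLp i]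
    exact Finset.sum_eq_single _ (fun k _ hk => by rw [hz k j hk, zero_mul]) (by simp)
  have hinj : Function.Injective π := by
    intro j j' hjj
    by_contra hne
    have h1 := sum_dotProduct_mul_dotProduct he (v j).ofLp (v j').ofLp
    rw [dotProduct_of_orthonormal hv.orthonormal, if_neg hne,
      Finset.sum_eq_single (π j) (fun k _ hk => by rw [hz k j hk, zero_mul]) (by simp)] at h1
    rcases mul_eq_zero.1 h1 with h | h
    · exact hπ j h
    · exact hπ j' (hjj ▸ h)
  -- `π` is injective and respects the two orderings of the eigenvalues, so it is the identity.
  have hmono : StrictMono π := by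
    refine Monotone.strictMono_of_injective (fun j j' hjj => ?_) hinj
    have := hv.antitone hjj
    rw [hμ, hμ] at this
    exact hlam.le_iff_ge.1 this
  have hid : π = id := by
    refine (hmono.range_inj strictMono_id).1 ?_
    rw [(Finite.injective_iff_surjective.1 hinj).range_eq, Set.range_id]
  refine ⟨funext fun j => by rw [hμ, hid, id], fun j => ⟨_, ?_, fun i => by
    have := hexp j i
    rwa [hid, id] at this⟩⟩
  have h1 := sum_dotProduct_mul_dotProduct he (v j).ofLp (v j).ofLp
  rw [dotProduct_of_orthonormal hv.orthonormal, if_pos rfl,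
    Finset.sum_eq_single j (fun k _ hk => by
      rw [hz k j (by rwa [hid, id]), zero_mul]) (by simp)] at h1
  rcases mul_self_eq_one_iff.1 h1 with h | h
  · rw [h, abs_one]
  · rw [h, abs_neg, abs_one]

end Eigenbasis

theorem inv_diagonal_mulVec {ι : Type*} [Fintype ι] [DecidableEq ι] {a : ι → ℝ}
    (ha : ∀ j, a j ≠ 0) (y : ι → ℝ) :
    (Matrix.diagonal a)⁻¹ *ᵥ y = fun j => y j / a j := by
  have h : (Matrix.diagonal a)⁻¹ = Matrix.diagonal fun j => (a j)⁻¹ := by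
    refine Matrix.inv_eq_right_inv ?_
    rw [Matrix.diagonal_mul_diagonal, ← Matrix.diagonal_one]
    congr 1
    exact funext fun j => mul_inv_cancel₀ (ha j)
  rw [h]
  ext j
  rw [Matrix.mulVec_diagonal, div_eq_inv_mul]

section SGPR

variable {X : Type*} {n : ℕ} {k : X → X → ℝ} {d : Fin n → X} {μ : Fin n → ℝ}
  {v : Fin n → EuclideanSpace ℝ (Fin n)}

/-- The coefficient of the cross-covariance vector `(k(x, x_i))_i` along the eigenvector `v_j`. -/
noncomputable def eigenCov (k : X → X → ℝ) (d : Fin n → X) (v : Fin n → EuclideanSpace ℝ (Fin n))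
    (x : X) (j : Fin n) : ℝ :=
  (v j).ofLp ⬝ᵥ fun i => k x (d i)

/-- The weights `w` for which the SGPR mean at `x` built on the first `m` eigenvectors is
`∑ i, w i * y i`. -/
noncomputable def meanWeights (k : X → X → ℝ) (d : Fin n → X) (μ : Fin n → ℝ)
    (v : Fin n → EuclideanSpace ℝ (Fin n)) (m : ℕ) (x : X) (i : Fin n) : ℝ :=
  ∑ j with j.val < m, eigenCov k d v x j / (1 + μ j) * v j i

theorem covDataInducing_eigenWeights (hv : IsOrderedEigenbasis (kernelMatrix k d) μ v) (m : ℕ)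
    (i : Fin n) (j : {j : Fin n // (j : ℕ) < m}) :
    covDataInducing k d (eigenWeights v m) i j = μ j * v j i := by
  have h := congrFun (hv.eigen j) i
  simp only [Matrix.mulVec, dotProduct, kernelMatrix, Matrix.of_apply, Pi.smul_apply,
    smul_eq_mul] at h
  rw [← h]
  simp only [covDataInducing, covAt, eigenWeights, Matrix.of_apply]
  exact Finset.sum_congr rfl fun _ _ => mul_comm _ _

theorem covInducing_eigenWeights (hv : IsOrderedEigenbasis (kernelMatrix k d) μ v) (m : ℕ) :
    covInducing k d (eigenWeights v m) = Matrix.diagonal fun j : {j : Fin n // (j : ℕ) < m} => μ j := by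
  ext j j'
  have h : covInducing k d (eigenWeights v m) j j' =
      (v j).ofLp ⬝ᵥ (kernelMatrix k d *ᵥ (v j').ofLp) := by
    simp only [covInducing, eigenWeights, Matrix.of_apply, dotProduct, Matrix.mulVec,
      kernelMatrix, Finset.mul_sum]
    exact Finset.sum_congr rfl fun _ _ => Finset.sum_congr rfl fun _ _ => by ring
  rw [h, hv.eigen, dotProduct_smul, dotProduct_of_orthonormal hv.orthonormal,
    Matrix.diagonal_apply]
  by_cases hj : j = j'
  · simp [hj]
  · simp [hj, Subtype.val_injective.ne hj]

theorem transpose_mul_covDataInducing_eigenWeights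
    (hv : IsOrderedEigenbasis (kernelMatrix k d) μ v) (m : ℕ) :
    (covDataInducing k d (eigenWeights v m))ᵀ * covDataInducing k d (eigenWeights v m) =
      Matrix.diagonal fun j : {j : Fin n // (j : ℕ) < m} => μ j ^ 2 := by
  ext j j'
  have h : ((covDataInducing k d (eigenWeights v m))ᵀ *
      covDataInducing k d (eigenWeights v m)) j j' =
      μ j * μ j' * ((v j).ofLp ⬝ᵥ (v j').ofLp) := by
    simp only [Matrix.mul_apply, Matrix.transpose_apply, covDataInducing_eigenWeights hv,
      dotProduct, Finset.mul_sum]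
    exact Finset.sum_congr rfl fun _ _ => by ring
  rw [h, dotProduct_of_orthonormal hv.orthonormal, Matrix.diagonal_apply]
  by_cases hj : j = j'
  · simp [hj, sq]
  · simp [hj, Subtype.val_injective.ne hj]

theorem meanWeights_dotProduct (m : ℕ) (x : X) (y : Fin n → ℝ) :
    meanWeights k d μ v m x ⬝ᵥ y =
      ∑ j with j.val < m, eigenCov k d v x j / (1 + μ j) * ((v j).ofLp ⬝ᵥ y) := by
  simp only [meanWeights, dotProduct, Finset.sum_mul, Finset.mul_sum]
  rw [Finset.sum_comm]
  exact Finset.sum_congr rfl fun _ _ => Finset.sum_congr rfl fun _ _ => by ring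

theorem sgprMean_eigenWeights (hv : IsOrderedEigenbasis (kernelMatrix k d) μ v)
    (hμ : ∀ j, 0 < μ j) (m : ℕ) (y : Fin n → ℝ) (x : X) :
    sgprMean 1 k d (eigenWeights v m) y x = meanWeights k d μ v m x ⬝ᵥ y := by
  have h1 : ∀ j : {j : Fin n // (j : ℕ) < m},
      ((covDataInducing k d (eigenWeights v m))ᵀ *ᵥ y) j = μ j * ((v j).ofLp ⬝ᵥ y) := by
    intro j
    simp only [Matrix.mulVec, dotProduct, Matrix.transpose_apply,
      covDataInducing_eigenWeights hv, Finset.mul_sum]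
    exact Finset.sum_congr rfl fun _ _ => by ring
  simp only [sgprMean, covInducing_eigenWeights hv, NNReal.coe_one, one_smul,
    transpose_mul_covDataInducing_eigenWeights hv, Matrix.diagonal_add]
  rw [inv_diagonal_mulVec fun j => by have := hμ j; positivity, meanWeights_dotProduct,
    Finset.sum_subtype (p := fun j : Fin n => (j : ℕ) < m) _ (by simp)]
  refine Finset.sum_congr rfl fun j _ => ?_
  have := hμ j
  beta_reduce
  rw [h1, show covAt k d (eigenWeights v m) x j = eigenCov k d v x j from rfl]
  field_simp

theorem sgprCov_eigenWeights (hv : IsOrderedEigenbasis (kernelMatrix k d) μ v)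
    (hμ : ∀ j, 0 < μ j) (m : ℕ) (x : X) :
    sgprCov 1 k d (eigenWeights v m) x x =
      k x x - ∑ j with j.val < m, eigenCov k d v x j ^ 2 / (1 + μ j) := by
  simp only [sgprCov, covInducing_eigenWeights hv, NNReal.coe_one, inv_one, one_smul,
    transpose_mul_covDataInducing_eigenWeights hv, Matrix.diagonal_add]
  rw [inv_diagonal_mulVec fun j => by have := hμ j; positivity,
    inv_diagonal_mulVec fun j => by have := hμ j; positivity,
    Finset.sum_subtype (p := fun j : Fin n => (j : ℕ) < m) _ (by simp), sub_add]
  congr 1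
  simp only [dotProduct, ← Finset.sum_sub_distrib]
  refine Finset.sum_congr rfl fun j _ => ?_
  have := hμ j
  rw [show covAt k d (eigenWeights v m) x j = eigenCov k d v x j from rfl]
  field_simp
  ring

theorem meanWeights_dotProduct_self (hv : Orthonormal ℝ v) (m : ℕ) (x : X) :
    meanWeights k d μ v m x ⬝ᵥ meanWeights k d μ v m x =
      ∑ j with j.val < m, (eigenCov k d v x j / (1 + μ j)) ^ 2 := by
  rw [meanWeights_dotProduct]
  refine Finset.sum_congr rfl fun j hj => ?_
  rw [sq]
  congr 1
  rw [dotProduct_comm, meanWeights_dotProduct]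
  simp only [dotProduct_of_orthonormal hv]
  simp [(Finset.mem_filter.1 hj).2]

/-- The coverage of the credible interval, through the bias `b` and the standard deviation `τ` of
the posterior mean and the posterior standard deviation `σ`. -/
theorem real_dataLaw_mem_credibleSet (hv : IsOrderedEigenbasis (kernelMatrix k d) μ v)
    (hμ : ∀ j, 0 < μ j) (m : ℕ) (x : X) (f : X → ℝ) {z : ℝ} (hz : 0 ≤ z) {σ τ : ℝ}
    (hσ : 0 < σ) (hτ : 0 < τ) (hσ2 : sgprCov 1 k d (eigenWeights v m) x x = σ ^ 2)
    (hτ2 : meanWeights k d μ v m x ⬝ᵥ meanWeights k d μ v m x = τ ^ 2) :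
    (dataLaw 1 d f).real {y | f x ∈ credibleSet 1 k d (eigenWeights v m) z y x} =
      normalIntervalProb z (((meanWeights k d μ v m x ⬝ᵥ fun i => f (d i)) - f x) / σ)
        (σ / τ) := by
  have hS : MeasurableSet {u : ℝ | |u - f x| ≤ z * σ} :=
    measurableSet_le (by fun_prop) (by fun_prop)
  have h := gaussianReal_real_abs_sub_le (f x) (meanWeights k d μ v m x ⬝ᵥ fun i => f (d i)) hτ
    (mul_nonneg hz hσ.le)
  have hm : Measurable fun y : Fin n → ℝ => meanWeights k d μ v m x ⬝ᵥ y := by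
    unfold dotProduct; fun_prop
  rw [← hτ2, ← pi_gaussianReal_map_sum_mul, map_measureReal_apply hm hS] at h
  have hset : {y | f x ∈ credibleSet 1 k d (eigenWeights v m) z y x} =
      (fun y => meanWeights k d μ v m x ⬝ᵥ y) ⁻¹' {u : ℝ | |u - f x| ≤ z * σ} := by
    ext y
    simp only [credibleSet, sgprMean_eigenWeights hv hμ, hσ2, Real.sqrt_sq hσ.le,
      Set.mem_ofPred_eq, Set.mem_Icc, Set.mem_preimage, abs_le]
    constructor <;> rintro ⟨h, h'⟩ <;> constructor <;> linarith
  rw [hset, dataLaw, h, normalIntervalProb]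
  congr 2 <;> field_simp

end SGPR

/-! ### The Brownian motion covariance matrix and its spectrum -/

/-- The matrix `(min(i, l))` inverts the second difference operator with a Dirichlet condition at
`0` and a Neumann condition at the right end; the last two terms are the boundary defects. -/
theorem sum_min_mul_second_difference (u : ℕ → ℝ) {n p : ℕ} (hp : p ≤ n) :
    ∑ i ∈ Finset.range n, (min p (i + 1) : ℕ) * (2 * u (i + 1) - u i - u (i + 2)) =
      u p - u 0 - p * (u (n + 1) - u n) := by
  induction n, hp using Nat.le_induction with
  | base =>
    have h : ∀ r, ∑ i ∈ Finset.range r, ((i + 1 : ℕ) : ℝ) * (2 * u (i + 1) - u i - u (i + 2)) =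
        u r - u 0 - r * (u (r + 1) - u r) := by
      intro r
      induction r with
      | zero => simp
      | succ r ih => rw [Finset.sum_range_succ, ih]; push_cast; ring
    rw [← h]
    refine Finset.sum_congr rfl fun i hi => ?_
    rw [min_eq_right (Finset.mem_range.1 hi)]
  | succ n hn ih =>
    rw [Finset.sum_range_succ, ih, min_eq_left (by omega)]
    ring

/-- The common factor `q` of the entries `q * min(i, l)` of the prior covariance matrix. -/
noncomputable def rbmScale (n : ℕ) (γ : ℝ) : ℝ :=
  ((n : ℝ) + 1 / 2) ^ ((1 - 2 * γ) / (1 + 2 * γ)) / ((n : ℝ) + 1 / 2)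

theorem rbmScale_pos (n : ℕ) (γ : ℝ) : 0 < rbmScale n γ := by unfold rbmScale; positivity

theorem rbmKernel_eq (n : ℕ) (γ : ℝ) (x x' : unitInterval) :
    rbmKernel n γ x x' =
      rbmScale n γ * min (x * ((n : ℝ) + 1 / 2)) (x' * ((n : ℝ) + 1 / 2)) := by
  have hN : (0 : ℝ) < (n : ℝ) + 1 / 2 := by positivity
  rw [rbmKernel, rbmScale, ← min_mul_of_nonneg _ _ hN.le]
  field_simp

theorem designPoint_mul (n : ℕ) (i : Fin n) :
    (designPoint n i : ℝ) * ((n : ℝ) + 1 / 2) = (i + 1 : ℕ) := by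
  have hN : (n : ℝ) + 1 / 2 ≠ 0 := by positivity
  simp only [designPoint]
  rw [div_mul_cancel₀ _ hN]
  push_cast; ring

theorem rbmKernel_designPoint (n : ℕ) (γ : ℝ) (x : unitInterval) (i : Fin n) :
    rbmKernel n γ x (designPoint n i) =
      rbmScale n γ * min (x * ((n : ℝ) + 1 / 2)) (i + 1 : ℕ) := by
  rw [rbmKernel_eq, designPoint_mul]

theorem kernelMatrix_rbmKernel_apply (n : ℕ) (γ : ℝ) (i i' : Fin n) :
    kernelMatrix (rbmKernel n γ) (designPoint n) i i' =
      rbmScale n γ * (min (i.val + 1) (i'.val + 1) : ℕ) := by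
  rw [kernelMatrix, Matrix.of_apply, rbmKernel_designPoint, designPoint_mul, Nat.cast_min]

theorem kernelMatrix_rbmKernel_transpose (n : ℕ) (γ : ℝ) :
    (kernelMatrix (rbmKernel n γ) (designPoint n))ᵀ =
      kernelMatrix (rbmKernel n γ) (designPoint n) := by
  ext i i'
  rw [Matrix.transpose_apply, kernelMatrix_rbmKernel_apply, kernelMatrix_rbmKernel_apply, min_comm]

theorem kernelMatrix_rbmKernel_mulVec (n : ℕ) (γ : ℝ) (u : ℕ → ℝ) (i : Fin n) :
    (kernelMatrix (rbmKernel n γ) (designPoint n) *ᵥ fun l => u l) i =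
      rbmScale n γ * ∑ l ∈ Finset.range n, (min (i.val + 1) (l + 1) : ℕ) * u l := by
  simp only [Matrix.mulVec, dotProduct, kernelMatrix_rbmKernel_apply]
  rw [Finset.mul_sum, Finset.sum_range]
  exact Finset.sum_congr rfl fun l _ => by ring

/-- The frequency `(j - 1/2) π / (n + 1/2)` of the `j`-th eigenvector; `j` is counted from `0`. -/
noncomputable def rbmFreq (n j : ℕ) : ℝ := (j + 1 / 2) * Real.pi / ((n : ℝ) + 1 / 2)

theorem rbmFreq_pos (n j : ℕ) : 0 < rbmFreq n j := by
  have := Real.pi_pos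
  unfold rbmFreq; positivity

theorem rbmFreq_lt_pi {n j : ℕ} (hj : j < n) : rbmFreq n j < Real.pi := by
  have hjn : (j : ℝ) < n := by exact_mod_cast hj
  rw [rbmFreq, div_lt_iff₀ (by positivity), mul_comm]
  have := Real.pi_pos
  gcongr

theorem rbmFreq_mul (n j : ℕ) : rbmFreq n j * ((n : ℝ) + 1 / 2) = (j + 1 / 2) * Real.pi := by
  rw [rbmFreq, div_mul_cancel₀ _ (by positivity)]

theorem rbmFreq_lt_rbmFreq {n j j' : ℕ} (h : j < j') : rbmFreq n j < rbmFreq n j' := by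
  have hjn : (j : ℝ) < j' := by exact_mod_cast h
  have := Real.pi_pos
  unfold rbmFreq
  gcongr

/-- The eigenvalues of the prior covariance matrix. -/
noncomputable def rbmEigenvalue (n : ℕ) (γ : ℝ) (j : ℕ) : ℝ :=
  rbmScale n γ / (4 * Real.sin (rbmFreq n j / 2) ^ 2)

theorem sin_half_rbmFreq_pos {n j : ℕ} (hj : j < n) : 0 < Real.sin (rbmFreq n j / 2) :=
  Real.sin_pos_of_pos_of_lt_pi (by have := rbmFreq_pos n j; positivity)
    (by have := rbmFreq_pos n j; have := rbmFreq_lt_pi hj; linarith)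

theorem rbmEigenvalue_pos {n j : ℕ} (γ : ℝ) (hj : j < n) : 0 < rbmEigenvalue n γ j := by
  have := sin_half_rbmFreq_pos hj
  have := rbmScale_pos n γ
  unfold rbmEigenvalue; positivity

theorem strictAnti_rbmEigenvalue (n : ℕ) (γ : ℝ) :
    StrictAnti fun j : Fin n => rbmEigenvalue n γ j := by
  intro j j' h
  have h1 := sin_half_rbmFreq_pos j.isLt
  have h2 : Real.sin (rbmFreq n j / 2) < Real.sin (rbmFreq n j' / 2) := by
    have h3 := rbmFreq_pos n j
    have h4 := rbmFreq_lt_pi j'.isLt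
    have h5 := rbmFreq_lt_rbmFreq (n := n) h
    refine Real.strictMonoOn_sin ⟨by linarith, by linarith⟩ ⟨by linarith, by linarith⟩ ?_
    linarith
  have := rbmScale_pos n γ
  simp only [rbmEigenvalue]
  gcongr

theorem rbmEigenvalue_le {n j : ℕ} (γ : ℝ) (hj : j < n) :
    rbmEigenvalue n γ j ≤ rbmScale n γ * ((n : ℝ) + 1 / 2) ^ 2 / ((j : ℝ) + 1) ^ 2 := by
  have hs : ((j : ℝ) + 1) / (2 * ((n : ℝ) + 1 / 2)) ≤ Real.sin (rbmFreq n j / 2) := by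
    refine le_trans ?_ (Real.mul_le_sin (by have := rbmFreq_pos n j; positivity)
      (by have := rbmFreq_lt_pi hj; linarith))
    have : 2 / Real.pi * (rbmFreq n j / 2) = (j + 1 / 2) / ((n : ℝ) + 1 / 2) := by
      have := Real.pi_pos
      unfold rbmFreq; field_simp
    rw [this, div_le_div_iff₀ (by positivity) (by positivity)]
    have hj0 : (0 : ℝ) ≤ j := by positivity
    have hn0 : (0 : ℝ) ≤ n := by positivity
    nlinarith
  have hq := rbmScale_pos n γ
  calc rbmEigenvalue n γ j
      ≤ rbmScale n γ / (4 * (((j : ℝ) + 1) / (2 * ((n : ℝ) + 1 / 2))) ^ 2) := by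
        unfold rbmEigenvalue; gcongr
    _ = _ := by field_simp; norm_num

/-- The orthonormal eigenvectors of the prior covariance matrix. -/
noncomputable def rbmEigenvector (n : ℕ) (j : Fin n) : EuclideanSpace ℝ (Fin n) :=
  WithLp.toLp 2 fun i => √(2 / ((n : ℝ) + 1 / 2)) * Real.sin (rbmFreq n j * (i + 1 : ℕ))

theorem kernelMatrix_mulVec_rbmEigenvector (n : ℕ) (γ : ℝ) (j : Fin n) :
    kernelMatrix (rbmKernel n γ) (designPoint n) *ᵥ (rbmEigenvector n j).ofLp =
      rbmEigenvalue n γ j • (rbmEigenvector n j).ofLp := by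
  ext i
  set ω := rbmFreq n j
  have hs := sin_half_rbmFreq_pos j.isLt
  have hdiff : ∀ l : ℕ, 2 * Real.sin (ω * (l + 1 : ℕ)) - Real.sin (ω * l) -
      Real.sin (ω * (l + 2 : ℕ)) = 4 * Real.sin (ω / 2) ^ 2 * Real.sin (ω * (l + 1 : ℕ)) := by
    intro l
    have e1 : ω * (l : ℝ) = ω * (l + 1 : ℕ) - ω := by push_cast; ring
    have e2 : ω * (l + 2 : ℕ) = ω * (l + 1 : ℕ) + ω := by push_cast; ring
    have e3 : Real.cos ω = 1 - 2 * Real.sin (ω / 2) ^ 2 := by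
      have := Real.cos_sq' (ω / 2)
      rw [show ω = 2 * (ω / 2) by ring, Real.cos_two_mul, this]
      ring_nf
    rw [e1, e2, Real.sin_add, Real.sin_sub, e3]
    ring
  -- The Neumann condition at `n + 1/2`, which fixes the frequencies.
  have hend : Real.sin (ω * (n + 1 : ℕ)) - Real.sin (ω * n) = 0 := by
    have e1 : (ω * (n + 1 : ℕ) + ω * n) / 2 = j * Real.pi + Real.pi / 2 := by
      have := rbmFreq_mul n j
      push_cast; linarith
    rw [Real.sin_sub_sin, e1, Real.cos_add_pi_div_two, Real.sin_nat_mul_pi]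
    ring
  have key := sum_min_mul_second_difference (fun l => Real.sin (ω * l)) (n := n) (p := i + 1)
    i.isLt
  simp only [hdiff, hend] at key
  have hL := kernelMatrix_rbmKernel_mulVec n γ
    (fun l => √(2 / ((n : ℝ) + 1 / 2)) * Real.sin (ω * (l + 1 : ℕ))) i
  refine hL.trans ?_
  have e4 : ∑ l ∈ Finset.range n, ((min (i.val + 1) (l + 1) : ℕ) : ℝ) *
      (√(2 / ((n : ℝ) + 1 / 2)) * Real.sin (ω * (l + 1 : ℕ))) =
      √(2 / ((n : ℝ) + 1 / 2)) / (4 * Real.sin (ω / 2) ^ 2) *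
      ∑ l ∈ Finset.range n, ((min (i.val + 1) (l + 1) : ℕ) : ℝ) *
      (4 * Real.sin (ω / 2) ^ 2 * Real.sin (ω * (l + 1 : ℕ))) := by
    rw [Finset.mul_sum]
    refine Finset.sum_congr rfl fun l _ => ?_
    have hs' : Real.sin (ω / 2) ≠ 0 := hs.ne'
    field_simp
  rw [e4, key]
  simp only [Pi.smul_apply, smul_eq_mul, rbmEigenvector, rbmEigenvalue]
  simp [ω]
  ring

/-- The sum of squares is evaluated by telescoping `2 sin ω cos (2 ω i)`; the end term vanishes as
`(2 n + 1) ω` is a multiple of `π`. -/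
theorem rbmEigenvector_dotProduct_self (n : ℕ) (j : Fin n) :
    (rbmEigenvector n j).ofLp ⬝ᵥ (rbmEigenvector n j).ofLp = 1 := by
  set ω := rbmFreq n j
  have hω : 0 < Real.sin ω := Real.sin_pos_of_pos_of_lt_pi (rbmFreq_pos n j) (rbmFreq_lt_pi j.isLt)
  have htel : ∀ r : ℕ, ∑ i ∈ Finset.range r, 2 * Real.sin ω * Real.cos (2 * (ω * (i + 1 : ℕ))) =
      Real.sin (ω * (2 * r + 1)) - Real.sin ω := by
    intro r
    induction r with
    | zero => simp
    | succ r ih =>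
      rw [Finset.sum_range_succ, ih]
      have e1 : ω * (2 * (r : ℝ) + 1) = 2 * (ω * (r + 1 : ℕ)) - ω := by push_cast; ring
      have e2 : ω * (2 * ((r + 1 : ℕ) : ℝ) + 1) = 2 * (ω * (r + 1 : ℕ)) + ω := by push_cast; ring
      rw [e1, e2, Real.sin_add, Real.sin_sub]
      ring
  have h0 : Real.sin (ω * (2 * n + 1)) = 0 := by
    have : ω * (2 * (n : ℝ) + 1) = ((2 * j + 1 : ℕ) : ℝ) * Real.pi := by
      have := rbmFreq_mul n j
      push_cast; linarith
    rw [this, Real.sin_nat_mul_pi]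
  have hcos : ∑ i ∈ Finset.range n, Real.cos (2 * (ω * (i + 1 : ℕ))) = -1 / 2 := by
    have := htel n
    rw [← Finset.mul_sum, h0] at this
    have h2 : Real.sin ω * (∑ i ∈ Finset.range n, Real.cos (2 * (ω * (i + 1 : ℕ))) + 1 / 2) = 0 := by
      linarith
    rcases mul_eq_zero.1 h2 with h | h
    · exact absurd h hω.ne'
    · linarith
  have hN : (0 : ℝ) ≤ 2 / ((n : ℝ) + 1 / 2) := by positivity
  have e : (rbmEigenvector n j).ofLp ⬝ᵥ (rbmEigenvector n j).ofLp =
      ∑ i ∈ Finset.range n, 2 / ((n : ℝ) + 1 / 2) *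
        (1 / 2 - Real.cos (2 * (ω * (i + 1 : ℕ))) / 2) := by
    rw [Finset.sum_range]
    refine Finset.sum_congr rfl fun i _ => ?_
    rw [← Real.sin_sq_eq_half_sub]
    simp only [rbmEigenvector]
    rw [mul_mul_mul_comm, Real.mul_self_sqrt hN, sq]
  rw [e, ← Finset.mul_sum, Finset.sum_sub_distrib,
    ← Finset.sum_div _ (fun i => Real.cos (2 * (ω * (i + 1 : ℕ)))), hcos]
  simp
  field_simp
  ring

theorem orthonormal_rbmEigenvector (n : ℕ) : Orthonormal ℝ (rbmEigenvector n) := by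
  rw [orthonormal_iff_ite]
  intro j j'
  rw [EuclideanSpace.inner_eq_star_dotProduct, star_trivial, dotProduct_comm]
  split_ifs with h
  · rw [h, rbmEigenvector_dotProduct_self]
  -- The eigenvectors do not depend on `γ`: the kernel matrix at `γ = 1` serves as well as any.
  · have h1 : (rbmEigenvector n j).ofLp ⬝ᵥ
        kernelMatrix (rbmKernel n 1) (designPoint n) *ᵥ (rbmEigenvector n j').ofLp =
        kernelMatrix (rbmKernel n 1) (designPoint n) *ᵥ (rbmEigenvector n j).ofLp ⬝ᵥ
          (rbmEigenvector n j').ofLp := by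
      rw [Matrix.dotProduct_mulVec, ← Matrix.mulVec_transpose, kernelMatrix_rbmKernel_transpose]
    rw [kernelMatrix_mulVec_rbmEigenvector, kernelMatrix_mulVec_rbmEigenvector, dotProduct_smul,
      smul_dotProduct, smul_eq_mul, smul_eq_mul, ← sub_eq_zero, ← sub_mul] at h1
    refine (mul_eq_zero.1 h1).resolve_left fun h2 => h ?_
    exact ((strictAnti_rbmEigenvalue n 1).injective (sub_eq_zero.1 h2)).symm

/-- Every ordered eigenbasis of the prior covariance matrix is the explicit one, up to signs. -/
theorem SparseGP.IsOrderedEigenbasis.eq_rbm {n : ℕ} {γ : ℝ} {μ : Fin n → ℝ}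
    {v : Fin n → EuclideanSpace ℝ (Fin n)}
    (hv : IsOrderedEigenbasis (kernelMatrix (rbmKernel n γ) (designPoint n)) μ v) :
    (∀ j, μ j = rbmEigenvalue n γ j) ∧
      ∀ j, ∃ c : ℝ, |c| = 1 ∧ ∀ i, v j i = c * rbmEigenvector n j i := by
  obtain ⟨h1, h2⟩ := hv.eq_of_strictAnti (kernelMatrix_rbmKernel_transpose n γ)
    (orthonormal_rbmEigenvector n) (kernelMatrix_mulVec_rbmEigenvector n γ)
    (strictAnti_rbmEigenvalue n γ)
  exact ⟨fun j => by rw [h1], h2⟩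

theorem abs_eigenvector_apply_le {n : ℕ} {γ : ℝ} {μ : Fin n → ℝ}
    {v : Fin n → EuclideanSpace ℝ (Fin n)}
    (hv : IsOrderedEigenbasis (kernelMatrix (rbmKernel n γ) (designPoint n)) μ v) (j i : Fin n) :
    |v j i| ≤ √(2 / ((n : ℝ) + 1 / 2)) := by
  obtain ⟨c, hc, h⟩ := hv.eq_rbm.2 j
  rw [h, abs_mul, hc, one_mul, rbmEigenvector, abs_mul, abs_of_nonneg (Real.sqrt_nonneg _)]
  exact mul_le_of_le_one_right (Real.sqrt_nonneg _) (Real.abs_sin_le_one _)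

theorem abs_eigenvector_dotProduct {n : ℕ} {γ : ℝ} {μ : Fin n → ℝ}
    {v : Fin n → EuclideanSpace ℝ (Fin n)}
    (hv : IsOrderedEigenbasis (kernelMatrix (rbmKernel n γ) (designPoint n)) μ v) (j : Fin n)
    (g : Fin n → ℝ) :
    |(v j).ofLp ⬝ᵥ g| = √(2 / ((n : ℝ) + 1 / 2)) *
      |∑ i, g i * Real.sin (rbmFreq n j * (i.val + 1 : ℕ))| := by
  obtain ⟨c, hc, h⟩ := hv.eq_rbm.2 j
  have e : (v j).ofLp ⬝ᵥ g = c * (√(2 / ((n : ℝ) + 1 / 2)) *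
      ∑ i, g i * Real.sin (rbmFreq n j * (i.val + 1 : ℕ))) := by
    simp only [dotProduct, h, rbmEigenvector, Finset.mul_sum]
    exact Finset.sum_congr rfl fun _ _ => by ring
  rw [e, abs_mul, hc, one_mul, abs_mul, abs_of_nonneg (Real.sqrt_nonneg _)]

/-! ### The equivalent kernel -/

/-- The two-sided geometric law centred at `s`: the Green's function of `1 - q⁻¹ Δ` on `ℤ` when
`(1 - ρ) ^ 2 = q * ρ`. -/
noncomputable def geomKernel (ρ : ℝ) (s l : ℕ) : ℝ :=
  (1 - ρ) / (1 + ρ) * ρ ^ ((l - s) + (s - l))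

/-- The linear interpolation of `geomKernel` between the centres `s` and `s + 1`. It approximates
the weights of the full posterior mean at the point `s + t`. -/
noncomputable def interpKernel (ρ : ℝ) (s : ℕ) (t : ℝ) (l : ℕ) : ℝ :=
  (1 - t) * geomKernel ρ s l + t * geomKernel ρ (s + 1) l

theorem geomKernel_second_difference {ρ q : ℝ} (h0 : 0 < ρ) (hq : (1 - ρ) ^ 2 = q * ρ) (s i : ℕ) :
    2 * geomKernel ρ s (i + 1) - geomKernel ρ s i - geomKernel ρ s (i + 2) =
      q * ((if i + 1 = s then 1 else 0) - geomKernel ρ s (i + 1)) := by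
  have hq' : q = (1 - ρ) ^ 2 / ρ := by rw [hq]; field_simp
  have h1 : 1 + ρ ≠ 0 := by positivity
  unfold geomKernel
  rw [hq']
  rcases lt_trichotomy (i + 1) s with h | h | h
  · obtain ⟨e, rfl⟩ := Nat.exists_eq_add_of_lt h
    rw [if_neg (by omega), show i + 1 - (i + 1 + e + 1) + (i + 1 + e + 1 - (i + 1)) = e + 1 by omega,
      show i - (i + 1 + e + 1) + (i + 1 + e + 1 - i) = e + 2 by omega,
      show i + 2 - (i + 1 + e + 1) + (i + 1 + e + 1 - (i + 2)) = e by omega]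
    field_simp
    ring
  · subst h
    rw [if_pos rfl, show i + 1 - (i + 1) + (i + 1 - (i + 1)) = 0 by omega,
      show i - (i + 1) + (i + 1 - i) = 1 by omega,
      show i + 2 - (i + 1) + (i + 1 - (i + 2)) = 1 by omega]
    field_simp
    ring
  · obtain ⟨e, he⟩ := Nat.exists_eq_add_of_lt h
    obtain rfl : i = s + e := by omega
    rw [if_neg (by omega), show s + e + 1 - s + (s - (s + e + 1)) = e + 1 by omega,
      show s + e - s + (s - (s + e)) = e by omega,
      show s + e + 2 - s + (s - (s + e + 2)) = e + 2 by omega]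
    field_simp
    ring

theorem sum_min_mul_interpKernel {ρ q : ℝ} (h0 : 0 < ρ) (hq : (1 - ρ) ^ 2 = q * ρ) {s n p : ℕ}
    (t : ℝ) (hs : 1 ≤ s) (hsn : s + 1 ≤ n) (hp : p ≤ n) :
    q * ∑ i ∈ Finset.range n, (min p (i + 1) : ℕ) * interpKernel ρ s t (i + 1) +
        interpKernel ρ s t p =
      q * ((1 - t) * (min p s : ℕ) + t * (min p (s + 1) : ℕ)) + interpKernel ρ s t 0 +
        p * (interpKernel ρ s t (n + 1) - interpKernel ρ s t n) := by
  have h := sum_min_mul_second_difference (interpKernel ρ s t) hp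
  have h1 : ∀ i, 2 * interpKernel ρ s t (i + 1) - interpKernel ρ s t i - interpKernel ρ s t (i + 2)
      = q * ((1 - t) * (if i + 1 = s then 1 else 0)) + q * (t * (if i = s then 1 else 0)) -
        q * interpKernel ρ s t (i + 1) := by
    intro i
    have e1 := geomKernel_second_difference h0 hq s i
    have e2 := geomKernel_second_difference h0 hq (s + 1) i
    simp only [Nat.add_right_cancel_iff] at e2
    unfold interpKernel
    linear_combination (1 - t) * e1 + t * e2
  have h2 : ∑ i ∈ Finset.range n, ((min p (i + 1) : ℕ) : ℝ) *
      (q * ((1 - t) * (if i + 1 = s then 1 else 0))) = q * ((1 - t) * (min p s : ℕ)) := by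
    rw [Finset.sum_eq_single (s - 1)]
    · rw [show s - 1 + 1 = s by omega, if_pos rfl]; ring
    · intro i _ hi
      rw [if_neg (by omega)]; ring
    · intro hi
      exact absurd (Finset.mem_range.2 (by omega)) hi
  have h3 : ∑ i ∈ Finset.range n, ((min p (i + 1) : ℕ) : ℝ) *
      (q * (t * (if i = s then 1 else 0))) = q * (t * (min p (s + 1) : ℕ)) := by
    rw [Finset.sum_eq_single s]
    · rw [if_pos rfl]; ring
    · intro i _ hi
      rw [if_neg hi]; ring
    · intro hi
      exact absurd (Finset.mem_range.2 (by omega)) hi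
  simp only [h1, mul_sub, mul_add, Finset.sum_sub_distrib, Finset.sum_add_distrib] at h
  have h4 : ∑ i ∈ Finset.range n, ((min p (i + 1) : ℕ) : ℝ) * (q * interpKernel ρ s t (i + 1)) =
      q * ∑ i ∈ Finset.range n, (min p (i + 1) : ℕ) * interpKernel ρ s t (i + 1) := by
    rw [Finset.mul_sum]
    exact Finset.sum_congr rfl fun i _ => by ring
  rw [h2, h3, h4] at h
  linarith

section Bounds

variable {ρ : ℝ} {s : ℕ} {t : ℝ}

theorem geomKernel_pos (h0 : 0 < ρ) (h1 : ρ < 1) (s l : ℕ) : 0 < geomKernel ρ s l := by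
  have : 0 < 1 - ρ := by linarith
  unfold geomKernel; positivity

theorem geomKernel_le (h0 : 0 < ρ) (h1 : ρ < 1) {s l k : ℕ} (hk : k ≤ (l - s) + (s - l)) :
    geomKernel ρ s l ≤ ρ ^ k := by
  have h2 : (1 - ρ) / (1 + ρ) ≤ 1 := by rw [div_le_one (by linarith)]; linarith
  calc geomKernel ρ s l ≤ 1 * ρ ^ k := by
        unfold geomKernel
        exact mul_le_mul h2 (pow_le_pow_of_le_one h0.le h1.le hk) (by positivity) zero_le_one
    _ = ρ ^ k := one_mul _

theorem geomKernel_succ_mem (h0 : 0 < ρ) (h1 : ρ < 1) (s l : ℕ) :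
    ρ * geomKernel ρ s l ≤ geomKernel ρ (s + 1) l ∧
      ρ * geomKernel ρ (s + 1) l ≤ geomKernel ρ s l := by
  have h2 : 0 < (1 - ρ) / (1 + ρ) := div_pos (by linarith) (by linarith)
  unfold geomKernel
  constructor <;>
  · rw [mul_left_comm, ← pow_succ']
    exact mul_le_mul_of_nonneg_left (pow_le_pow_of_le_one h0.le h1.le (by omega)) h2.le

theorem interpKernel_nonneg (h0 : 0 < ρ) (h1 : ρ < 1) (ht0 : 0 ≤ t) (ht1 : t ≤ 1) (l : ℕ) :
    0 ≤ interpKernel ρ s t l := by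
  have := geomKernel_pos h0 h1 s l
  have := geomKernel_pos h0 h1 (s + 1) l
  have : 0 ≤ 1 - t := by linarith
  unfold interpKernel; positivity

theorem le_interpKernel (h0 : 0 < ρ) (h1 : ρ < 1) (ht0 : 0 ≤ t) (ht1 : t ≤ 1) (l : ℕ) :
    ρ * geomKernel ρ s l ≤ interpKernel ρ s t l := by
  have h2 := geomKernel_pos h0 h1 s l
  have h3 := (geomKernel_succ_mem h0 h1 s l).1
  unfold interpKernel
  nlinarith [mul_nonneg (sub_nonneg.2 ht1) (mul_nonneg (sub_nonneg.2 h1.le) h2.le),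
    mul_le_mul_of_nonneg_left h3 ht0]

theorem interpKernel_le (h0 : 0 < ρ) (h1 : ρ < 1) (ht0 : 0 ≤ t) (ht1 : t ≤ 1) (l : ℕ) :
    ρ * interpKernel ρ s t l ≤ geomKernel ρ s l := by
  have h2 := geomKernel_pos h0 h1 s l
  have h3 := (geomKernel_succ_mem h0 h1 s l).2
  unfold interpKernel
  nlinarith [mul_nonneg (sub_nonneg.2 ht1) (mul_nonneg (sub_nonneg.2 h1.le) h2.le),
    mul_le_mul_of_nonneg_left h3 ht0]

theorem interpKernel_le_pow (h0 : 0 < ρ) (h1 : ρ < 1) (ht0 : 0 ≤ t) (ht1 : t ≤ 1) {l k : ℕ}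
    (hk : k ≤ (l - s) + (s - l)) (hk' : k ≤ (l - (s + 1)) + (s + 1 - l)) :
    interpKernel ρ s t l ≤ ρ ^ k := by
  have h2 := geomKernel_le h0 h1 hk
  have h3 := geomKernel_le h0 h1 hk'
  unfold interpKernel
  nlinarith [mul_le_mul_of_nonneg_left h2 (sub_nonneg.2 ht1), mul_le_mul_of_nonneg_left h3 ht0]

/-- The boundary defect of `interpKernel` as a solution of the normal equations is exponentially
small. -/
theorem abs_boundary_defect_le (h0 : 0 < ρ) (h1 : ρ < 1) (ht0 : 0 ≤ t) (ht1 : t ≤ 1) {n p : ℕ}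
    (hsn : s + 1 ≤ n) (hp : p ≤ n) :
    |interpKernel ρ s t 0 + p * (interpKernel ρ s t (n + 1) - interpKernel ρ s t n)| ≤
      ρ ^ s + n * ρ ^ (n - s - 1) := by
  have a0 := interpKernel_nonneg (s := s) h0 h1 ht0 ht1 0
  have a1 := interpKernel_nonneg (s := s) h0 h1 ht0 ht1 (n + 1)
  have a2 := interpKernel_nonneg (s := s) h0 h1 ht0 ht1 n
  have b0 := interpKernel_le_pow (s := s) (l := 0) (k := s) h0 h1 ht0 ht1 (by omega) (by omega)
  have b1 := interpKernel_le_pow (s := s) (l := n + 1) (k := n - s - 1) h0 h1 ht0 ht1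
    (by omega) (by omega)
  have b2 := interpKernel_le_pow (s := s) (l := n) (k := n - s - 1) h0 h1 ht0 ht1
    (by omega) (by omega)
  have hpn : (p : ℝ) ≤ n := by exact_mod_cast hp
  refine (abs_add_le _ _).trans (add_le_add (by rwa [abs_of_nonneg a0]) ?_)
  rw [abs_mul, Nat.abs_cast]
  exact mul_le_mul hpn (abs_le.2 ⟨by linarith, by linarith⟩) (abs_nonneg _) (by positivity)

end Bounds

theorem sum_range_dist (h : ℕ → ℝ) {s n : ℕ} (hsn : s ≤ n) :
    ∑ i ∈ Finset.range n, h ((i + 1 - s) + (s - (i + 1))) =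
      ∑ d ∈ Finset.range s, h d + ∑ d ∈ Finset.range (n - s), h (d + 1) := by
  obtain ⟨e, rfl⟩ := Nat.exists_eq_add_of_le hsn
  rw [Finset.sum_range_add, ← Finset.sum_range_reflect]
  congr 1
  · refine Finset.sum_congr rfl fun i hi => ?_
    have := Finset.mem_range.1 hi
    congr 1; omega
  · rw [show s + e - s = e by omega]
    refine Finset.sum_congr rfl fun i _ => ?_
    congr 1; omega

theorem sum_pow_dist (r : ℝ) {s n : ℕ} (hsn : s ≤ n) :
    (1 - r) * ∑ i ∈ Finset.range n, r ^ ((i + 1 - s) + (s - (i + 1))) =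
      1 + r - r ^ s - r ^ (n - s + 1) := by
  rw [sum_range_dist (fun d => r ^ d) hsn]
  have e1 := mul_neg_geom_sum r s
  have e2 := mul_neg_geom_sum r (n - s)
  simp only [pow_succ, ← Finset.sum_mul]
  linear_combination e1 + r * e2

theorem sum_geomKernel {ρ : ℝ} (h0 : 0 < ρ) {s n : ℕ} (hsn : s ≤ n) :
    ∑ i ∈ Finset.range n, geomKernel ρ s (i + 1) =
      1 - (ρ ^ s + ρ ^ (n - s + 1)) / (1 + ρ) := by
  have e := sum_pow_dist ρ hsn
  have : 1 + ρ ≠ 0 := by positivity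
  simp only [geomKernel, ← Finset.mul_sum]
  rw [div_mul_eq_mul_div, e]
  field_simp
  ring

theorem sum_geomKernel_sq {ρ : ℝ} (h0 : 0 < ρ) (h1 : ρ < 1) {s n : ℕ} (hsn : s ≤ n) :
    ∑ i ∈ Finset.range n, geomKernel ρ s (i + 1) ^ 2 =
      (1 - ρ) / (1 + ρ) ^ 3 * (1 + ρ ^ 2 - (ρ ^ s) ^ 2 - (ρ ^ (n - s + 1)) ^ 2) := by
  have e := sum_pow_dist (ρ ^ 2) hsn
  have h2 : 1 + ρ ≠ 0 := by positivity
  have h3 : 1 - ρ ≠ 0 := by linarith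
  simp only [geomKernel, mul_pow, ← Finset.mul_sum, ← pow_mul, mul_comm _ 2] at e ⊢
  rw [← e]
  simp only [pow_mul]
  field_simp
  ring

theorem abs_sum_interpKernel_sub_one_le {ρ : ℝ} (h0 : 0 < ρ) (h1 : ρ < 1) {s n : ℕ} {t : ℝ}
    (ht0 : 0 ≤ t) (ht1 : t ≤ 1) (hsn : s + 1 ≤ n) :
    |∑ i ∈ Finset.range n, interpKernel ρ s t (i + 1) - 1| ≤ ρ ^ s + ρ ^ (n - s - 1) := by
  have e1 := sum_geomKernel h0 (show s ≤ n by omega)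
  have e2 := sum_geomKernel h0 hsn
  simp only [interpKernel, Finset.sum_add_distrib, ← Finset.mul_sum]
  have key : ∀ a b : ℕ, s ≤ a → n - s - 1 ≤ b →
      0 ≤ (ρ ^ a + ρ ^ b) / (1 + ρ) ∧
        (ρ ^ a + ρ ^ b) / (1 + ρ) ≤ ρ ^ s + ρ ^ (n - s - 1) := by
    intro a b ha hb
    refine ⟨by positivity, (div_le_self (by positivity) (by linarith)).trans ?_⟩
    exact add_le_add (pow_le_pow_of_le_one h0.le h1.le ha) (pow_le_pow_of_le_one h0.le h1.le hb)
  obtain ⟨a1, a2⟩ := key s (n - s + 1) le_rfl (by omega)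
  obtain ⟨b1, b2⟩ := key (s + 1) (n - (s + 1) + 1) (by omega) (by omega)
  rw [e1, e2, abs_le]
  constructor <;> nlinarith [mul_le_mul_of_nonneg_left a2 (sub_nonneg.2 ht1),
    mul_le_mul_of_nonneg_left b2 ht0, mul_nonneg (sub_nonneg.2 ht1) a1, mul_nonneg ht0 b1]

theorem sum_pow_mul_le {ρ : ℝ} (h0 : 0 < ρ) (h1 : ρ < 1) (n : ℕ) :
    (1 - ρ) ^ 2 * ∑ d ∈ Finset.range n, ((d : ℝ) + 1) * ρ ^ d ≤ 1 := by
  have : ∀ n : ℕ, (1 - ρ) ^ 2 * ∑ d ∈ Finset.range n, ((d : ℝ) + 1) * ρ ^ d =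
      1 - ρ ^ n * (1 + n * (1 - ρ)) := by
    intro n
    induction n with
    | zero => simp
    | succ n ih => rw [Finset.sum_range_succ, mul_add, ih]; push_cast; ring
  rw [this]
  have : 0 ≤ 1 - ρ := by linarith
  have : 0 ≤ ρ ^ n * (1 + n * (1 - ρ)) := by positivity
  linarith

/-- The first absolute moment of the equivalent kernel is of the order `1 / (1 - ρ)`. -/
theorem sum_geomKernel_mul_dist_le {ρ : ℝ} (h0 : 0 < ρ) (h1 : ρ < 1) {s n : ℕ} (hsn : s ≤ n) :
    ∑ i ∈ Finset.range n, geomKernel ρ s (i + 1) * (((i + 1 - s) + (s - (i + 1)) : ℕ) + 1) ≤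
      2 / (1 - ρ) := by
  have h2 : 0 < 1 - ρ := by linarith
  have e := sum_range_dist (fun d => ((d : ℝ) + 1) * ρ ^ d) hsn
  have e1 := sum_pow_mul_le h0 h1 s
  have e2 := sum_pow_mul_le h0 h1 (n - s + 1)
  rw [Finset.sum_range_succ'] at e2
  have e3 : ∑ i ∈ Finset.range n, geomKernel ρ s (i + 1) *
      (((i + 1 - s) + (s - (i + 1)) : ℕ) + 1) = (1 - ρ) / (1 + ρ) *
      ∑ i ∈ Finset.range n, ((((i + 1 - s) + (s - (i + 1)) : ℕ) : ℝ) + 1) *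
        ρ ^ ((i + 1 - s) + (s - (i + 1))) := by
    rw [Finset.mul_sum]
    exact Finset.sum_congr rfl fun i _ => by unfold geomKernel; ring
  rw [e3, e, le_div_iff₀ h2]
  set A := ∑ d ∈ Finset.range s, ((d : ℝ) + 1) * ρ ^ d
  set B := ∑ d ∈ Finset.range (n - s), (((d + 1 : ℕ) : ℝ) + 1) * ρ ^ (d + 1)
  have e4 : (1 - ρ) ^ 2 * (A + B) ≤ 2 := by
    simp only [pow_zero] at e2
    nlinarith [sq_nonneg (1 - ρ)]
  have hA : 0 ≤ A := by positivity
  have hB : 0 ≤ B := by positivity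
  calc (1 - ρ) / (1 + ρ) * (A + B) * (1 - ρ) = (1 - ρ) ^ 2 * (A + B) / (1 + ρ) := by ring
    _ ≤ (1 - ρ) ^ 2 * (A + B) := div_le_self (by positivity) (by linarith)
    _ ≤ 2 := e4

/-! ### Comparison with the posterior built on all eigenvectors -/

section Full

variable {X : Type*} {n : ℕ} {k : X → X → ℝ} {d : Fin n → X} {μ : Fin n → ℝ}
  {v : Fin n → EuclideanSpace ℝ (Fin n)}

/-- Stability of the normal equations `(K + 1) w = k_x` for the weights of the full posterior mean:
since `K` is positive, a residual `r` moves the solution by at most the Euclidean norm of `r`. -/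
theorem abs_meanWeights_sub_le (hv : IsOrderedEigenbasis (kernelMatrix k d) μ v)
    (hμ : ∀ j, 0 < μ j) (hK : (kernelMatrix k d)ᵀ = kernelMatrix k d) (x : X)
    {w r : Fin n → ℝ} {R : ℝ} (hr : ∀ i, |r i| ≤ R)
    (hw : ∀ i, (kernelMatrix k d *ᵥ w) i + w i = k x (d i) + r i) (i : Fin n) :
    |meanWeights k d μ v n x i - w i| ≤ n * R := by
  have hR : 0 ≤ R := (abs_nonneg _).trans (hr i)
  set D : Fin n → ℝ := fun i => meanWeights k d μ v n x i - w i
  have hcoef : ∀ j, (v j).ofLp ⬝ᵥ D = -((v j).ofLp ⬝ᵥ r) / (1 + μ j) := by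
    intro j
    have h1 : (v j).ofLp ⬝ᵥ meanWeights k d μ v n x = eigenCov k d v x j / (1 + μ j) := by
      rw [dotProduct_comm, meanWeights_dotProduct]
      simp only [dotProduct_of_orthonormal hv.orthonormal]
      simp
    have h2 : (v j).ofLp ⬝ᵥ (kernelMatrix k d *ᵥ w) = μ j * ((v j).ofLp ⬝ᵥ w) := by
      rw [Matrix.dotProduct_mulVec, ← Matrix.mulVec_transpose, hK, hv.eigen, smul_dotProduct,
        smul_eq_mul]
    have h3 : (v j).ofLp ⬝ᵥ (kernelMatrix k d *ᵥ w) + (v j).ofLp ⬝ᵥ w =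
        eigenCov k d v x j + (v j).ofLp ⬝ᵥ r := by
      rw [← dotProduct_add, eigenCov, ← dotProduct_add]
      congr 1
      exact funext hw
    have h4 : (v j).ofLp ⬝ᵥ D = (v j).ofLp ⬝ᵥ meanWeights k d μ v n x - (v j).ofLp ⬝ᵥ w :=
      dotProduct_sub _ _ _
    have := hμ j
    rw [h4, h1, eq_div_iff (by positivity), sub_mul, div_mul_cancel₀ _ (by positivity)]
    linarith
  have hn : (1 : ℝ) ≤ n := by exact_mod_cast Nat.one_le_of_lt i.isLt
  have h5 : D ⬝ᵥ D ≤ r ⬝ᵥ r := by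
    rw [← sum_dotProduct_mul_dotProduct hv.orthonormal D D,
      ← sum_dotProduct_mul_dotProduct hv.orthonormal r r]
    refine Finset.sum_le_sum fun j _ => ?_
    have := hμ j
    rw [hcoef, div_mul_div_comm, neg_mul_neg]
    exact div_le_self (mul_self_nonneg _) (by nlinarith)
  have h6 : r ⬝ᵥ r ≤ n * R ^ 2 := by
    have : ∀ i ∈ Finset.univ, r i * r i ≤ R ^ 2 := fun i _ => by
      rw [← sq]; exact sq_le_sq' (by linarith [(abs_le.1 (hr i)).1]) (abs_le.1 (hr i)).2
    refine (Finset.sum_le_card_nsmul _ _ _ this).trans ?_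
    simp
  have h7 : D i * D i ≤ D ⬝ᵥ D :=
    Finset.single_le_sum (f := fun i => D i * D i) (fun i _ => mul_self_nonneg _)
      (Finset.mem_univ i)
  refine abs_le_of_sq_le_sq ?_ (by positivity)
  nlinarith [sq_nonneg R, mul_nonneg (sub_nonneg.2 hn) (sq_nonneg R)]

theorem sgprCov_eigenWeights_full (hv : IsOrderedEigenbasis (kernelMatrix k d) μ v)
    (hμ : ∀ j, 0 < μ j) (x : X) :
    sgprCov 1 k d (eigenWeights v n) x x =
      k x x - meanWeights k d μ v n x ⬝ᵥ fun i => k x (d i) := by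
  rw [sgprCov_eigenWeights hv hμ, meanWeights_dotProduct]
  congr 1
  exact Finset.sum_congr rfl fun j _ => by rw [eigenCov]; ring

theorem sum_filter_lt_add_sum_filter_not_lt (m : ℕ) (g : Fin n → ℝ) :
    ∑ j with j.val < m, g j + ∑ j with ¬ j.val < m, g j = ∑ j with j.val < n, g j := by
  rw [Finset.sum_filter_add_sum_filter_not]
  exact Finset.sum_congr (by simp) fun _ _ => rfl

theorem abs_sgprCov_sub_full_le (hv : IsOrderedEigenbasis (kernelMatrix k d) μ v)
    (hμ : ∀ j, 0 < μ j) (m : ℕ) (x : X) :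
    |sgprCov 1 k d (eigenWeights v m) x x - sgprCov 1 k d (eigenWeights v n) x x| ≤
      ∑ j with ¬ j.val < m, eigenCov k d v x j ^ 2 := by
  rw [sgprCov_eigenWeights hv hμ, sgprCov_eigenWeights hv hμ,
    ← sum_filter_lt_add_sum_filter_not_lt m, sub_sub_sub_cancel_left, add_sub_cancel_left]
  refine (Finset.abs_sum_le_sum_abs _ _).trans (Finset.sum_le_sum fun j _ => ?_)
  have := hμ j
  rw [abs_of_nonneg (by positivity)]
  exact div_le_self (sq_nonneg _) (by linarith)

theorem abs_meanWeights_dotProduct_self_sub_full_le (hv : Orthonormal ℝ v)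
    (hμ : ∀ j, 0 < μ j) (m : ℕ) (x : X) :
    |meanWeights k d μ v m x ⬝ᵥ meanWeights k d μ v m x -
        meanWeights k d μ v n x ⬝ᵥ meanWeights k d μ v n x| ≤
      ∑ j with ¬ j.val < m, eigenCov k d v x j ^ 2 := by
  rw [meanWeights_dotProduct_self hv, meanWeights_dotProduct_self hv,
    ← sum_filter_lt_add_sum_filter_not_lt m, sub_add_cancel_left, abs_neg]
  refine (Finset.abs_sum_le_sum_abs _ _).trans (Finset.sum_le_sum fun j _ => ?_)
  have := hμ j
  rw [abs_of_nonneg (by positivity), div_pow]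
  exact div_le_self (sq_nonneg _) (one_le_pow₀ (by linarith))

theorem abs_meanWeights_dotProduct_sub_full_le (hμ : ∀ j, 0 < μ j) (m : ℕ) (x : X)
    (y : Fin n → ℝ) :
    |meanWeights k d μ v m x ⬝ᵥ y - meanWeights k d μ v n x ⬝ᵥ y| ≤
      ∑ j with ¬ j.val < m, |eigenCov k d v x j| * |(v j).ofLp ⬝ᵥ y| := by
  rw [meanWeights_dotProduct, meanWeights_dotProduct,
    ← sum_filter_lt_add_sum_filter_not_lt m, sub_add_cancel_left, abs_neg]
  refine (Finset.abs_sum_le_sum_abs _ _).trans (Finset.sum_le_sum fun j _ => ?_)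
  have := hμ j
  rw [abs_mul, abs_div]
  gcongr
  refine div_le_self (abs_nonneg _) ?_
  rw [abs_of_pos] <;> linarith

end Full

theorem sum_inv_sq_tail_le {n m : ℕ} (hm : 0 < m) :
    ∑ j : Fin n with ¬ j.val < m, 1 / ((j : ℝ) + 1) ^ 2 ≤ 1 / (m : ℝ) := by
  have hm' : (0 : ℝ) < m := by exact_mod_cast hm
  have h : ∀ n : ℕ, ∑ j ∈ Finset.range n, (if ¬ j < m then 1 / ((j : ℝ) + 1) ^ 2 else 0) ≤
      1 / (m : ℝ) - 1 / ((max m n : ℕ) : ℝ) := by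
    intro n
    induction n with
    | zero => simp
    | succ n ih =>
      rw [Finset.sum_range_succ]
      rcases lt_or_ge n m with hn | hn
      · rw [if_neg (by simpa using hn), max_eq_left (by omega)]
        rw [max_eq_left hn.le] at ih
        linarith
      · rw [if_pos (by omega), max_eq_right (by omega)]
        rw [max_eq_right hn] at ih
        have hn' : (0 : ℝ) < n := lt_of_lt_of_le hm' (by exact_mod_cast hn)
        have : 1 / ((n : ℝ) + 1) ^ 2 ≤ 1 / n - 1 / ((n + 1 : ℕ) : ℝ) := by
          push_cast
          rw [div_sub_div _ _ hn'.ne' (by positivity),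
            div_le_div_iff₀ (by positivity) (by positivity)]
          nlinarith
        linarith
  rw [Finset.sum_filter,
    Fin.sum_univ_eq_sum_range (fun j : ℕ => if ¬ j < m then 1 / ((j : ℝ) + 1) ^ 2 else 0)]
  refine (h n).trans (sub_le_self _ (by positivity))

/-! ### Fourier coefficients of Hölder functions -/

theorem norm_exp_pow_sub_one_ge {ω : ℝ} {L : ℕ} (h1 : Real.pi / 2 ≤ ω * L)
    (h2 : ω * L ≤ Real.pi + Real.pi / 2) : 1 ≤ ‖Complex.exp (ω * Complex.I) ^ L - 1‖ := by
  have e : Complex.exp (ω * Complex.I) ^ L = Complex.exp ((ω * L : ℝ) * Complex.I) := by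
    rw [← Complex.exp_nat_mul]
    congr 1
    push_cast; ring
  have hre : (Complex.exp (ω * Complex.I) ^ L - 1).re ≤ -1 := by
    rw [e, Complex.sub_re, Complex.exp_ofReal_mul_I_re, Complex.one_re]
    linarith [Real.cos_nonpos_of_pi_div_two_le_of_le h1 h2]
  have := Complex.abs_re_le_norm (Complex.exp (ω * Complex.I) ^ L - 1)
  rw [abs_of_neg (by linarith)] at this
  linarith

/-- Shifting a trigonometric sum by `L` steps, where `ω * L` is away from the multiples of `2 π`,
bounds it by the oscillation of the coefficients at distance `L` and by two boundary terms. -/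
theorem norm_sum_mul_exp_pow_le {ω F H : ℝ} {L n : ℕ} {G : ℕ → ℝ} (hF : ∀ i < n, |G i| ≤ F)
    (hH0 : 0 ≤ H) (hF0 : 0 ≤ F)
    (hH : ∀ i, L + i < n → |G i - G (L + i)| ≤ H) (h1 : Real.pi / 2 ≤ ω * L)
    (h2 : ω * L ≤ Real.pi + Real.pi / 2) :
    ‖∑ i ∈ Finset.range n, (G i : ℂ) * Complex.exp (ω * Complex.I) ^ (i + 1)‖ ≤
      n * H + 2 * L * F := by
  set ζ := Complex.exp (ω * Complex.I) with hζ
  have hζ1 : ∀ a : ℕ, ‖ζ ^ a‖ = 1 := fun a => by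
    rw [norm_pow, hζ, Complex.norm_exp_ofReal_mul_I, one_pow]
  have hb : ∀ i < n, ∀ a : ℕ, ‖(G i : ℂ) * ζ ^ a‖ ≤ F := fun i hi a => by
    rw [norm_mul, hζ1, mul_one, Complex.norm_real]; exact hF i hi
  rcases le_total L n with hL | hL
  · obtain ⟨e, rfl⟩ := Nat.exists_eq_add_of_le hL
    set T := ∑ i ∈ Finset.range (L + e), (G i : ℂ) * ζ ^ (i + 1)
    have e1 : T = ∑ i ∈ Finset.range L, (G i : ℂ) * ζ ^ (i + 1) +
        ∑ i ∈ Finset.range e, (G (L + i) : ℂ) * ζ ^ (L + i + 1) := Finset.sum_range_add _ _ _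
    have e2 : ζ ^ L * T = ∑ i ∈ Finset.range e, (G i : ℂ) * ζ ^ (L + i + 1) +
        ∑ i ∈ Finset.range L, (G (e + i) : ℂ) * ζ ^ (L + (e + i) + 1) := by
      have : T = ∑ i ∈ Finset.range (e + L), (G i : ℂ) * ζ ^ (i + 1) := by rw [add_comm e L]
      rw [this, Finset.sum_range_add, mul_add, Finset.mul_sum, Finset.mul_sum]
      congr 1 <;> exact Finset.sum_congr rfl fun i _ => by ring
    have e3 : (ζ ^ L - 1) * T =
        ∑ i ∈ Finset.range e, ((G i - G (L + i) : ℝ) : ℂ) * ζ ^ (L + i + 1) +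
        (∑ i ∈ Finset.range L, (G (e + i) : ℂ) * ζ ^ (L + (e + i) + 1) -
          ∑ i ∈ Finset.range L, (G i : ℂ) * ζ ^ (i + 1)) := by
      rw [sub_mul, one_mul, e2, e1]
      simp only [Complex.ofReal_sub, sub_mul, Finset.sum_sub_distrib]
      ring
    have n1 : ‖∑ i ∈ Finset.range e, ((G i - G (L + i) : ℝ) : ℂ) * ζ ^ (L + i + 1)‖ ≤ e * H := by
      refine (norm_sum_le_of_le _ (f := fun i => ((G i - G (L + i) : ℝ) : ℂ) * ζ ^ (L + i + 1))
        (n := fun _ => H) fun i hi => ?_).trans (by simp)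
      rw [norm_mul, hζ1, mul_one, Complex.norm_real]
      exact hH i (by have := Finset.mem_range.1 hi; omega)
    have n2 : ‖∑ i ∈ Finset.range L, (G (e + i) : ℂ) * ζ ^ (L + (e + i) + 1)‖ ≤ L * F :=
      (norm_sum_le_of_le _ (n := fun _ => F) fun i hi =>
        hb _ (by have := Finset.mem_range.1 hi; omega) _).trans (by simp)
    have n3 : ‖∑ i ∈ Finset.range L, (G i : ℂ) * ζ ^ (i + 1)‖ ≤ L * F :=
      (norm_sum_le_of_le _ (n := fun _ => F) fun i hi =>
        hb _ (by have := Finset.mem_range.1 hi; omega) _).trans (by simp)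
    have n4 : ‖T‖ ≤ ‖(ζ ^ L - 1) * T‖ := by
      rw [norm_mul]
      exact le_mul_of_one_le_left (norm_nonneg _) (norm_exp_pow_sub_one_ge h1 h2)
    have n5 : (e : ℝ) * H ≤ ((L + e : ℕ) : ℝ) * H := by gcongr; omega
    rw [e3] at n4
    have n6 := norm_add_le (∑ i ∈ Finset.range e, ((G i - G (L + i) : ℝ) : ℂ) * ζ ^ (L + i + 1))
      (∑ i ∈ Finset.range L, (G (e + i) : ℂ) * ζ ^ (L + (e + i) + 1) -
          ∑ i ∈ Finset.range L, (G i : ℂ) * ζ ^ (i + 1))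
    have n7 := norm_sub_le (∑ i ∈ Finset.range L, (G (e + i) : ℂ) * ζ ^ (L + (e + i) + 1))
      (∑ i ∈ Finset.range L, (G i : ℂ) * ζ ^ (i + 1))
    linarith
  · have n3 : ‖∑ i ∈ Finset.range n, (G i : ℂ) * ζ ^ (i + 1)‖ ≤ n * F :=
      (norm_sum_le_of_le _ (n := fun _ => F) fun i hi =>
        hb _ (by have := Finset.mem_range.1 hi; omega) _).trans (by simp)
    have : (n : ℝ) ≤ L := by exact_mod_cast hL
    nlinarith [mul_nonneg (Nat.cast_nonneg n : (0 : ℝ) ≤ n) hH0,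
      mul_nonneg (Nat.cast_nonneg L : (0 : ℝ) ≤ L) hF0, mul_le_mul_of_nonneg_right this hF0]

/-- The sine coefficients of a Hölder function decay like `(j + 1) ^ (-α)`. There is no boundary
condition on the function: the boundary terms are of order `(j + 1)⁻¹`, which is enough for
`α ≤ 1`. -/
theorem abs_sum_mul_sin_rbmFreq_le {n j : ℕ} (hj : j < n) {α F H : ℝ} (hα0 : 0 < α) (hα1 : α ≤ 1)
    (hF0 : 0 ≤ F) (hH0 : 0 ≤ H) {G : ℕ → ℝ} (hF : ∀ i < n, |G i| ≤ F)
    (hH : ∀ L i, L + i < n → |G i - G (L + i)| ≤ H * (L / ((n : ℝ) + 1 / 2)) ^ α) :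
    |∑ i ∈ Finset.range n, G i * Real.sin (rbmFreq n j * (i + 1 : ℕ))| ≤
      (2 * H + 4 * F) * ((n : ℝ) + 1 / 2) / ((j : ℝ) + 1) ^ α := by
  set N : ℝ := (n : ℝ) + 1 / 2 with hN
  have hN0 : 0 < N := by positivity
  have hj0 : (0 : ℝ) ≤ j := by positivity
  have hjn : (j : ℝ) + 1 ≤ N := by
    have : ((j + 1 : ℕ) : ℝ) ≤ n := by exact_mod_cast hj
    push_cast at this; linarith
  have hω := rbmFreq_pos n j
  have hωπ := rbmFreq_lt_pi hj
  -- The shift is about a quarter of a period, so that `ω * L` lies in `[π / 2, 3 π / 2]`.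
  set L := ⌈Real.pi / 2 / rbmFreq n j⌉₊ with hL
  have hL1 : Real.pi / 2 ≤ rbmFreq n j * L := by
    rw [← div_le_iff₀' hω]; exact Nat.le_ceil _
  have hL2 : (L : ℝ) < Real.pi / 2 / rbmFreq n j + 1 :=
    Nat.ceil_lt_add_one (by have := Real.pi_pos; positivity)
  have hL3 : rbmFreq n j * L ≤ Real.pi + Real.pi / 2 := by
    have := mul_le_mul_of_nonneg_left hL2.le hω.le
    rw [mul_add, mul_div_cancel₀ _ hω.ne'] at this
    linarith
  have hL4 : (L : ℝ) ≤ 2 * N / (j + 1) := by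
    have e : Real.pi / 2 / rbmFreq n j = N / (2 * j + 1) := by
      have := Real.pi_pos
      unfold rbmFreq
      rw [← hN]
      field_simp
    rw [e] at hL2
    refine hL2.le.trans ?_
    rw [div_add_one (by positivity), div_le_div_iff₀ (by positivity) (by positivity)]
    nlinarith [mul_nonneg hj0 (sub_nonneg.2 hjn)]
  have hja : ((j : ℝ) + 1) ^ α ≤ j + 1 := by
    simpa using Real.rpow_le_rpow_of_exponent_le (by linarith : (1 : ℝ) ≤ j + 1) hα1
  have hja0 : 0 < ((j : ℝ) + 1) ^ α := by positivity
  have hL5 : (L / N) ^ α ≤ 2 / ((j : ℝ) + 1) ^ α := by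
    have : (L : ℝ) / N ≤ 2 / (j + 1) := by
      rw [div_le_iff₀ hN0]
      calc (L : ℝ) ≤ 2 * N / (j + 1) := hL4
        _ = _ := by ring
    calc (L / N) ^ α ≤ (2 / ((j : ℝ) + 1)) ^ α := Real.rpow_le_rpow (by positivity) this hα0.le
      _ = 2 ^ α / ((j : ℝ) + 1) ^ α := Real.div_rpow (by norm_num) (by positivity) _
      _ ≤ _ := by
        gcongr
        simpa using Real.rpow_le_rpow_of_exponent_le (by norm_num : (1 : ℝ) ≤ 2) hα1
  have key := norm_sum_mul_exp_pow_le (H := H * (L / N) ^ α) hF (by positivity) hF0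
    (fun i hi => hH L i hi) hL1 hL3
  have him : (∑ i ∈ Finset.range n, (G i : ℂ) *
      Complex.exp (rbmFreq n j * Complex.I) ^ (i + 1)).im =
      ∑ i ∈ Finset.range n, G i * Real.sin (rbmFreq n j * (i + 1 : ℕ)) := by
    rw [Complex.im_sum]
    refine Finset.sum_congr rfl fun i _ => ?_
    rw [← Complex.exp_nat_mul, Complex.im_ofReal_mul, show ((i + 1 : ℕ) : ℂ) *
      (rbmFreq n j * Complex.I) = ((rbmFreq n j * (i + 1 : ℕ) : ℝ) : ℂ) * Complex.I by
        push_cast; ring, Complex.exp_ofReal_mul_I_im]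
  rw [← him]
  refine (Complex.abs_im_le_norm _).trans (key.trans ?_)
  have hn : (n : ℝ) ≤ N := by linarith
  calc n * (H * (L / N) ^ α) + 2 * L * F
      ≤ N * (H * (2 / ((j : ℝ) + 1) ^ α)) + 2 * (2 * N / ((j : ℝ) + 1) ^ α) * F := by
        gcongr
        exact hL4.trans (by gcongr)
    _ = _ := by ring

/-! ### Error bounds for rescaled Brownian motion -/

theorem min_interp {s t : ℝ} {s' a : ℕ} (hs : s = s' + t) (ht0 : 0 ≤ t) (ht1 : t ≤ 1) :
    min s (a : ℝ) = (1 - t) * (min s' a : ℕ) + t * (min (s' + 1) a : ℕ) := by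
  subst hs
  rcases le_or_gt a s' with h | h
  · have h' : (a : ℝ) ≤ s' := by exact_mod_cast h
    rw [min_eq_right h, min_eq_right (show a ≤ s' + 1 by omega),
      min_eq_right (show (a : ℝ) ≤ s' + t by linarith)]
    ring
  · have h' : ((s' + 1 : ℕ) : ℝ) ≤ a := by exact_mod_cast h
    rw [min_eq_left h.le, min_eq_left (show s' + 1 ≤ a from h),
      min_eq_left (show (s' : ℝ) + t ≤ a by push_cast at h'; linarith)]
    push_cast; ring

section RBM

variable {n : ℕ} {γ : ℝ} {μ : Fin n → ℝ} {v : Fin n → EuclideanSpace ℝ (Fin n)}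
  {x : unitInterval} {s : ℕ} {t : ℝ}

theorem rbmKernel_designPoint_interp (hx : (x : ℝ) * ((n : ℝ) + 1 / 2) = s + t) (ht0 : 0 ≤ t)
    (ht1 : t ≤ 1) (i : Fin n) :
    rbmKernel n γ x (designPoint n i) = rbmScale n γ *
      ((1 - t) * (min s (i.val + 1) : ℕ) + t * (min (s + 1) (i.val + 1) : ℕ)) := by
  rw [rbmKernel_designPoint, min_interp hx ht0 ht1]

/-- Between design points, `k_x` interpolates two rows of `K`, on which `v_j` acts through its
eigenvalue. -/
theorem abs_eigenCov_rbm_le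
    (hv : IsOrderedEigenbasis (kernelMatrix (rbmKernel n γ) (designPoint n)) μ v)
    (hμ : ∀ j, 0 < μ j)
    (hx : (x : ℝ) * ((n : ℝ) + 1 / 2) = s + t) (ht0 : 0 ≤ t) (ht1 : t ≤ 1) (hs : 1 ≤ s)
    (hsn : s + 1 ≤ n) (j : Fin n) :
    |eigenCov (rbmKernel n γ) (designPoint n) v x j| ≤ μ j * √(2 / ((n : ℝ) + 1 / 2)) := by
  have hrow : ∀ i : Fin n, (v j).ofLp ⬝ᵥ
      (fun l : Fin n => rbmScale n γ * ((min (i.val + 1) (l.val + 1) : ℕ) : ℝ)) = μ j * v j i := by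
    intro i
    have h := congrFun (hv.eigen j) i
    rw [dotProduct_comm]
    simpa only [Matrix.mulVec, kernelMatrix_rbmKernel_apply, Pi.smul_apply, smul_eq_mul] using h
  have e : eigenCov (rbmKernel n γ) (designPoint n) v x j =
      (1 - t) * (μ j * v j ⟨s - 1, by omega⟩) + t * (μ j * v j ⟨s, by omega⟩) := by
    rw [← hrow, ← hrow, eigenCov]
    simp only [rbmKernel_designPoint_interp hx ht0 ht1, dotProduct, Finset.mul_sum]
    rw [← Finset.sum_add_distrib, show s - 1 + 1 = s by omega]
    exact Finset.sum_congr rfl fun l _ => by ring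
  have a1 := abs_eigenvector_apply_le hv j ⟨s - 1, by omega⟩
  have a2 := abs_eigenvector_apply_le hv j ⟨s, by omega⟩
  set B := √(2 / ((n : ℝ) + 1 / 2))
  have h1t : 0 ≤ 1 - t := by linarith
  have hj := hμ j
  calc |eigenCov (rbmKernel n γ) (designPoint n) v x j|
      ≤ |(1 - t) * (μ j * v j ⟨s - 1, by omega⟩)| + |t * (μ j * v j ⟨s, by omega⟩)| := by
        rw [e]; exact abs_add_le _ _
    _ = (1 - t) * (μ j * |v j ⟨s - 1, by omega⟩|) + t * (μ j * |v j ⟨s, by omega⟩|) := by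
        rw [abs_mul, abs_mul, abs_mul, abs_mul, abs_of_nonneg h1t, abs_of_nonneg ht0,
          abs_of_pos hj]
    _ ≤ (1 - t) * (μ j * B) + t * (μ j * B) := by gcongr
    _ = μ j * B := by ring

/-- The price of truncation for the two variances. -/
theorem sum_eigenCov_sq_tail_le
    (hv : IsOrderedEigenbasis (kernelMatrix (rbmKernel n γ) (designPoint n)) μ v)
    (hμ : ∀ j, 0 < μ j)
    (hx : (x : ℝ) * ((n : ℝ) + 1 / 2) = s + t) (ht0 : 0 ≤ t) (ht1 : t ≤ 1) (hs : 1 ≤ s)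
    (hsn : s + 1 ≤ n) {m : ℕ} (hm : 0 < m) :
    ∑ j with ¬ j.val < m, eigenCov (rbmKernel n γ) (designPoint n) v x j ^ 2 ≤
      2 / ((n : ℝ) + 1 / 2) * (rbmScale n γ * ((n : ℝ) + 1 / 2) ^ 2) ^ 2 / (m : ℝ) ^ 3 := by
  set N : ℝ := (n : ℝ) + 1 / 2
  have hN : 0 < N := by positivity
  have hm' : (0 : ℝ) < m := by exact_mod_cast hm
  have hq := rbmScale_pos n γ
  have h1 : ∀ j ∈ Finset.univ.filter fun j : Fin n => ¬ j.val < m,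
      eigenCov (rbmKernel n γ) (designPoint n) v x j ^ 2 ≤
        2 / N * (rbmScale n γ * N ^ 2) ^ 2 / (m : ℝ) ^ 2 * (1 / ((j : ℝ) + 1) ^ 2) := by
    intro j hj
    have hjm : (m : ℝ) ≤ j + 1 := by
      have : m ≤ j.val := not_lt.1 (Finset.mem_filter.1 hj).2
      have : (m : ℝ) ≤ j.val := by exact_mod_cast this
      linarith
    have h2 := abs_eigenCov_rbm_le hv hμ hx ht0 ht1 hs hsn j
    have h3 : μ j ≤ rbmScale n γ * N ^ 2 / ((j : ℝ) + 1) ^ 2 := by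
      rw [hv.eq_rbm.1 j]; exact rbmEigenvalue_le γ j.isLt
    have h4 : μ j ^ 2 ≤ (rbmScale n γ * N ^ 2 / ((j : ℝ) + 1) ^ 2) ^ 2 :=
      pow_le_pow_left₀ (hμ j).le h3 2
    calc eigenCov (rbmKernel n γ) (designPoint n) v x j ^ 2
        = |eigenCov (rbmKernel n γ) (designPoint n) v x j| ^ 2 := (sq_abs _).symm
      _ ≤ (μ j * √(2 / N)) ^ 2 := pow_le_pow_left₀ (abs_nonneg _) h2 2
      _ = 2 / N * μ j ^ 2 := by rw [mul_pow, Real.sq_sqrt (by positivity)]; ring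
      _ ≤ 2 / N * (rbmScale n γ * N ^ 2 / ((j : ℝ) + 1) ^ 2) ^ 2 := by gcongr
      _ = 2 / N * (rbmScale n γ * N ^ 2) ^ 2 / ((j : ℝ) + 1) ^ 2 * (1 / ((j : ℝ) + 1) ^ 2) := by
        field_simp
      _ ≤ _ := by gcongr
  refine (Finset.sum_le_sum h1).trans ?_
  rw [← Finset.mul_sum]
  calc _ ≤ 2 / N * (rbmScale n γ * N ^ 2) ^ 2 / (m : ℝ) ^ 2 * (1 / (m : ℝ)) := by
        gcongr; exact sum_inv_sq_tail_le hm
    _ = _ := by field_simp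

/-- The price of truncation for the bias. -/
theorem sum_eigenCov_mul_tail_le
    (hv : IsOrderedEigenbasis (kernelMatrix (rbmKernel n γ) (designPoint n)) μ v)
    (hμ : ∀ j, 0 < μ j)
    (hx : (x : ℝ) * ((n : ℝ) + 1 / 2) = s + t) (ht0 : 0 ≤ t) (ht1 : t ≤ 1) (hs : 1 ≤ s)
    (hsn : s + 1 ≤ n) {m : ℕ} (hm : 0 < m) {α F H : ℝ} (hα0 : 0 < α) (hα1 : α ≤ 1) (hF0 : 0 ≤ F)
    (hH0 : 0 ≤ H) {f : unitInterval → ℝ} (hF : ∀ u, |f u| ≤ F)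
    (hH : ∀ u u' : unitInterval, |f u - f u'| ≤ H * |(u : ℝ) - u'| ^ α) :
    ∑ j with ¬ j.val < m, |eigenCov (rbmKernel n γ) (designPoint n) v x j| *
        |(v j).ofLp ⬝ᵥ fun i => f (designPoint n i)| ≤
      2 * (2 * H + 4 * F) * (rbmScale n γ * ((n : ℝ) + 1 / 2) ^ 2) / (m * (m : ℝ) ^ α) := by
  set N : ℝ := (n : ℝ) + 1 / 2 with hN_def
  have hN : 0 < N := by positivity
  have hm' : (0 : ℝ) < m := by exact_mod_cast hm
  have hq := rbmScale_pos n γ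
  set G : ℕ → ℝ := fun i => if h : i < n then f (designPoint n ⟨i, h⟩) else 0 with hG
  have hGF : ∀ i < n, |G i| ≤ F := fun i hi => by simp only [hG, hi, dif_pos]; exact hF _
  have hGH : ∀ L i, L + i < n → |G i - G (L + i)| ≤ H * (L / N) ^ α := by
    intro L i hi
    have hi' : i < n := by omega
    simp only [hG, hi, hi', dif_pos]
    refine (hH _ _).trans (le_of_eq ?_)
    congr 2
    simp only [designPoint]
    rw [← hN_def, ← sub_div, abs_div, abs_of_pos hN, abs_sub_comm]
    push_cast
    congr 1
    rw [show (L : ℝ) + i + 1 - (i + 1) = L by ring, Nat.abs_cast]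
  have hcoef : ∀ j : Fin n, |(v j).ofLp ⬝ᵥ fun i => f (designPoint n i)| ≤
      √(2 / N) * ((2 * H + 4 * F) * N / ((j : ℝ) + 1) ^ α) := by
    intro j
    rw [abs_eigenvector_dotProduct hv]
    gcongr
    refine le_trans (le_of_eq ?_)
      (abs_sum_mul_sin_rbmFreq_le j.isLt hα0 hα1 hF0 hH0 hGF hGH)
    rw [Finset.sum_range]
    simp [hG]
  have h1 : ∀ j ∈ Finset.univ.filter fun j : Fin n => ¬ j.val < m,
      |eigenCov (rbmKernel n γ) (designPoint n) v x j| *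
        |(v j).ofLp ⬝ᵥ fun i => f (designPoint n i)| ≤
      2 * (2 * H + 4 * F) * (rbmScale n γ * N ^ 2) / (m : ℝ) ^ α * (1 / ((j : ℝ) + 1) ^ 2) := by
    intro j hj
    have hjm : (m : ℝ) ≤ j + 1 := by
      have : m ≤ j.val := not_lt.1 (Finset.mem_filter.1 hj).2
      have : (m : ℝ) ≤ j.val := by exact_mod_cast this
      linarith
    have hjα : (m : ℝ) ^ α ≤ ((j : ℝ) + 1) ^ α := Real.rpow_le_rpow hm'.le hjm hα0.le
    have hmα : 0 < (m : ℝ) ^ α := by positivity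
    have h3 : μ j ≤ rbmScale n γ * N ^ 2 / ((j : ℝ) + 1) ^ 2 := by
      rw [hv.eq_rbm.1 j]; exact rbmEigenvalue_le γ j.isLt
    calc _ ≤ (μ j * √(2 / N)) * (√(2 / N) * ((2 * H + 4 * F) * N / ((j : ℝ) + 1) ^ α)) :=
          mul_le_mul (abs_eigenCov_rbm_le hv hμ hx ht0 ht1 hs hsn j) (hcoef j) (abs_nonneg _)
            (mul_nonneg (hμ j).le (Real.sqrt_nonneg _))
      _ = (√(2 / N) * √(2 / N)) * μ j * ((2 * H + 4 * F) * N / ((j : ℝ) + 1) ^ α) := by ring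
      _ = 2 / N * μ j * ((2 * H + 4 * F) * N / ((j : ℝ) + 1) ^ α) := by
        rw [Real.mul_self_sqrt (by positivity)]
      _ ≤ 2 / N * (rbmScale n γ * N ^ 2 / ((j : ℝ) + 1) ^ 2) *
          ((2 * H + 4 * F) * N / (m : ℝ) ^ α) := by gcongr
      _ = _ := by field_simp
  refine (Finset.sum_le_sum h1).trans ?_
  rw [← Finset.mul_sum]
  calc _ ≤ 2 * (2 * H + 4 * F) * (rbmScale n γ * N ^ 2) / (m : ℝ) ^ α * (1 / (m : ℝ)) := by
        gcongr; exact sum_inv_sq_tail_le hm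
    _ = _ := by field_simp

/-- The weights of the full posterior mean are those of the equivalent kernel, up to an
exponentially small boundary effect. -/
theorem abs_meanWeights_sub_interpKernel_le
    (hv : IsOrderedEigenbasis (kernelMatrix (rbmKernel n γ) (designPoint n)) μ v)
    (hμ : ∀ j, 0 < μ j)
    (hx : (x : ℝ) * ((n : ℝ) + 1 / 2) = s + t) (ht0 : 0 ≤ t) (ht1 : t ≤ 1) (hs : 1 ≤ s)
    (hsn : s + 1 ≤ n) {ρ : ℝ} (h0 : 0 < ρ) (h1 : ρ < 1) (hρ : (1 - ρ) ^ 2 = rbmScale n γ * ρ)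
    (i : Fin n) :
    |meanWeights (rbmKernel n γ) (designPoint n) μ v n x i - interpKernel ρ s t (i.val + 1)| ≤
      n * (ρ ^ s + n * ρ ^ (n - s - 1)) := by
  refine abs_meanWeights_sub_le hv hμ (kernelMatrix_rbmKernel_transpose n γ) x
    (w := fun i => interpKernel ρ s t (i.val + 1))
    (r := fun i => interpKernel ρ s t 0 + ((i.val + 1 : ℕ) : ℝ) *
      (interpKernel ρ s t (n + 1) - interpKernel ρ s t n))
    (fun i => abs_boundary_defect_le h0 h1 ht0 ht1 hsn i.isLt) (fun i => ?_) i
  rw [kernelMatrix_rbmKernel_mulVec n γ (fun l => interpKernel ρ s t (l + 1)),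
    sum_min_mul_interpKernel h0 hρ t hs hsn i.isLt, rbmKernel_designPoint_interp hx ht0 ht1,
    min_comm _ s, min_comm _ (s + 1)]
  ring

/-- The full posterior variance: the Brownian bridge between the two neighbouring design points
contributes `q * t * (1 - t)`, the equivalent kernel the rest. -/
theorem abs_sgprCov_full_sub_le
    (hv : IsOrderedEigenbasis (kernelMatrix (rbmKernel n γ) (designPoint n)) μ v)
    (hμ : ∀ j, 0 < μ j)
    (hx : (x : ℝ) * ((n : ℝ) + 1 / 2) = s + t) (ht0 : 0 ≤ t) (ht1 : t ≤ 1) (hs : 1 ≤ s)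
    (hsn : s + 1 ≤ n) {ρ : ℝ} (h0 : 0 < ρ) (h1 : ρ < 1) (hρ : (1 - ρ) ^ 2 = rbmScale n γ * ρ) :
    |sgprCov 1 (rbmKernel n γ) (designPoint n) (eigenWeights v n) x x -
        (rbmScale n γ * (t * (1 - t)) +
          ((1 - t) * interpKernel ρ s t s + t * interpKernel ρ s t (s + 1)))| ≤
      (n ^ 3 * rbmScale n γ + 1) * (ρ ^ s + n * ρ ^ (n - s - 1)) := by
  set q := rbmScale n γ
  set R := ρ ^ s + n * ρ ^ (n - s - 1)
  have hq : 0 < q := rbmScale_pos n γ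
  have hR : 0 ≤ R := by positivity
  set bd : ℕ → ℝ := fun p => interpKernel ρ s t 0 +
    p * (interpKernel ρ s t (n + 1) - interpKernel ρ s t n) with hbd
  have hxx : rbmKernel n γ x x = q * (s + t) := by rw [rbmKernel_eq, hx, min_self]
  have k1 := sum_min_mul_interpKernel h0 hρ t hs hsn (show s ≤ n by omega)
  have k2 := sum_min_mul_interpKernel h0 hρ t hs hsn hsn
  rw [min_self, min_eq_left (by omega)] at k1
  rw [min_self, min_eq_right (by omega)] at k2
  have e1 : ∑ i : Fin n, interpKernel ρ s t (i.val + 1) * rbmKernel n γ x (designPoint n i) =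
      (1 - t) * (q * ∑ i ∈ Finset.range n, (min s (i + 1) : ℕ) * interpKernel ρ s t (i + 1)) +
      t * (q * ∑ i ∈ Finset.range n,
        (min (s + 1) (i + 1) : ℕ) * interpKernel ρ s t (i + 1)) := by
    rw [Finset.sum_range, Finset.sum_range]
    simp only [Finset.mul_sum]
    rw [← Finset.sum_add_distrib]
    refine Finset.sum_congr rfl fun i _ => ?_
    rw [rbmKernel_designPoint_interp hx ht0 ht1]
    ring
  have e2 : sgprCov 1 (rbmKernel n γ) (designPoint n) (eigenWeights v n) x x -
      (q * (t * (1 - t)) + ((1 - t) * interpKernel ρ s t s + t * interpKernel ρ s t (s + 1))) =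
      -(∑ i, (meanWeights (rbmKernel n γ) (designPoint n) μ v n x i -
        interpKernel ρ s t (i.val + 1)) * rbmKernel n γ x (designPoint n i)) -
      ((1 - t) * bd s + t * bd (s + 1)) := by
    rw [sgprCov_eigenWeights_full hv hμ, hxx]
    simp only [sub_mul, Finset.sum_sub_distrib, dotProduct]
    rw [e1]
    simp only [hbd]
    push_cast at k1 k2 ⊢
    linear_combination (-(1 - t)) * k1 - t * k2
  have b1 := abs_boundary_defect_le (p := s) h0 h1 ht0 ht1 hsn (by omega)
  have b2 := abs_boundary_defect_le (p := s + 1) h0 h1 ht0 ht1 hsn hsn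
  have b3 : |(1 - t) * bd s + t * bd (s + 1)| ≤ R := by
    refine (abs_add_le _ _).trans ?_
    rw [abs_mul, abs_mul, abs_of_nonneg ht0, abs_of_nonneg (sub_nonneg.2 ht1)]
    calc _ ≤ (1 - t) * R + t * R := by
          have := sub_nonneg.2 ht1
          gcongr
      _ = R := by ring
  have b4 : |∑ i, (meanWeights (rbmKernel n γ) (designPoint n) μ v n x i -
        interpKernel ρ s t (i.val + 1)) * rbmKernel n γ x (designPoint n i)| ≤
      n * ((n * R) * (q * n)) := by
    refine (Finset.abs_sum_le_sum_abs _ _).trans ?_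
    have : ∀ i ∈ Finset.univ, |(meanWeights (rbmKernel n γ) (designPoint n) μ v n x i -
        interpKernel ρ s t (i.val + 1)) * rbmKernel n γ x (designPoint n i)| ≤
        (n * R) * (q * n) := by
      intro i _
      rw [abs_mul]
      refine mul_le_mul (abs_meanWeights_sub_interpKernel_le hv hμ hx ht0 ht1 hs hsn h0 h1 hρ i) ?_
        (abs_nonneg _) (by positivity)
      have hi : ((i.val + 1 : ℕ) : ℝ) ≤ n := by exact_mod_cast i.isLt
      have hst : (0 : ℝ) ≤ s + t := by positivity
      rw [rbmKernel_designPoint, hx, abs_mul, abs_of_pos hq, abs_of_nonneg (by positivity)]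
      gcongr
      exact (min_le_right _ _).trans hi
    refine (Finset.sum_le_card_nsmul _ _ _ this).trans ?_
    simp
  rw [e2]
  refine (abs_sub _ _).trans ?_
  rw [abs_neg]
  calc _ ≤ n * ((n * R) * (q * n)) + R := add_le_add b4 b3
    _ = _ := by ring

theorem abs_meanWeights_full_dotProduct_self_sub_le
    (hv : IsOrderedEigenbasis (kernelMatrix (rbmKernel n γ) (designPoint n)) μ v)
    (hμ : ∀ j, 0 < μ j)
    (hx : (x : ℝ) * ((n : ℝ) + 1 / 2) = s + t) (ht0 : 0 ≤ t) (ht1 : t ≤ 1) (hs : 1 ≤ s)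
    (hsn : s + 1 ≤ n) {ρ : ℝ} (h0 : 0 < ρ) (h1 : ρ < 1) (hρ : (1 - ρ) ^ 2 = rbmScale n γ * ρ) :
    |meanWeights (rbmKernel n γ) (designPoint n) μ v n x ⬝ᵥ
          meanWeights (rbmKernel n γ) (designPoint n) μ v n x -
        ∑ i ∈ Finset.range n, interpKernel ρ s t (i + 1) ^ 2| ≤
      n * (n * (ρ ^ s + n * ρ ^ (n - s - 1)) * (2 + n * (ρ ^ s + n * ρ ^ (n - s - 1)))) := by
  set E := n * (ρ ^ s + n * ρ ^ (n - s - 1))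
  have hE : 0 ≤ E := by positivity
  rw [Finset.sum_range, dotProduct, ← Finset.sum_sub_distrib]
  refine (Finset.abs_sum_le_sum_abs _ _).trans ?_
  have : ∀ i ∈ Finset.univ, |meanWeights (rbmKernel n γ) (designPoint n) μ v n x i *
      meanWeights (rbmKernel n γ) (designPoint n) μ v n x i -
        interpKernel ρ s t (i.val + 1) ^ 2| ≤ E * (2 + E) := by
    intro i _
    have a1 := abs_meanWeights_sub_interpKernel_le hv hμ hx ht0 ht1 hs hsn h0 h1 hρ i
    have a2 := interpKernel_nonneg (s := s) h0 h1 ht0 ht1 (i.val + 1)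
    have a3 : interpKernel ρ s t (i.val + 1) ≤ 1 := by
      simpa using interpKernel_le_pow (s := s) (l := i.val + 1) (k := 0) h0 h1 ht0 ht1
        (Nat.zero_le _) (Nat.zero_le _)
    set a := meanWeights (rbmKernel n γ) (designPoint n) μ v n x i
    set b := interpKernel ρ s t (i.val + 1)
    rw [show a * a - b ^ 2 = (a - b) * (2 * b + (a - b)) by ring, abs_mul]
    refine mul_le_mul a1 ((abs_add_le _ _).trans (add_le_add ?_ a1)) (abs_nonneg _) hE
    rw [abs_of_nonneg (by positivity)]; linarith
  refine (Finset.sum_le_card_nsmul _ _ _ this).trans ?_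
  simp

theorem abs_meanWeights_full_dotProduct_sub_le
    (hv : IsOrderedEigenbasis (kernelMatrix (rbmKernel n γ) (designPoint n)) μ v)
    (hμ : ∀ j, 0 < μ j)
    (hx : (x : ℝ) * ((n : ℝ) + 1 / 2) = s + t) (ht0 : 0 ≤ t) (ht1 : t ≤ 1) (hs : 1 ≤ s)
    (hsn : s + 1 ≤ n) {ρ : ℝ} (h0 : 0 < ρ) (h1 : ρ < 1) (hρ : (1 - ρ) ^ 2 = rbmScale n γ * ρ)
    {f : Fin n → ℝ} {F : ℝ} (hF : ∀ i, |f i| ≤ F) :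
    |meanWeights (rbmKernel n γ) (designPoint n) μ v n x ⬝ᵥ f -
        ∑ i : Fin n, interpKernel ρ s t (i.val + 1) * f i| ≤
      n * (n * (ρ ^ s + n * ρ ^ (n - s - 1)) * F) := by
  rw [dotProduct, ← Finset.sum_sub_distrib]
  refine (Finset.abs_sum_le_sum_abs _ _).trans ?_
  have : ∀ i ∈ Finset.univ, |meanWeights (rbmKernel n γ) (designPoint n) μ v n x i * f i -
      interpKernel ρ s t (i.val + 1) * f i| ≤ n * (ρ ^ s + n * ρ ^ (n - s - 1)) * F := by
    intro i _
    rw [← sub_mul, abs_mul]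
    exact mul_le_mul (abs_meanWeights_sub_interpKernel_le hv hμ hx ht0 ht1 hs hsn h0 h1 hρ i)
      (hF i) (abs_nonneg _) (by positivity)
  refine (Finset.sum_le_card_nsmul _ _ _ this).trans ?_
  simp

end RBM

/-! ### A Riemann sum for the Gamma function -/

theorem tendsto_log_div {θ ρ : ℕ → ℝ} (hθ : ∀ n, 0 < θ n) (hρ0 : ∀ n, 0 < ρ n)
    (hρ : Tendsto ρ atTop (𝓝 1)) (hr : Tendsto (fun n => (1 - ρ n) / θ n) atTop (𝓝 1)) :
    Tendsto (fun n => Real.log (ρ n) / θ n) atTop (𝓝 (-1)) := by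
  have h1 : Tendsto (fun n => -((1 - ρ n) / θ n) / ρ n) atTop (𝓝 (-1)) := by
    have h := hr.neg.div hρ one_ne_zero
    rw [div_one] at h
    exact h
  refine tendsto_of_tendsto_of_tendsto_of_le_of_le h1 hr.neg (fun n => ?_) (fun n => ?_)
  · have h2 := Real.one_sub_inv_le_log_of_pos (hρ0 n)
    have h3 := hρ0 n
    calc -((1 - ρ n) / θ n) / ρ n = (1 - (ρ n)⁻¹) / θ n := by field_simp; ring
      _ ≤ _ := div_le_div_of_nonneg_right h2 (hθ n).le
  · have h2 := Real.log_le_sub_one_of_pos (hρ0 n)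
    calc Real.log (ρ n) / θ n ≤ (ρ n - 1) / θ n := div_le_div_of_nonneg_right h2 (hθ n).le
      _ = _ := by ring

theorem pow_le_exp_neg {ρ c : ℝ} (h0 : 0 ≤ ρ) (hc : c ≤ 1 - ρ) (k : ℕ) :
    ρ ^ k ≤ Real.exp (-(c * k)) := by
  have h : ρ ≤ Real.exp (-c) := by
    have := Real.add_one_le_exp (-c)
    linarith
  calc ρ ^ k ≤ Real.exp (-c) ^ k := pow_le_pow_left₀ h0 h k
    _ = _ := by rw [← Real.exp_nat_mul]; congr 1; ring

theorem integral_step {θ : ℝ} (hθ : 0 < θ) (a : ℕ → ℝ) (M : ℕ) :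
    ∫ u in Set.Ioi 0, ∑ e ∈ Finset.range M,
        (Set.Ioc (e * θ) ((e + 1 : ℕ) * θ)).indicator (fun _ => a e) u =
      θ * ∑ e ∈ Finset.range M, a e := by
  rw [integral_finsetSum, Finset.mul_sum]
  · refine Finset.sum_congr rfl fun e _ => ?_
    have hsub : Set.Ioc (e * θ) ((e + 1 : ℕ) * θ) ⊆ Set.Ioi 0 := fun u hu =>
      lt_of_le_of_lt (by positivity) hu.1
    rw [integral_indicator measurableSet_Ioc, Measure.restrict_restrict measurableSet_Ioc,
      Set.inter_eq_left.2 hsub, setIntegral_const, measureReal_def, Real.volume_Ioc, ENNReal.toReal_ofReal]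
    · push_cast; rw [smul_eq_mul]; ring
    · push_cast; nlinarith
  · intro e _
    refine (IntegrableOn.integrable_indicator ?_ measurableSet_Ioc).integrableOn
    exact integrableOn_const (by simp)

theorem sum_indicator_Ioc_eq {θ : ℝ} (hθ : 0 < θ) (a : ℕ → ℝ) (M : ℕ) {u : ℝ} (hu : 0 < u) :
    ∑ e ∈ Finset.range M, (Set.Ioc (e * θ) ((e + 1 : ℕ) * θ)).indicator (fun _ => a e) u =
      if ⌈u / θ⌉₊ - 1 < M then a (⌈u / θ⌉₊ - 1) else 0 := by
  have hpos : 0 < ⌈u / θ⌉₊ := Nat.ceil_pos.2 (by positivity)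
  have hmem : ∀ e : ℕ, u ∈ Set.Ioc (e * θ) ((e + 1 : ℕ) * θ) ↔ ⌈u / θ⌉₊ - 1 = e := by
    intro e
    rw [Set.mem_Ioc, ← lt_div_iff₀ hθ, ← div_le_iff₀ hθ, ← Nat.lt_ceil, ← Nat.ceil_le]
    omega
  split_ifs with h
  · rw [Finset.sum_eq_single (⌈u / θ⌉₊ - 1)]
    · rw [Set.indicator_of_mem ((hmem _).2 rfl)]
    · intro e _ he
      exact Set.indicator_of_notMem (fun h' => he ((hmem e).1 h').symm) _
    · intro h'
      exact absurd (Finset.mem_range.2 h) h'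
  · refine Finset.sum_eq_zero fun e he => Set.indicator_of_notMem (fun h' => h ?_) _
    rw [(hmem e).1 h']; exact Finset.mem_range.1 he

/-- The moments of order `α` of a geometric law with parameter close to `1`, rescaled, are those
of the exponential law. -/
theorem tendsto_sum_pow_mul_rpow {α : ℝ} (hα0 : 0 < α) (hα1 : α ≤ 1) {θ ρ t : ℕ → ℝ} {M : ℕ → ℕ}
    (hθ : ∀ n, 0 < θ n) (hθ0 : Tendsto θ atTop (𝓝 0)) (hρ0 : ∀ n, 0 < ρ n)
    (hρ : Tendsto ρ atTop (𝓝 1)) (hr : Tendsto (fun n => (1 - ρ n) / θ n) atTop (𝓝 1))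
    (ht0 : ∀ n, 0 ≤ t n) (ht1 : ∀ n, t n ≤ 1)
    (hM : Tendsto (fun n => θ n * M n) atTop atTop) :
    Tendsto (fun n => θ n * ∑ e ∈ Finset.range (M n), ρ n ^ e * (θ n * (e + 1 - t n)) ^ α) atTop
      (𝓝 (Real.Gamma (α + 1))) := by
  simp_rw [← integral_step (hθ _)]
  rw [Real.Gamma_eq_integral (by linarith)]
  have hk : ∀ n, ∀ u : ℝ, 0 < u → u ≤ θ n * ((⌈u / θ n⌉₊ - 1 : ℕ) + 1) ∧
      θ n * ((⌈u / θ n⌉₊ - 1 : ℕ) + 1) ≤ u + θ n := by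
    intro n u hu
    have hpos : 0 < ⌈u / θ n⌉₊ := Nat.ceil_pos.2 (div_pos hu (hθ n))
    have e : (((⌈u / θ n⌉₊ - 1 : ℕ) : ℝ) + 1) = ⌈u / θ n⌉₊ := by
      exact_mod_cast Nat.sub_add_cancel hpos
    rw [e]
    have h1 := Nat.le_ceil (u / θ n)
    have h2 := (Nat.ceil_lt_add_one (div_pos hu (hθ n)).le).le
    have h3 : θ n * (u / θ n) = u := mul_div_cancel₀ _ (hθ n).ne'
    constructor
    · nlinarith [mul_le_mul_of_nonneg_left h1 (hθ n).le]
    · nlinarith [mul_le_mul_of_nonneg_left h2 (hθ n).le]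
  -- The dominating function: `(u + 1) * exp (-u / 2)`, up to a constant, is at most this.
  refine tendsto_integral_filter_of_dominated_convergence
    (fun u => 4 * Real.exp 1 * Real.exp (-(1 / 4) * u)) ?_ ?_ ?_ ?_
  · refine Eventually.of_forall fun n => Measurable.aestronglyMeasurable ?_
    exact Finset.measurable_sum _ fun e _ => measurable_const.indicator measurableSet_Ioc
  · have h1 : ∀ᶠ n in atTop, θ n < 1 := hθ0.eventually (gt_mem_nhds one_pos)
    have h2 : ∀ᶠ n in atTop, 1 / 2 < (1 - ρ n) / θ n := hr.eventually (lt_mem_nhds (by norm_num))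
    filter_upwards [h1, h2] with n hn1 hn2
    refine (ae_restrict_iff' measurableSet_Ioi).2 (Eventually.of_forall fun u hu => ?_)
    have hu : 0 < u := hu
    rw [sum_indicator_Ioc_eq (hθ n) _ _ hu]
    split_ifs
    swap
    · rw [norm_zero]; positivity
    obtain ⟨k1, k2⟩ := hk n u hu
    set d := ⌈u / θ n⌉₊ - 1
    have hb0 : 0 ≤ θ n * (d + 1 - t n) :=
      mul_nonneg (hθ n).le (by linarith [ht1 n, (Nat.cast_nonneg d : (0 : ℝ) ≤ d)])
    have hb1 : θ n * (d + 1 - t n) ≤ u + 1 := by nlinarith [mul_nonneg (hθ n).le (ht0 n)]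
    have hb : (θ n * (d + 1 - t n)) ^ α ≤ u + 1 :=
      calc _ ≤ (u + 1) ^ α := Real.rpow_le_rpow hb0 hb1 hα0.le
        _ ≤ (u + 1) ^ (1 : ℝ) := Real.rpow_le_rpow_of_exponent_le (by linarith) hα1
        _ = u + 1 := Real.rpow_one _
    have hp : ρ n ^ d ≤ Real.exp 1 * Real.exp (-(u / 2)) := by
      rw [lt_div_iff₀ (hθ n)] at hn2
      refine (pow_le_exp_neg (hρ0 n).le hn2.le d).trans ?_
      rw [← Real.exp_add]
      refine Real.exp_le_exp.2 ?_
      nlinarith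
    have hu4 : u + 1 ≤ 4 * Real.exp (u / 4) := by
      have := Real.add_one_le_exp (u / 4)
      linarith
    rw [norm_mul, Real.norm_of_nonneg (pow_nonneg (hρ0 n).le _),
      Real.norm_of_nonneg (Real.rpow_nonneg hb0 _)]
    calc ρ n ^ d * (θ n * (d + 1 - t n)) ^ α
        ≤ (Real.exp 1 * Real.exp (-(u / 2))) * (4 * Real.exp (u / 4)) := by
          gcongr
          exact hb.trans hu4
      _ = 4 * Real.exp 1 * (Real.exp (-(u / 2)) * Real.exp (u / 4)) := by ring
      _ = _ := by rw [← Real.exp_add]; congr 2; ring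
  · exact (exp_neg_integrableOn_Ioi 0 (by norm_num)).const_mul _
  · refine (ae_restrict_iff' measurableSet_Ioi).2 (Eventually.of_forall fun u hu => ?_)
    have hu : 0 < u := hu
    have hd1 : Tendsto (fun n => θ n * ((⌈u / θ n⌉₊ - 1 : ℕ) + 1)) atTop (𝓝 u) :=
      tendsto_of_tendsto_of_tendsto_of_le_of_le tendsto_const_nhds
        (by simpa using tendsto_const_nhds.add hθ0) (fun n => (hk n u hu).1)
        (fun n => (hk n u hu).2)
    have hd : Tendsto (fun n => θ n * (⌈u / θ n⌉₊ - 1 : ℕ)) atTop (𝓝 u) := by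
      have := hd1.sub hθ0
      rw [sub_zero] at this
      exact this.congr fun n => by ring
    have htθ : Tendsto (fun n => θ n * t n) atTop (𝓝 0) :=
      tendsto_of_tendsto_of_tendsto_of_le_of_le tendsto_const_nhds hθ0
        (fun n => mul_nonneg (hθ n).le (ht0 n))
        (fun n => mul_le_of_le_one_right (hθ n).le (ht1 n))
    have hlim1 : Tendsto (fun n => ρ n ^ (⌈u / θ n⌉₊ - 1)) atTop (𝓝 (Real.exp (-u))) := by
      have h := (Real.continuous_exp.tendsto _).comp (hd.mul (tendsto_log_div hθ hρ0 hρ hr))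
      rw [mul_neg_one] at h
      refine h.congr fun n => ?_
      have := (hθ n).ne'
      simp only [Function.comp]
      rw [← Real.exp_log (pow_pos (hρ0 n) _), Real.log_pow]
      congr 1
      field_simp
    have hlim2 : Tendsto (fun n => (θ n * ((⌈u / θ n⌉₊ - 1 : ℕ) + 1 - t n)) ^ α) atTop
        (𝓝 (u ^ α)) := by
      refine Tendsto.rpow_const ?_ (Or.inl hu.ne')
      have := hd1.sub htθ
      rw [sub_zero] at this
      exact this.congr fun n => by ring
    rw [add_sub_cancel_right]
    refine (hlim1.mul hlim2).congr' ?_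
    filter_upwards [hM.eventually_gt_atTop (u + 1), hθ0.eventually (gt_mem_nhds one_pos)]
      with n hn hn1
    rw [sum_indicator_Ioc_eq (hθ n) _ _ hu, if_pos]
    have h1 := (hk n u hu).2
    have h2 : θ n * ((⌈u / θ n⌉₊ - 1 : ℕ) + 1) < θ n * M n := by linarith
    have h3 := lt_of_mul_lt_mul_left h2 (hθ n).le
    have h4 : (⌈u / θ n⌉₊ - 1) + 1 < M n := by exact_mod_cast h3
    omega

/-! ### Rates -/

/-- The inverse of the bandwidth of the posterior mean. -/
noncomputable def rbmRate (n : ℕ) (γ : ℝ) : ℝ := ((n : ℝ) + 1 / 2) ^ (1 / (1 + 2 * γ))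

/-- The inverse of the bandwidth, in units of the spacing of the design; this is also the order of
the posterior variance. -/
noncomputable def rbmStep (n : ℕ) (γ : ℝ) : ℝ := rbmRate n γ / ((n : ℝ) + 1 / 2)

/-- The solution in `(0, 1)` of `(1 - ρ) ^ 2 = q * ρ`: the rate of decay of the equivalent
kernel. -/
noncomputable def rbmRatio (n : ℕ) (γ : ℝ) : ℝ :=
  ((√(rbmStep n γ ^ 2 + 4) - rbmStep n γ) / 2) ^ 2

theorem rbmRate_pos (n : ℕ) (γ : ℝ) : 0 < rbmRate n γ := by unfold rbmRate; positivity

theorem rbmStep_pos (n : ℕ) (γ : ℝ) : 0 < rbmStep n γ := by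
  have := rbmRate_pos n γ
  unfold rbmStep; positivity

theorem rbmStep_mul (n : ℕ) (γ : ℝ) : rbmStep n γ * ((n : ℝ) + 1 / 2) = rbmRate n γ := by
  rw [rbmStep, div_mul_cancel₀ _ (by positivity)]

theorem rbmStep_sq {γ : ℝ} (hγ : 0 < γ) (n : ℕ) : rbmStep n γ ^ 2 = rbmScale n γ := by
  have hN : (0 : ℝ) < (n : ℝ) + 1 / 2 := by positivity
  have h1 : 1 + 2 * γ ≠ 0 := by positivity
  rw [rbmStep, rbmRate, rbmScale, div_pow, ← Real.rpow_natCast, ← Real.rpow_mul hN.le, div_eq_div_iff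
    (by positivity) (by positivity), ← Real.rpow_add_one hN.ne', ← Real.rpow_natCast,
    ← Real.rpow_add hN]
  congr 1
  field_simp
  push_cast
  ring

theorem rbmRatio_aux (n : ℕ) (γ : ℝ) :
    0 < (√(rbmStep n γ ^ 2 + 4) - rbmStep n γ) / 2 ∧
      ((√(rbmStep n γ ^ 2 + 4) - rbmStep n γ) / 2) ^ 2 +
        rbmStep n γ * ((√(rbmStep n γ ^ 2 + 4) - rbmStep n γ) / 2) = 1 := by
  have hθ := rbmStep_pos n γ
  have h1 : rbmStep n γ < √(rbmStep n γ ^ 2 + 4) := by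
    rw [Real.lt_sqrt hθ.le]; linarith
  have h2 : √(rbmStep n γ ^ 2 + 4) ^ 2 = rbmStep n γ ^ 2 + 4 := Real.sq_sqrt (by positivity)
  constructor
  · linarith
  · linear_combination h2 / 4

theorem rbmRatio_pos (n : ℕ) (γ : ℝ) : 0 < rbmRatio n γ := pow_pos (rbmRatio_aux n γ).1 2

theorem one_sub_rbmRatio (n : ℕ) (γ : ℝ) :
    1 - rbmRatio n γ = rbmStep n γ * ((√(rbmStep n γ ^ 2 + 4) - rbmStep n γ) / 2) := by
  have := (rbmRatio_aux n γ).2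
  rw [rbmRatio]; linarith

theorem rbmRatio_lt_one (n : ℕ) (γ : ℝ) : rbmRatio n γ < 1 := by
  have := mul_pos (rbmStep_pos n γ) (rbmRatio_aux n γ).1
  rw [← one_sub_rbmRatio] at this
  linarith

theorem one_sub_rbmRatio_sq {γ : ℝ} (hγ : 0 < γ) (n : ℕ) :
    (1 - rbmRatio n γ) ^ 2 = rbmScale n γ * rbmRatio n γ := by
  rw [one_sub_rbmRatio, ← rbmStep_sq hγ, rbmRatio]; ring

theorem tendsto_size : Tendsto (fun n : ℕ => (n : ℝ) + 1 / 2) atTop atTop :=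
  tendsto_atTop_add_const_right _ _ tendsto_natCast_atTop_atTop

section Limits

variable {γ : ℝ}

theorem tendsto_rbmRate (hγ : 0 < γ) : Tendsto (fun n => rbmRate n γ) atTop atTop :=
  (tendsto_rpow_atTop (by positivity)).comp tendsto_size

theorem tendsto_rbmStep (hγ : 0 < γ) : Tendsto (fun n => rbmStep n γ) atTop (𝓝 0) := by
  have h := (tendsto_rpow_neg_atTop (show 0 < 2 * γ / (1 + 2 * γ) by positivity)).comp tendsto_size
  refine h.congr fun n => ?_
  have hN : (0 : ℝ) < (n : ℝ) + 1 / 2 := by positivity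
  simp only [Function.comp, rbmStep, rbmRate]
  rw [← Real.rpow_sub_one hN.ne']
  congr 1
  field_simp
  ring

theorem tendsto_one_sub_rbmRatio_div (hγ : 0 < γ) :
    Tendsto (fun n => (1 - rbmRatio n γ) / rbmStep n γ) atTop (𝓝 1) := by
  have hc : Continuous fun θ : ℝ => (√(θ ^ 2 + 4) - θ) / 2 := by fun_prop
  have h := (hc.tendsto 0).comp (tendsto_rbmStep hγ)
  have h4 : √(4 : ℝ) = 2 := by
    rw [show (4 : ℝ) = 2 ^ 2 by norm_num, Real.sqrt_sq (by norm_num)]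
  norm_num [h4] at h
  refine h.congr fun n => ?_
  have := (rbmStep_pos n γ).ne'
  rw [one_sub_rbmRatio]
  simp only [Function.comp]
  field_simp

theorem tendsto_rbmRatio (hγ : 0 < γ) : Tendsto (fun n => rbmRatio n γ) atTop (𝓝 1) := by
  have h := (tendsto_one_sub_rbmRatio_div hγ).mul (tendsto_rbmStep hγ)
  rw [mul_zero] at h
  have h2 := (tendsto_const_nhds (x := (1 : ℝ))).sub h
  rw [sub_zero] at h2
  refine h2.congr fun n => ?_
  rw [div_mul_cancel₀ _ (rbmStep_pos n γ).ne']
  ring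

theorem size_le_rbmRate_pow (hγ : 0 < γ) (hγ1 : γ ≤ 1) {n : ℕ} (hn : 1 ≤ n) :
    (n : ℝ) + 1 / 2 ≤ rbmRate n γ ^ 3 := by
  have hn' : (1 : ℝ) ≤ n := by exact_mod_cast hn
  have hN : (0 : ℝ) < (n : ℝ) + 1 / 2 := by positivity
  rw [rbmRate, ← Real.rpow_natCast, ← Real.rpow_mul hN.le]
  refine Real.self_le_rpow_of_one_le (by linarith) ?_
  rw [div_mul_eq_mul_div, le_div_iff₀ (by positivity)]
  push_cast; linarith

theorem one_le_rbmRate (hγ : 0 < γ) {n : ℕ} (hn : 1 ≤ n) : 1 ≤ rbmRate n γ := by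
  have hn' : (1 : ℝ) ≤ n := by exact_mod_cast hn
  exact Real.one_le_rpow (by linarith) (by positivity)

theorem rbmRate_le_size (hγ : 0 < γ) {n : ℕ} (hn : 1 ≤ n) : rbmRate n γ ≤ (n : ℝ) + 1 / 2 := by
  have hn' : (1 : ℝ) ≤ n := by exact_mod_cast hn
  refine Real.rpow_le_self_of_one_le (by linarith) ?_
  rw [div_le_one (by positivity)]; linarith

end Limits

/-- The index (counted from `1`) of the last design point to the left of `x`. -/
noncomputable def designFloor (n : ℕ) (x : unitInterval) : ℕ := ⌊(x : ℝ) * ((n : ℝ) + 1 / 2)⌋₊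

/-- The position, in `[0, 1]`, of `x` between two neighbouring design points. -/
noncomputable def designFract (n : ℕ) (x : unitInterval) : ℝ :=
  (x : ℝ) * ((n : ℝ) + 1 / 2) - designFloor n x

section Location

variable (n : ℕ) (x : unitInterval)

theorem mul_size_eq : (x : ℝ) * ((n : ℝ) + 1 / 2) = designFloor n x + designFract n x := by
  rw [designFract]; ring

theorem mul_size_nonneg : 0 ≤ (x : ℝ) * ((n : ℝ) + 1 / 2) := mul_nonneg x.2.1 (by positivity)

theorem designFract_nonneg : 0 ≤ designFract n x :=
  sub_nonneg.2 (Nat.floor_le (mul_size_nonneg n x))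

theorem designFract_le_one : designFract n x ≤ 1 := by
  have := (Nat.lt_floor_add_one ((x : ℝ) * ((n : ℝ) + 1 / 2))).le
  rw [designFract, designFloor]; linarith

end Location

theorem eventually_location {x : unitInterval} (hx0 : 0 < x) (hx1 : x < 1) :
    ∀ᶠ n : ℕ in atTop, 1 ≤ designFloor n x ∧ designFloor n x + 1 ≤ n ∧
      (x : ℝ) / 2 * ((n : ℝ) + 1 / 2) ≤ designFloor n x ∧
      (1 - (x : ℝ)) / 2 * ((n : ℝ) + 1 / 2) ≤ (n - designFloor n x - 1 : ℕ) := by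
  have h0 : 0 < (x : ℝ) := hx0
  have h1 : (x : ℝ) < 1 := hx1
  filter_upwards [(tendsto_size.const_mul_atTop h0).eventually_ge_atTop 2,
    (tendsto_size.const_mul_atTop (sub_pos.2 h1)).eventually_ge_atTop 4] with n hn1 hn2
  have e := mul_size_eq n x
  have a0 := designFract_nonneg n x
  have a1 := designFract_le_one n x
  have b1 : (1 : ℝ) ≤ designFloor n x := by linarith
  have b2 : ((designFloor n x + 1 : ℕ) : ℝ) ≤ n := by push_cast; linarith
  have b2' : designFloor n x + 1 ≤ n := by exact_mod_cast b2
  refine ⟨by exact_mod_cast b1, b2', by linarith, ?_⟩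
  rw [Nat.sub_sub, Nat.cast_sub b2']
  push_cast
  linarith

/-- The size of the boundary effects. -/
noncomputable def boundaryError (n : ℕ) (γ : ℝ) (x : unitInterval) : ℝ :=
  rbmRatio n γ ^ designFloor n x + n * rbmRatio n γ ^ (n - designFloor n x - 1)

theorem boundaryError_nonneg (n : ℕ) (γ : ℝ) (x : unitInterval) : 0 ≤ boundaryError n γ x := by
  have := rbmRatio_pos n γ
  unfold boundaryError; positivity

theorem tendsto_pow_mul_boundaryError {γ : ℝ} (hγ : 0 < γ) (hγ1 : γ ≤ 1) {x : unitInterval}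
    (hx0 : 0 < x) (hx1 : x < 1) (p : ℕ) :
    Tendsto (fun n : ℕ => ((n : ℝ) + 1 / 2) ^ p * boundaryError n γ x) atTop (𝓝 0) := by
  have h0 : 0 < (x : ℝ) := hx0
  have h1 : 0 < 1 - (x : ℝ) := sub_pos.2 hx1
  set c : ℝ := min (x : ℝ) (1 - x) / 4 with hc_def
  have hc : 0 < c := by have := lt_min h0 h1; positivity
  have hlim : Tendsto (fun n => 2 * (rbmRate n γ ^ ((3 * p + 3 : ℕ) : ℝ) *
      Real.exp (-c * rbmRate n γ))) atTop (𝓝 0) := by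
    have h := ((tendsto_rpow_mul_exp_neg_mul_atTop_nhds_zero ((3 * p + 3 : ℕ) : ℝ) c hc).comp
      (tendsto_rbmRate hγ)).const_mul 2
    rw [mul_zero] at h
    exact h
  refine squeeze_zero' (Eventually.of_forall fun n =>
    mul_nonneg (by positivity) (boundaryError_nonneg n γ x)) ?_ hlim
  filter_upwards [eventually_location hx0 hx1, eventually_ge_atTop 1,
    (tendsto_one_sub_rbmRatio_div hγ).eventually (lt_mem_nhds (show (1 / 2 : ℝ) < 1 by norm_num))]
    with n ⟨_, _, hs, hs'⟩ hn hr
  have hθ := rbmStep_pos n γ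
  have hJ := rbmRate_pos n γ
  have hN := size_le_rbmRate_pow hγ hγ1 hn
  have hN1 : (1 : ℝ) ≤ (n : ℝ) + 1 / 2 := by
    have : (1 : ℝ) ≤ n := by exact_mod_cast hn
    linarith
  rw [lt_div_iff₀ hθ] at hr
  have hθN := rbmStep_mul n γ
  have key : ∀ (k : ℕ) (y : ℝ), 4 * c ≤ y → y / 2 * ((n : ℝ) + 1 / 2) ≤ k →
      rbmRatio n γ ^ k ≤ Real.exp (-c * rbmRate n γ) := by
    intro k y hy hk
    refine (pow_le_exp_neg (rbmRatio_pos n γ).le hr.le k).trans (Real.exp_le_exp.2 ?_)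
    have a1 := mul_le_mul_of_nonneg_left hk (by positivity : 0 ≤ 1 / 2 * rbmStep n γ)
    have a2 : 1 / 2 * rbmStep n γ * (y / 2 * ((n : ℝ) + 1 / 2)) = y / 4 * rbmRate n γ := by
      rw [← hθN]; ring
    have a3 := mul_le_mul_of_nonneg_right hy hJ.le
    linarith
  have k1 := key _ _ (by rw [hc_def]; linarith [min_le_left (x : ℝ) (1 - x)]) hs
  have k2 := key _ _ (by rw [hc_def]; linarith [min_le_right (x : ℝ) (1 - x)]) hs'
  have hE := Real.exp_pos (-c * rbmRate n γ)
  have hρ := (rbmRatio_pos n γ).le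
  have hnN : (n : ℝ) ≤ (n : ℝ) + 1 / 2 := by linarith
  calc ((n : ℝ) + 1 / 2) ^ p * boundaryError n γ x
      ≤ ((n : ℝ) + 1 / 2) ^ p * (((n : ℝ) + 1 / 2) * Real.exp (-c * rbmRate n γ) +
        ((n : ℝ) + 1 / 2) * Real.exp (-c * rbmRate n γ)) := by
        unfold boundaryError
        gcongr
        exact k1.trans (le_mul_of_one_le_left hE.le hN1)
    _ = 2 * (((n : ℝ) + 1 / 2) ^ (p + 1) * Real.exp (-c * rbmRate n γ)) := by ring
    _ ≤ 2 * ((rbmRate n γ ^ 3) ^ (p + 1) * Real.exp (-c * rbmRate n γ)) := by gcongr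
    _ = _ := by
      rw [Real.rpow_natCast, ← pow_mul]
      ring_nf

/-- The number of inducing variables is large enough for the truncated part of the bias to be
negligible. -/
theorem tendsto_rbmRate_rpow_div {α γ : ℝ} (hα : 0 < α) (hγ : 0 < γ) {m : ℕ → ℕ}
    (hm : Tendsto
      (fun n : ℕ => (m n : ℝ) / (n : ℝ) ^ (1 / (1 + 2 * γ) * ((2 + α) / (1 + α)))) atTop atTop) :
    Tendsto (fun n => rbmRate n γ ^ ((2 + α) / (1 + α)) / m n) atTop (𝓝 0) := by
  set e := 1 / (1 + 2 * γ) * ((2 + α) / (1 + α)) with he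
  have he0 : 0 < e := by positivity
  have h := hm.inv_tendsto_atTop.const_mul (2 ^ e)
  rw [mul_zero] at h
  refine squeeze_zero' (Eventually.of_forall fun n => ?_) ?_ h
  · have := rbmRate_pos n γ
    positivity
  · filter_upwards [eventually_ge_atTop 1] with n hn
    have hn' : (1 : ℝ) ≤ n := by exact_mod_cast hn
    have hN : (0 : ℝ) < (n : ℝ) + 1 / 2 := by positivity
    rw [rbmRate, ← Real.rpow_mul hN.le, ← he, Pi.inv_apply, inv_div, mul_div_assoc',
      ← Real.mul_rpow (by norm_num) (by positivity)]
    gcongr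
    linarith

theorem tendsto_rbmRate_div {α γ : ℝ} (hα : 0 < α) (hγ : 0 < γ) {m : ℕ → ℕ}
    (hm : Tendsto
      (fun n : ℕ => (m n : ℝ) / (n : ℝ) ^ (1 / (1 + 2 * γ) * ((2 + α) / (1 + α)))) atTop atTop) :
    Tendsto (fun n => rbmRate n γ / m n) atTop (𝓝 0) := by
  refine squeeze_zero' (Eventually.of_forall fun n => ?_) ?_ (tendsto_rbmRate_rpow_div hα hγ hm)
  · have := rbmRate_pos n γ
    positivity
  · filter_upwards [eventually_ge_atTop 1] with n hn
    gcongr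
    refine Real.self_le_rpow_of_one_le (one_le_rbmRate hγ hn) ?_
    rw [le_div_iff₀ (by positivity)]; linarith

theorem eventually_pos_of_tendsto_div {α γ : ℝ} {m : ℕ → ℕ}
    (hm : Tendsto
      (fun n : ℕ => (m n : ℝ) / (n : ℝ) ^ (1 / (1 + 2 * γ) * ((2 + α) / (1 + α)))) atTop atTop) :
    ∀ᶠ n in atTop, 0 < m n := by
  filter_upwards [hm.eventually_gt_atTop 0] with n hn
  refine Nat.pos_of_ne_zero fun h => ?_
  rw [h] at hn
  simp at hn

/-! ### Limits of the posterior variance, of the variance of the mean, and of the bias -/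

theorem Filter.Tendsto.of_abs_sub_le {a b e : ℕ → ℝ} {L : ℝ} (ha : Tendsto a atTop (𝓝 L))
    (hb : ∀ᶠ n in atTop, |b n - a n| ≤ e n) (he : Tendsto e atTop (𝓝 0)) :
    Tendsto b atTop (𝓝 L) := by
  have h : Tendsto (fun n => b n - a n) atTop (𝓝 0) := squeeze_zero_norm' hb he
  simpa using h.add ha

theorem abs_div_sub_div_le {a b e θ : ℝ} (hθ : 0 < θ) (h : |b - a| ≤ e) :
    |b / θ - a / θ| ≤ e / θ := by
  rw [← sub_div, abs_div, abs_of_pos hθ]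
  gcongr

section Asymptotics

variable {γ : ℝ} {x : unitInterval}

theorem tendsto_boundaryError (hγ : 0 < γ) (hγ1 : γ ≤ 1) (hx0 : 0 < x) (hx1 : x < 1) :
    Tendsto (fun n => boundaryError n γ x) atTop (𝓝 0) := by
  simpa using tendsto_pow_mul_boundaryError hγ hγ1 hx0 hx1 0

theorem tendsto_ratio_pow_floor (hγ : 0 < γ) (hγ1 : γ ≤ 1) (hx0 : 0 < x) (hx1 : x < 1) :
    Tendsto (fun n => rbmRatio n γ ^ designFloor n x) atTop (𝓝 0) := by
  refine squeeze_zero (fun n => pow_nonneg (rbmRatio_pos n γ).le _) (fun n => ?_)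
    (tendsto_boundaryError hγ hγ1 hx0 hx1)
  have := rbmRatio_pos n γ
  exact le_add_of_nonneg_right (by positivity)

theorem tendsto_ratio_pow_sub (hγ : 0 < γ) (hγ1 : γ ≤ 1) (hx0 : 0 < x) (hx1 : x < 1) :
    Tendsto (fun n => rbmRatio n γ ^ (n - designFloor n x + 1)) atTop (𝓝 0) := by
  refine squeeze_zero' (Eventually.of_forall fun n => pow_nonneg (rbmRatio_pos n γ).le _) ?_
    (tendsto_boundaryError hγ hγ1 hx0 hx1)
  filter_upwards [eventually_ge_atTop 1] with n hn
  have h0 := rbmRatio_pos n γ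
  have hn' : (1 : ℝ) ≤ n := by exact_mod_cast hn
  calc rbmRatio n γ ^ (n - designFloor n x + 1) ≤ rbmRatio n γ ^ (n - designFloor n x - 1) :=
        pow_le_pow_of_le_one h0.le (rbmRatio_lt_one n γ).le (by omega)
    _ ≤ n * rbmRatio n γ ^ (n - designFloor n x - 1) :=
        le_mul_of_one_le_left (by positivity) hn'
    _ ≤ _ := le_add_of_nonneg_left (by positivity)

theorem inv_rbmStep_le (hγ : 0 < γ) {n : ℕ} (hn : 1 ≤ n) :
    1 / rbmStep n γ ≤ (n : ℝ) + 1 / 2 := by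
  rw [div_le_iff₀ (rbmStep_pos n γ), mul_comm, rbmStep_mul]
  exact one_le_rbmRate hγ hn

theorem rbmScale_mul_sq (hγ : 0 < γ) (n : ℕ) :
    rbmScale n γ * ((n : ℝ) + 1 / 2) ^ 2 = rbmRate n γ ^ 2 := by
  rw [← rbmStep_sq hγ, ← mul_pow, rbmStep_mul]

theorem rbmScale_le_one (hγ : 0 < γ) {n : ℕ} (hn : 1 ≤ n) : rbmScale n γ ≤ 1 := by
  rw [← rbmStep_sq hγ]
  refine pow_le_one₀ (rbmStep_pos n γ).le ?_
  rw [rbmStep, div_le_one (by positivity)]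
  exact rbmRate_le_size hγ hn

theorem tail_div_rbmStep (hγ : 0 < γ) (n m : ℕ) :
    2 / ((n : ℝ) + 1 / 2) * (rbmScale n γ * ((n : ℝ) + 1 / 2) ^ 2) ^ 2 / (m : ℝ) ^ 3 /
      rbmStep n γ = 2 * (rbmRate n γ / m) ^ 3 := by
  have hN : (n : ℝ) + 1 / 2 ≠ 0 := by positivity
  have hJ := (rbmRate_pos n γ).ne'
  rw [rbmScale_mul_sq hγ, rbmStep]
  field_simp

theorem tendsto_geomKernel_center (hγ : 0 < γ) :
    Tendsto (fun n => (1 - rbmRatio n γ) / (1 + rbmRatio n γ) / rbmStep n γ) atTop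
      (𝓝 (1 / 2)) := by
  have h := (tendsto_one_sub_rbmRatio_div hγ).div
    ((tendsto_rbmRatio hγ).const_add 1) (by norm_num)
  norm_num at h
  exact h.congr fun n => by simp only [Pi.div_apply]; rw [div_right_comm]

theorem tendsto_interpKernel_center (hγ : 0 < γ) :
    Tendsto (fun n => ((1 - designFract n x) *
        interpKernel (rbmRatio n γ) (designFloor n x) (designFract n x) (designFloor n x) +
      designFract n x * interpKernel (rbmRatio n γ) (designFloor n x) (designFract n x)
        (designFloor n x + 1)) / rbmStep n γ) atTop (𝓝 (1 / 2)) := by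
  have hρ := tendsto_rbmRatio hγ
  have hC := tendsto_geomKernel_center hγ
  have hlo := (hρ.mul hρ).mul hC
  have hup := hC.div hρ one_ne_zero
  rw [one_mul, one_mul] at hlo
  rw [div_one] at hup
  refine tendsto_of_tendsto_of_tendsto_of_le_of_le hlo hup (fun n => ?_) (fun n => ?_) <;>
  · have h0 := rbmRatio_pos n γ
    have h1 := rbmRatio_lt_one n γ
    have ht0 := designFract_nonneg n x
    have ht1 := sub_nonneg.2 (designFract_le_one n x)
    have hθ := rbmStep_pos n γ
    set ρ := rbmRatio n γ
    set s := designFloor n x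
    set t := designFract n x
    set C := (1 - ρ) / (1 + ρ) with hCdef
    have hC0 : 0 < C := div_pos (by linarith) (by linarith)
    have g1 : geomKernel ρ s s = C := by simp [geomKernel, hCdef]
    have g2 : geomKernel ρ s (s + 1) = C * ρ := by simp [geomKernel, hCdef]
    have a1 := le_interpKernel (s := s) h0 h1 ht0 (designFract_le_one n x) s
    have a2 := le_interpKernel (s := s) h0 h1 ht0 (designFract_le_one n x) (s + 1)
    have b1 := interpKernel_le (s := s) h0 h1 ht0 (designFract_le_one n x) s
    have b2 := interpKernel_le (s := s) h0 h1 ht0 (designFract_le_one n x) (s + 1)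
    rw [g1] at a1 b1
    rw [g2] at a2 b2
    set w1 := interpKernel ρ s t s
    set w2 := interpKernel ρ s t (s + 1)
    have hρC : ρ * C ≤ C := mul_le_of_le_one_left hC0.le h1.le
    have hρρC : ρ * (ρ * C) ≤ ρ * C := mul_le_mul_of_nonneg_left hρC h0.le
    first
    | rw [mul_div_assoc']
      refine div_le_div_of_nonneg_right ?_ hθ.le
      nlinarith [mul_le_mul_of_nonneg_left a1 ht1, mul_le_mul_of_nonneg_left a2 ht0,
        mul_le_mul_of_nonneg_left hρρC ht1]
    | simp only [Pi.div_apply]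
      rw [div_right_comm]
      refine div_le_div_of_nonneg_right ?_ hθ.le
      rw [le_div_iff₀ h0]
      nlinarith [mul_le_mul_of_nonneg_left b1 ht1, mul_le_mul_of_nonneg_left b2 ht0,
        mul_le_mul_of_nonneg_left hρC ht0]

/-- The variance of the full posterior mean is asymptotically half the posterior variance. -/
theorem tendsto_sum_interpKernel_sq (hγ : 0 < γ) (hγ1 : γ ≤ 1) (hx0 : 0 < x) (hx1 : x < 1) :
    Tendsto (fun n => (∑ i ∈ Finset.range n,
      interpKernel (rbmRatio n γ) (designFloor n x) (designFract n x) (i + 1) ^ 2) / rbmStep n γ)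
      atTop (𝓝 (1 / 4)) := by
  have hρ := tendsto_rbmRatio hγ
  have hS : Tendsto (fun n => (∑ i ∈ Finset.range n,
      geomKernel (rbmRatio n γ) (designFloor n x) (i + 1) ^ 2) / rbmStep n γ)
      atTop (𝓝 (1 / 4)) := by
    have h := ((tendsto_one_sub_rbmRatio_div hγ).div ((hρ.const_add 1).pow 3)
      (by norm_num)).mul ((((hρ.pow 2).const_add 1).sub
        ((tendsto_ratio_pow_floor hγ hγ1 hx0 hx1).pow 2)).sub
        ((tendsto_ratio_pow_sub hγ hγ1 hx0 hx1).pow 2))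
    norm_num at h
    refine h.congr' ?_
    filter_upwards [eventually_location hx0 hx1] with n ⟨_, hs, _⟩
    rw [sum_geomKernel_sq (rbmRatio_pos n γ) (rbmRatio_lt_one n γ) (by omega)]
    ring
  have hlo := (hρ.pow 2).mul hS
  have hup := hS.div (hρ.pow 2) (by norm_num)
  rw [one_pow, one_mul] at hlo
  rw [one_pow, div_one] at hup
  refine tendsto_of_tendsto_of_tendsto_of_le_of_le hlo hup (fun n => ?_) (fun n => ?_)
  · have h0 := rbmRatio_pos n γ
    have h1 := rbmRatio_lt_one n γ
    simp only
    rw [mul_div_assoc', Finset.mul_sum]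
    refine div_le_div_of_nonneg_right (Finset.sum_le_sum fun i _ => ?_) (rbmStep_pos n γ).le
    rw [← mul_pow]
    exact pow_le_pow_left₀ (mul_nonneg h0.le (geomKernel_pos h0 h1 _ _).le)
      (le_interpKernel h0 h1 (designFract_nonneg n x) (designFract_le_one n x) _) 2
  · have h0 := rbmRatio_pos n γ
    have h1 := rbmRatio_lt_one n γ
    simp only [Pi.div_apply]
    rw [div_right_comm]
    refine div_le_div_of_nonneg_right ?_ (rbmStep_pos n γ).le
    rw [le_div_iff₀ (by positivity), mul_comm, Finset.mul_sum]
    refine Finset.sum_le_sum fun i _ => ?_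
    rw [← mul_pow]
    exact pow_le_pow_left₀ (mul_nonneg h0.le (interpKernel_nonneg h0 h1
      (designFract_nonneg n x) (designFract_le_one n x) _))
      (interpKernel_le h0 h1 (designFract_nonneg n x) (designFract_le_one n x) _) 2

variable {m : ℕ → ℕ} {μ : ∀ n : ℕ, Fin n → ℝ} {v : ∀ n : ℕ, Fin n → EuclideanSpace ℝ (Fin n)}

theorem eigenvalue_pos {n : ℕ} {μ : Fin n → ℝ} {v : Fin n → EuclideanSpace ℝ (Fin n)}
    (hv : IsOrderedEigenbasis (kernelMatrix (rbmKernel n γ) (designPoint n)) μ v) (j : Fin n) :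
    0 < μ j := by
  rw [hv.eq_rbm.1 j]; exact rbmEigenvalue_pos γ j.isLt

theorem tendsto_sgprCov (hγ : 0 < γ) (hγ1 : γ ≤ 1) (hx0 : 0 < x) (hx1 : x < 1)
    (hm0 : ∀ᶠ n in atTop, 0 < m n) (hm : Tendsto (fun n => rbmRate n γ / m n) atTop (𝓝 0))
    (hv : ∀ n : ℕ,
      IsOrderedEigenbasis (kernelMatrix (rbmKernel n γ) (designPoint n)) (μ n) (v n)) :
    Tendsto (fun n => sgprCov 1 (rbmKernel n γ) (designPoint n) (eigenWeights (v n) (m n)) x x /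
      rbmStep n γ) atTop (𝓝 (1 / 2)) := by
  have hmain : Tendsto (fun n => (rbmScale n γ * (designFract n x * (1 - designFract n x)) +
      ((1 - designFract n x) *
        interpKernel (rbmRatio n γ) (designFloor n x) (designFract n x) (designFloor n x) +
      designFract n x * interpKernel (rbmRatio n γ) (designFloor n x) (designFract n x)
        (designFloor n x + 1))) / rbmStep n γ) atTop (𝓝 (1 / 2)) := by
    refine (tendsto_interpKernel_center (x := x) hγ).of_abs_sub_le (Eventually.of_forall fun n => ?_)
      (tendsto_rbmStep hγ)
    have hθ := rbmStep_pos n γ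
    have ht0 := designFract_nonneg n x
    have ht1 := designFract_le_one n x
    rw [← sub_div, add_sub_cancel_right, ← rbmStep_sq hγ, sq, mul_assoc, mul_div_cancel_left₀ _ hθ.ne',
      abs_of_nonneg (mul_nonneg hθ.le (mul_nonneg ht0 (sub_nonneg.2 ht1)))]
    exact mul_le_of_le_one_right hθ.le (by nlinarith)
  have hE1 : Tendsto (fun n : ℕ => (((n : ℝ) + 1 / 2) ^ 4 * boundaryError n γ x +
      ((n : ℝ) + 1 / 2) ^ 1 * boundaryError n γ x)) atTop (𝓝 0) := by
    simpa using (tendsto_pow_mul_boundaryError hγ hγ1 hx0 hx1 4).add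
      (tendsto_pow_mul_boundaryError hγ hγ1 hx0 hx1 1)
  have hE2 : Tendsto (fun n => 2 * (rbmRate n γ / m n) ^ 3) atTop (𝓝 0) := by
    simpa using (hm.pow 3).const_mul 2
  refine (hmain.of_abs_sub_le (b := fun n => sgprCov 1 (rbmKernel n γ) (designPoint n)
    (eigenWeights (v n) n) x x / rbmStep n γ) ?_ hE1).of_abs_sub_le ?_ hE2
  · filter_upwards [eventually_location hx0 hx1, eventually_ge_atTop 1] with n ⟨hs, hsn, _⟩ hn
    have hR := boundaryError_nonneg n γ x
    have hN : (n : ℝ) ≤ (n : ℝ) + 1 / 2 := by linarith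
    refine (abs_div_sub_div_le (rbmStep_pos n γ) (abs_sgprCov_full_sub_le (hv n)
      (eigenvalue_pos (hv n)) (mul_size_eq n x) (designFract_nonneg n x) (designFract_le_one n x) hs
      hsn (rbmRatio_pos n γ) (rbmRatio_lt_one n γ) (one_sub_rbmRatio_sq hγ n))).trans ?_
    have hθ := rbmStep_pos n γ
    rw [← boundaryError, div_eq_mul_one_div]
    have hq := rbmScale_le_one hγ hn
    have hq0 := (rbmScale_pos n γ).le
    calc (n ^ 3 * rbmScale n γ + 1) * boundaryError n γ x * (1 / rbmStep n γ)
        ≤ (((n : ℝ) + 1 / 2) ^ 3 * 1 + 1) * boundaryError n γ x * ((n : ℝ) + 1 / 2) := by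
          gcongr
          exact inv_rbmStep_le hγ hn
      _ = _ := by ring
  · filter_upwards [eventually_location hx0 hx1, hm0] with n ⟨hs, hsn, _⟩ hmn
    refine (abs_div_sub_div_le (rbmStep_pos n γ) ((abs_sgprCov_sub_full_le (hv n)
      (eigenvalue_pos (hv n)) (m n) x).trans (sum_eigenCov_sq_tail_le (hv n)
      (eigenvalue_pos (hv n)) (mul_size_eq n x) (designFract_nonneg n x) (designFract_le_one n x) hs
      hsn hmn))).trans (le_of_eq (tail_div_rbmStep hγ n (m n)))

theorem tendsto_meanWeights_sq (hγ : 0 < γ) (hγ1 : γ ≤ 1) (hx0 : 0 < x) (hx1 : x < 1)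
    (hm0 : ∀ᶠ n in atTop, 0 < m n) (hm : Tendsto (fun n => rbmRate n γ / m n) atTop (𝓝 0))
    (hv : ∀ n : ℕ,
      IsOrderedEigenbasis (kernelMatrix (rbmKernel n γ) (designPoint n)) (μ n) (v n)) :
    Tendsto (fun n => meanWeights (rbmKernel n γ) (designPoint n) (μ n) (v n) (m n) x ⬝ᵥ
      meanWeights (rbmKernel n γ) (designPoint n) (μ n) (v n) (m n) x / rbmStep n γ)
      atTop (𝓝 (1 / 4)) := by
  have hE1 : Tendsto (fun n : ℕ => ((n : ℝ) + 1 / 2) ^ 3 * boundaryError n γ x *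
      (2 + ((n : ℝ) + 1 / 2) ^ 1 * boundaryError n γ x)) atTop (𝓝 0) := by
    simpa using (tendsto_pow_mul_boundaryError hγ hγ1 hx0 hx1 3).mul
      ((tendsto_pow_mul_boundaryError hγ hγ1 hx0 hx1 1).const_add 2)
  have hE2 : Tendsto (fun n => 2 * (rbmRate n γ / m n) ^ 3) atTop (𝓝 0) := by
    simpa using (hm.pow 3).const_mul 2
  refine ((tendsto_sum_interpKernel_sq hγ hγ1 hx0 hx1).of_abs_sub_le (b := fun n =>
    meanWeights (rbmKernel n γ) (designPoint n) (μ n) (v n) n x ⬝ᵥ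
    meanWeights (rbmKernel n γ) (designPoint n) (μ n) (v n) n x / rbmStep n γ)
    ?_ hE1).of_abs_sub_le ?_ hE2
  · filter_upwards [eventually_location hx0 hx1, eventually_ge_atTop 1] with n ⟨hs, hsn, _⟩ hn
    have hR := boundaryError_nonneg n γ x
    have hN : (n : ℝ) ≤ (n : ℝ) + 1 / 2 := by linarith
    refine (abs_div_sub_div_le (rbmStep_pos n γ) (abs_meanWeights_full_dotProduct_self_sub_le (hv n)
      (eigenvalue_pos (hv n)) (mul_size_eq n x) (designFract_nonneg n x) (designFract_le_one n x) hs
      hsn (rbmRatio_pos n γ) (rbmRatio_lt_one n γ) (one_sub_rbmRatio_sq hγ n))).trans ?_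
    have hθ := rbmStep_pos n γ
    rw [← boundaryError, div_eq_mul_one_div]
    calc n * (n * boundaryError n γ x * (2 + n * boundaryError n γ x)) * (1 / rbmStep n γ)
        ≤ ((n : ℝ) + 1 / 2) * (((n : ℝ) + 1 / 2) * boundaryError n γ x *
          (2 + ((n : ℝ) + 1 / 2) * boundaryError n γ x)) * ((n : ℝ) + 1 / 2) := by
          gcongr
          exact inv_rbmStep_le hγ hn
      _ = _ := by ring
  · filter_upwards [eventually_location hx0 hx1, hm0] with n ⟨hs, hsn, _⟩ hmn
    refine (abs_div_sub_div_le (rbmStep_pos n γ) ((abs_meanWeights_dotProduct_self_sub_full_le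
      (hv n).orthonormal (eigenvalue_pos (hv n)) (m n) x).trans (sum_eigenCov_sq_tail_le (hv n)
      (eigenvalue_pos (hv n)) (mul_size_eq n x) (designFract_nonneg n x) (designFract_le_one n x) hs
      hsn hmn))).trans (le_of_eq (tail_div_rbmStep hγ n (m n)))

theorem tendsto_rbmRate_rpow_mul_boundaryError {α : ℝ} (hα1 : α ≤ 1)
    (hγ : 0 < γ) (hγ1 : γ ≤ 1) (hx0 : 0 < x) (hx1 : x < 1) (p : ℕ) :
    Tendsto (fun n : ℕ => rbmRate n γ ^ α * (((n : ℝ) + 1 / 2) ^ p * boundaryError n γ x))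
      atTop (𝓝 0) := by
  refine squeeze_zero' (Eventually.of_forall fun n => ?_) ?_
    (tendsto_pow_mul_boundaryError hγ hγ1 hx0 hx1 (p + 1))
  · have := boundaryError_nonneg n γ x
    have := rbmRate_pos n γ
    positivity
  · filter_upwards [eventually_ge_atTop 1] with n hn
    have hR := boundaryError_nonneg n γ x
    have : rbmRate n γ ^ α ≤ (n : ℝ) + 1 / 2 :=
      (Real.rpow_le_self_of_one_le (one_le_rbmRate hγ hn) hα1).trans (rbmRate_le_size hγ hn)
    calc _ ≤ ((n : ℝ) + 1 / 2) * (((n : ℝ) + 1 / 2) ^ p * boundaryError n γ x) := by gcongr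
      _ = _ := by ring

/-- The mean of the posterior at `x`, in expectation, is the smoothing of `f` by the equivalent
kernel, up to an error which is negligible with respect to the order `rbmRate ^ (-α)` of the
bias. -/
theorem tendsto_meanWeights_sub_smoothing {α F H : ℝ} (hα0 : 0 < α) (hα1 : α ≤ 1) (hγ : 0 < γ)
    (hγ1 : γ ≤ 1) (hx0 : 0 < x) (hx1 : x < 1) (hm0 : ∀ᶠ n in atTop, 0 < m n)
    (hm : Tendsto (fun n => rbmRate n γ ^ ((2 + α) / (1 + α)) / m n) atTop (𝓝 0))
    (hv : ∀ n : ℕ,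
      IsOrderedEigenbasis (kernelMatrix (rbmKernel n γ) (designPoint n)) (μ n) (v n))
    (hF0 : 0 ≤ F) (hH0 : 0 ≤ H) {f : unitInterval → ℝ} (hF : ∀ u, |f u| ≤ F)
    (hH : ∀ u u' : unitInterval, |f u - f u'| ≤ H * |(u : ℝ) - u'| ^ α) :
    Tendsto (fun n => rbmRate n γ ^ α *
      ((meanWeights (rbmKernel n γ) (designPoint n) (μ n) (v n) (m n) x ⬝ᵥ
        fun i => f (designPoint n i)) -
      ∑ i : Fin n, interpKernel (rbmRatio n γ) (designFloor n x) (designFract n x) (i.val + 1) *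
        f (designPoint n i))) atTop (𝓝 0) := by
  have hE1 : Tendsto (fun n => 2 * (2 * H + 4 * F) *
      (rbmRate n γ ^ ((2 + α) / (1 + α)) / m n) ^ (1 + α)) atTop (𝓝 0) := by
    have h := (hm.rpow_const (p := 1 + α) (Or.inr (by linarith))).const_mul (2 * (2 * H + 4 * F))
    rwa [Real.zero_rpow (by positivity), mul_zero] at h
  have hE2 : Tendsto (fun n : ℕ => F *
      (rbmRate n γ ^ α * (((n : ℝ) + 1 / 2) ^ 2 * boundaryError n γ x))) atTop (𝓝 0) := by
    simpa using (tendsto_rbmRate_rpow_mul_boundaryError hα1 hγ hγ1 hx0 hx1 2).const_mul F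
  have hE := hE1.add hE2
  rw [add_zero] at hE
  refine squeeze_zero_norm' ?_ hE
  filter_upwards [eventually_location hx0 hx1, hm0] with n ⟨hs, hsn, _⟩ hmn
  have hm' : (0 : ℝ) < m n := by exact_mod_cast hmn
  have hJ := rbmRate_pos n γ
  have hR := boundaryError_nonneg n γ x
  have hN : (n : ℝ) ≤ (n : ℝ) + 1 / 2 := by linarith
  have a1 := (abs_meanWeights_dotProduct_sub_full_le (k := rbmKernel n γ) (d := designPoint n)
    (v := v n) (eigenvalue_pos (hv n)) (m n) x fun i => f (designPoint n i)).trans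
    (sum_eigenCov_mul_tail_le (hv n) (eigenvalue_pos (hv n)) (mul_size_eq n x)
      (designFract_nonneg n x) (designFract_le_one n x) hs hsn hmn hα0 hα1 hF0 hH0 hF hH)
  have a2 := abs_meanWeights_full_dotProduct_sub_le (hv n) (eigenvalue_pos (hv n))
    (mul_size_eq n x) (designFract_nonneg n x) (designFract_le_one n x) hs hsn (rbmRatio_pos n γ)
    (rbmRatio_lt_one n γ) (one_sub_rbmRatio_sq hγ n) (f := fun i => f (designPoint n i))
    fun i => hF _
  rw [Real.norm_eq_abs, abs_mul, abs_of_nonneg (by positivity)]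
  have a3 := (abs_sub_le _ _ _).trans (add_le_add a1 a2)
  refine (mul_le_mul_of_nonneg_left a3 (by positivity)).trans ?_
  rw [mul_add, ← boundaryError]
  refine add_le_add (le_of_eq ?_) ?_
  · rw [rbmScale_mul_sq hγ, Real.div_rpow (by positivity) hm'.le, ← Real.rpow_mul hJ.le,
      div_mul_cancel₀ _ (by positivity), add_comm 2 α, Real.rpow_add hJ, Real.rpow_add hm',
      Real.rpow_one, Real.rpow_two]
    field_simp
  · calc rbmRate n γ ^ α * (n * (n * boundaryError n γ x * F))
        ≤ rbmRate n γ ^ α * (((n : ℝ) + 1 / 2) *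
          (((n : ℝ) + 1 / 2) * boundaryError n γ x * F)) := by gcongr
      _ = _ := by ring

end Asymptotics

/-! ### The bias for Hölder functions -/

theorem exists_bounds_of_mem_holderClass {α : ℝ} (hα0 : 0 < α) {f : unitInterval → ℝ}
    (hf : f ∈ holderClass α) : ∃ F H : ℝ, 0 ≤ F ∧ 0 ≤ H ∧ (∀ u, |f u| ≤ F) ∧
      ∀ u u' : unitInterval, |f u - f u'| ≤ H * |(u : ℝ) - u'| ^ α := by
  obtain ⟨H, hH⟩ := hf
  have h1 : ∀ u u' : unitInterval, |f u - f u'| ≤ H * |(u : ℝ) - u'| ^ α := by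
    intro u u'
    have h := hH.dist_le u u'
    rwa [Real.coe_toNNReal _ hα0.le, Real.dist_eq, Subtype.dist_eq, Real.dist_eq] at h
  refine ⟨|f 0| + H, H, by positivity, H.2, fun u => ?_, h1⟩
  have h2 := h1 u 0
  have h3 : |(u : ℝ) - (0 : unitInterval)| ^ α ≤ 1 := by
    refine Real.rpow_le_one (abs_nonneg _) ?_ hα0.le
    rw [Set.Icc.coe_zero, sub_zero, abs_of_nonneg u.2.1]
    exact u.2.2
  have h4 := mul_le_mul_of_nonneg_left h3 H.2
  have h5 := abs_sub_abs_le_abs_sub (f u) (f 0)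
  simp only [NNReal.val_eq_coe] at h4
  linarith

/-- The function `lam * (u - x)₊ ^ α`, which is no smoother than `C^α` at `x`. -/
noncomputable def oneSidedPower (α lam : ℝ) (x u : unitInterval) : ℝ :=
  lam * max ((u : ℝ) - x) 0 ^ α

theorem abs_rpow_sub_rpow_le {α a b : ℝ} (hα0 : 0 ≤ α) (hα1 : α ≤ 1) (ha : 0 ≤ a) (hb : 0 ≤ b) :
    |a ^ α - b ^ α| ≤ |a - b| ^ α := by
  wlog hab : b ≤ a generalizing a b
  · rw [abs_sub_comm, abs_sub_comm a]
    exact this hb ha (le_of_not_ge hab)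
  rw [abs_of_nonneg (sub_nonneg.2 hab),
    abs_of_nonneg (sub_nonneg.2 (Real.rpow_le_rpow hb hab hα0))]
  have h := Real.rpow_add_le_add_rpow hb (sub_nonneg.2 hab) hα0 hα1
  rw [add_sub_cancel] at h
  linarith

theorem oneSidedPower_mem_holderClass {α : ℝ} (hα0 : 0 < α) (hα1 : α ≤ 1) (lam : ℝ)
    (x : unitInterval) : oneSidedPower α lam x ∈ holderClass α := by
  refine ⟨|lam|.toNNReal, fun u u' => ?_⟩
  have h : dist (oneSidedPower α lam x u) (oneSidedPower α lam x u') ≤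
      |lam| * dist u u' ^ α := by
    rw [Real.dist_eq, Subtype.dist_eq, Real.dist_eq, oneSidedPower, oneSidedPower, ← mul_sub,
      abs_mul]
    gcongr
    refine (abs_rpow_sub_rpow_le hα0.le hα1 (le_max_right _ _) (le_max_right _ _)).trans ?_
    refine Real.rpow_le_rpow (abs_nonneg _) ?_ hα0.le
    simpa using abs_max_sub_max_le_abs ((u : ℝ) - x) ((u' : ℝ) - x) 0
  rw [edist_dist, edist_dist, Real.coe_toNNReal _ hα0.le,
    ENNReal.ofReal_rpow_of_nonneg dist_nonneg hα0.le]
  change _ ≤ ENNReal.ofReal |lam| * _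
  rw [← ENNReal.ofReal_mul (abs_nonneg lam)]
  exact ENNReal.ofReal_le_ofReal h

section Bias

variable {γ : ℝ} {x : unitInterval}

/-- The smoothing bias of a function in `C^α` is of order at most `rbmRate ^ (-α)`. -/
theorem eventually_abs_smoothing_bias_le {α F H : ℝ} (hα0 : 0 < α) (hα1 : α ≤ 1) (hγ : 0 < γ)
    (hγ1 : γ ≤ 1) (hx0 : 0 < x) (hx1 : x < 1) (hF0 : 0 ≤ F) (hH0 : 0 ≤ H)
    {f : unitInterval → ℝ} (hF : ∀ u, |f u| ≤ F)
    (hH : ∀ u u' : unitInterval, |f u - f u'| ≤ H * |(u : ℝ) - u'| ^ α) :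
    ∀ᶠ n in atTop, |rbmRate n γ ^ α *
      ((∑ i : Fin n, interpKernel (rbmRatio n γ) (designFloor n x) (designFract n x) (i.val + 1) *
        f (designPoint n i)) - f x)| ≤ 10 * H + 1 := by
  have hE : Tendsto (fun n => F * (rbmRate n γ ^ α * (((n : ℝ) + 1 / 2) ^ 0 *
      boundaryError n γ x))) atTop (𝓝 0) := by
    simpa only [mul_zero] using
      (tendsto_rbmRate_rpow_mul_boundaryError hα1 hγ hγ1 hx0 hx1 0).const_mul F
  filter_upwards [eventually_location hx0 hx1, eventually_ge_atTop 1,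
    hE.eventually (gt_mem_nhds one_pos),
    (tendsto_one_sub_rbmRatio_div hγ).eventually (lt_mem_nhds (show (1 / 2 : ℝ) < 1 by norm_num)),
    (tendsto_rbmRatio hγ).eventually (lt_mem_nhds (show (1 / 2 : ℝ) < 1 by norm_num))]
    with n ⟨hs, hsn, _⟩ hn hE1 hr hρ
  have h0 := rbmRatio_pos n γ
  have h1 := rbmRatio_lt_one n γ
  have ht0 := designFract_nonneg n x
  have ht1 := designFract_le_one n x
  have hy := mul_size_eq n x
  have hJ := rbmRate_pos n γ
  have hθ := rbmStep_pos n γ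
  have hθN := rbmStep_mul n γ
  rw [lt_div_iff₀ hθ] at hr
  set ρ := rbmRatio n γ
  set s := designFloor n x
  set t := designFract n x
  set J := rbmRate n γ
  set θ := rbmStep n γ
  have hN : (0 : ℝ) < (n : ℝ) + 1 / 2 := by positivity
  have hn' : (1 : ℝ) ≤ n := by exact_mod_cast hn
  have hpt : ∀ i : Fin n, J ^ α * |f (designPoint n i) - f x| ≤
      H * (1 + θ * (((i.val + 1 - s) + (s - (i.val + 1)) : ℕ) + 1)) := by
    intro i
    set D : ℝ := (((i.val + 1 - s) + (s - (i.val + 1)) : ℕ) : ℝ) with hD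
    have hdist : |((i.val + 1 : ℕ) : ℝ) - s| = D := by
      rw [hD]
      rcases le_total s (i.val + 1) with h | h
      · rw [Nat.sub_eq_zero_of_le h, add_zero, Nat.cast_sub h, abs_of_nonneg]
        have : (s : ℝ) ≤ (i.val + 1 : ℕ) := by exact_mod_cast h
        linarith
      · rw [Nat.sub_eq_zero_of_le h, zero_add, Nat.cast_sub h, abs_of_nonpos, neg_sub]
        have : ((i.val + 1 : ℕ) : ℝ) ≤ s := by exact_mod_cast h
        linarith
    have h2 : J * |(designPoint n i : ℝ) - x| ≤ θ * (D + 1) := by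
      rw [← hθN, mul_assoc]
      gcongr
      rw [mul_comm, ← abs_of_pos hN, ← abs_mul, sub_mul, designPoint_mul, hy,
        ← sub_sub, ← hdist]
      refine (abs_sub _ _).trans ?_
      rw [abs_of_nonneg ht0]
      gcongr
    have h3 : (J * |(designPoint n i : ℝ) - x|) ^ α ≤ 1 + θ * (D + 1) := by
      have h4 : 0 ≤ J * |(designPoint n i : ℝ) - x| := by positivity
      calc _ ≤ (1 + θ * (D + 1)) ^ α := Real.rpow_le_rpow h4 (by linarith) hα0.le
        _ ≤ 1 + θ * (D + 1) := Real.rpow_le_self_of_one_le (by linarith) hα1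
    calc J ^ α * |f (designPoint n i) - f x| ≤ J ^ α * (H * |(designPoint n i : ℝ) - x| ^ α) := by
          gcongr; exact hH _ _
      _ = H * (J * |(designPoint n i : ℝ) - x|) ^ α := by
          rw [Real.mul_rpow hJ.le (abs_nonneg _)]; ring
      _ ≤ _ := by gcongr
  have hsplit : J ^ α * ((∑ i : Fin n, interpKernel ρ s t (i.val + 1) * f (designPoint n i)) - f x) =
      ∑ i : Fin n, interpKernel ρ s t (i.val + 1) * (J ^ α * (f (designPoint n i) - f x)) +
      J ^ α * (f x * (∑ i ∈ Finset.range n, interpKernel ρ s t (i + 1) - 1)) := by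
    rw [Finset.sum_range]
    have : ∀ i : Fin n, interpKernel ρ s t (i.val + 1) * (J ^ α * (f (designPoint n i) - f x)) =
        J ^ α * (interpKernel ρ s t (i.val + 1) * f (designPoint n i)) -
          J ^ α * f x * interpKernel ρ s t (i.val + 1) := fun i => by ring
    simp only [this, Finset.sum_sub_distrib, ← Finset.mul_sum]
    ring
  have b1 : |∑ i : Fin n, interpKernel ρ s t (i.val + 1) *
      (J ^ α * (f (designPoint n i) - f x))| ≤ 10 * H := by
    have hw : ∀ i : Fin n, interpKernel ρ s t (i.val + 1) ≤ 2 * geomKernel ρ s (i.val + 1) := by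
      intro i
      have a1 := interpKernel_le (s := s) h0 h1 ht0 ht1 (i.val + 1)
      have a2 := interpKernel_nonneg (s := s) h0 h1 ht0 ht1 (i.val + 1)
      nlinarith
    refine (Finset.abs_sum_le_sum_abs _ _).trans ?_
    have hterm : ∀ i ∈ (Finset.univ : Finset (Fin n)), |interpKernel ρ s t (i.val + 1) *
        (J ^ α * (f (designPoint n i) - f x))| ≤ 2 * geomKernel ρ s (i.val + 1) *
          (H * (1 + θ * (((i.val + 1 - s) + (s - (i.val + 1)) : ℕ) + 1))) := by
      intro i _
      have a2 := interpKernel_nonneg (s := s) h0 h1 ht0 ht1 (i.val + 1)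
      have a3 := geomKernel_pos h0 h1 s (i.val + 1)
      rw [abs_mul, abs_mul, abs_of_nonneg a2, abs_of_nonneg (by positivity : 0 ≤ J ^ α)]
      exact mul_le_mul (hw i) (hpt i) (by positivity) (by positivity)
    refine (Finset.sum_le_sum hterm).trans ?_
    have e1 : ∑ i : Fin n, 2 * geomKernel ρ s (i.val + 1) *
          (H * (1 + θ * ((((i.val + 1 - s) + (s - (i.val + 1)) : ℕ) : ℝ) + 1))) =
        2 * H * (∑ i ∈ Finset.range n, geomKernel ρ s (i + 1) + θ *
          ∑ i ∈ Finset.range n, geomKernel ρ s (i + 1) *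
            ((((i + 1 - s) + (s - (i + 1)) : ℕ) : ℝ) + 1)) := by
      rw [Finset.sum_range, Finset.sum_range, Finset.mul_sum, ← Finset.sum_add_distrib,
        Finset.mul_sum]
      exact Finset.sum_congr rfl fun i _ => by ring
    rw [e1]
    have c1 : ∑ i ∈ Finset.range n, geomKernel ρ s (i + 1) ≤ 1 := by
      rw [sum_geomKernel h0 (show s ≤ n by omega)]
      have : 0 ≤ (ρ ^ s + ρ ^ (n - s + 1)) / (1 + ρ) := by positivity
      linarith
    have c2 := sum_geomKernel_mul_dist_le h0 h1 (show s ≤ n by omega)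
    have c3 : θ * (2 / (1 - ρ)) ≤ 4 := by
      rw [mul_div_assoc', div_le_iff₀ (by linarith)]; linarith
    have c4 := mul_le_mul_of_nonneg_left c2 hθ.le
    nlinarith
  have b2 : |J ^ α * (f x * (∑ i ∈ Finset.range n, interpKernel ρ s t (i + 1) - 1))| ≤ 1 := by
    refine le_trans ?_ hE1.le
    have a1 := abs_sum_interpKernel_sub_one_le h0 h1 ht0 ht1 hsn
    have a2 : ρ ^ s + ρ ^ (n - s - 1) ≤ boundaryError n γ x := by
      unfold boundaryError
      gcongr
      exact le_mul_of_one_le_left (by positivity) hn'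
    have hR := boundaryError_nonneg n γ x
    rw [abs_mul, abs_mul, abs_of_nonneg (by positivity : 0 ≤ J ^ α)]
    calc J ^ α * (|f x| * |∑ i ∈ Finset.range n, interpKernel ρ s t (i + 1) - 1|)
        ≤ J ^ α * (F * boundaryError n γ x) := by
          gcongr
          · exact hF x
          · exact a1.trans a2
      _ = _ := by ring
  rw [hsplit]
  exact (abs_add_le _ _).trans (add_le_add b1 b2)

/-- The smoothing bias of the one-sided power function is of order exactly `rbmRate ^ (-α)`. -/
theorem tendsto_smoothing_oneSidedPower {α : ℝ} (hα0 : 0 < α) (hα1 : α ≤ 1) (lam : ℝ)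
    (hγ : 0 < γ) (hx0 : 0 < x) (hx1 : x < 1) :
    Tendsto (fun n => rbmRate n γ ^ α *
      ∑ i : Fin n, interpKernel (rbmRatio n γ) (designFloor n x) (designFract n x) (i.val + 1) *
        oneSidedPower α lam x (designPoint n i)) atTop (𝓝 (lam * (Real.Gamma (α + 1) / 2))) := by
  have hρ := tendsto_rbmRatio hγ
  have hM : Tendsto (fun n => rbmStep n γ * (n - designFloor n x : ℕ)) atTop atTop := by
    have h1 : 0 < 1 - (x : ℝ) := sub_pos.2 hx1
    refine tendsto_atTop_mono' _ ?_
      ((tendsto_rbmRate hγ).const_mul_atTop (show 0 < (1 - (x : ℝ)) / 2 by positivity))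
    filter_upwards [eventually_location hx0 hx1] with n ⟨_, _, _, hn⟩
    have h2 : ((n - designFloor n x - 1 : ℕ) : ℝ) ≤ (n - designFloor n x : ℕ) := by
      exact_mod_cast Nat.sub_le _ _
    rw [← rbmStep_mul]
    nlinarith [rbmStep_pos n γ, mul_le_mul_of_nonneg_left (hn.trans h2) (rbmStep_pos n γ).le]
  have hsum := tendsto_sum_pow_mul_rpow hα0 hα1 (fun n => rbmStep_pos n γ) (tendsto_rbmStep hγ)
    (fun n => rbmRatio_pos n γ) hρ (tendsto_one_sub_rbmRatio_div hγ)
    (fun n => designFract_nonneg n x) (fun n => designFract_le_one n x) hM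
  have hfac : Tendsto (fun n => (1 - designFract n x) * rbmRatio n γ + designFract n x) atTop
      (𝓝 1) := by
    refine tendsto_of_tendsto_of_tendsto_of_le_of_le hρ tendsto_const_nhds (fun n => ?_)
      (fun n => ?_) <;>
    nlinarith [designFract_nonneg n x, designFract_le_one n x, rbmRatio_lt_one n γ]
  have h := (((tendsto_geomKernel_center hγ).mul hfac).mul hsum).const_mul lam
  rw [mul_one, one_div_mul_eq_div] at h
  refine h.congr' ?_
  filter_upwards [eventually_location hx0 hx1] with n ⟨hs, hsn, _⟩
  have hy := mul_size_eq n x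
  have h0 := rbmRatio_pos n γ
  have ht0 := designFract_nonneg n x
  have ht1 := designFract_le_one n x
  have hθ := rbmStep_pos n γ
  have hJ := rbmRate_pos n γ
  have hθN := rbmStep_mul n γ
  have hN : (0 : ℝ) < (n : ℝ) + 1 / 2 := by positivity
  set ρ := rbmRatio n γ
  set s := designFloor n x
  set t := designFract n x
  set J := rbmRate n γ
  set θ := rbmStep n γ
  obtain ⟨e, he⟩ := Nat.exists_eq_add_of_le (show s ≤ n by omega)
  have hval : ∀ i : Fin n, oneSidedPower α lam x (designPoint n i) =
      lam * max (((i.val + 1 : ℕ) - (s + t)) / ((n : ℝ) + 1 / 2)) 0 ^ α := by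
    intro i
    rw [oneSidedPower, ← hy, ← designPoint_mul n i, ← sub_mul, mul_div_cancel_right₀ _ hN.ne']
  simp only [hval]
  rw [← Finset.sum_range (fun i => interpKernel ρ s t (i + 1) *
    (lam * max (((i + 1 : ℕ) - (s + t)) / ((n : ℝ) + 1 / 2)) 0 ^ α)), show n - s = e by omega,
    show Finset.range n = Finset.range (s + e) by rw [he], Finset.sum_range_add]
  have hzero : ∑ i ∈ Finset.range s, interpKernel ρ s t (i + 1) *
      (lam * max (((i + 1 : ℕ) - (s + t)) / ((n : ℝ) + 1 / 2)) 0 ^ α) = 0 := by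
    refine Finset.sum_eq_zero fun i hi => ?_
    have hi' : ((i + 1 : ℕ) : ℝ) ≤ s := by exact_mod_cast Finset.mem_range.1 hi
    rw [max_eq_right (div_nonpos_of_nonpos_of_nonneg (by linarith) hN.le), Real.zero_rpow hα0.ne',
      mul_zero, mul_zero]
  rw [hzero, zero_add, Finset.mul_sum, Finset.mul_sum, Finset.mul_sum, Finset.mul_sum]
  refine Finset.sum_congr rfl fun i _ => ?_
  have hw : interpKernel ρ s t (s + i + 1) =
      (1 - ρ) / (1 + ρ) * (((1 - t) * ρ + t) * ρ ^ i) := by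
    unfold interpKernel geomKernel
    rw [show s + i + 1 - s + (s - (s + i + 1)) = i + 1 by omega,
      show s + i + 1 - (s + 1) + (s + 1 - (s + i + 1)) = i by omega]
    ring
  have hb : 0 ≤ (i : ℝ) + 1 - t := by
    have : (0 : ℝ) ≤ i := Nat.cast_nonneg i
    linarith
  have hmax : max (((s + i + 1 : ℕ) - (s + t)) / ((n : ℝ) + 1 / 2)) 0 =
      (i + 1 - t) / ((n : ℝ) + 1 / 2) := by
    rw [max_eq_left]
    · push_cast; ring
    · push_cast
      refine div_nonneg ?_ hN.le
      linarith
  have hpow : J ^ α * ((i + 1 - t) / ((n : ℝ) + 1 / 2)) ^ α = (θ * (i + 1 - t)) ^ α := by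
    rw [← Real.mul_rpow hJ.le (by positivity), ← hθN]
    congr 1
    field_simp
  rw [hw, hmax, ← hpow]
  field_simp

end Bias

/-! ### The limit of the coverage -/

theorem sqrt_rbmStep {γ : ℝ} (hγ : 0 < γ) (n : ℕ) : √(rbmStep n γ) = rbmRate n γ ^ (-γ) := by
  have hN : (0 : ℝ) < (n : ℝ) + 1 / 2 := by positivity
  have h1 : 1 + 2 * γ ≠ 0 := by positivity
  rw [rbmStep, rbmRate, ← Real.rpow_sub_one hN.ne', Real.sqrt_eq_rpow, ← Real.rpow_mul hN.le,
    ← Real.rpow_mul hN.le]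
  congr 1
  field_simp
  ring

section Coverage

variable {γ z : ℝ} {x : unitInterval} {m : ℕ → ℕ} {μ : ∀ n : ℕ, Fin n → ℝ}
  {v : ∀ n : ℕ, Fin n → EuclideanSpace ℝ (Fin n)}

/-- The bias of the posterior mean at `x`. -/
noncomputable def rbmBias (γ : ℝ) (μ : ∀ n : ℕ, Fin n → ℝ)
    (v : ∀ n : ℕ, Fin n → EuclideanSpace ℝ (Fin n)) (m : ℕ → ℕ) (f : unitInterval → ℝ)
    (x : unitInterval) (n : ℕ) : ℝ :=
  (meanWeights (rbmKernel n γ) (designPoint n) (μ n) (v n) (m n) x ⬝ᵥ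
    fun i => f (designPoint n i)) - f x

/-- The posterior standard deviation at `x`. -/
noncomputable def rbmSigma (γ : ℝ) (v : ∀ n : ℕ, Fin n → EuclideanSpace ℝ (Fin n)) (m : ℕ → ℕ)
    (x : unitInterval) (n : ℕ) : ℝ :=
  √(sgprCov 1 (rbmKernel n γ) (designPoint n) (eigenWeights (v n) (m n)) x x)

/-- The coverage is asymptotically the probability that a normal variable with variance `1 / 2`
and mean `bias / σ` lies in `[-z, z]`. -/
theorem exists_coverage_eventuallyEq (hγ : 0 < γ) (hγ1 : γ ≤ 1) (hz : 0 ≤ z) (hx0 : 0 < x)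
    (hx1 : x < 1) (hm0 : ∀ᶠ n in atTop, 0 < m n)
    (hm : Tendsto (fun n => rbmRate n γ / m n) atTop (𝓝 0))
    (hv : ∀ n : ℕ,
      IsOrderedEigenbasis (kernelMatrix (rbmKernel n γ) (designPoint n)) (μ n) (v n)) :
    ∃ r : ℕ → ℝ, Tendsto r atTop (𝓝 √2) ∧ ∀ f, ∀ᶠ n in atTop,
      normalIntervalProb z (rbmBias γ μ v m f x n / rbmSigma γ v m x n) (r n) =
        coverage n γ (v n) (m n) z f x := by
  have hσ := tendsto_sgprCov hγ hγ1 hx0 hx1 hm0 hm hv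
  have hτ := tendsto_meanWeights_sq hγ hγ1 hx0 hx1 hm0 hm hv
  refine ⟨fun n => rbmSigma γ v m x n /
    √(meanWeights (rbmKernel n γ) (designPoint n) (μ n) (v n) (m n) x ⬝ᵥ
      meanWeights (rbmKernel n γ) (designPoint n) (μ n) (v n) (m n) x), ?_, fun f => ?_⟩
  · have h := hσ.sqrt.div hτ.sqrt (by positivity)
    rw [← Real.sqrt_div (by norm_num)] at h
    norm_num at h
    refine h.congr fun n => ?_
    have hθ := rbmStep_pos n γ
    rw [Pi.div_apply, Real.sqrt_div' _ hθ.le, Real.sqrt_div' _ hθ.le,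
      div_div_div_cancel_right₀ (Real.sqrt_pos.2 hθ).ne', rbmSigma]
  · filter_upwards [hσ.eventually (lt_mem_nhds (by norm_num : (0 : ℝ) < 1 / 2)),
      hτ.eventually (lt_mem_nhds (by norm_num : (0 : ℝ) < 1 / 4))] with n hn1 hn2
    have hθ := rbmStep_pos n γ
    rw [lt_div_iff₀ hθ, zero_mul] at hn1 hn2
    exact (real_dataLaw_mem_credibleSet (hv n) (eigenvalue_pos (hv n)) (m n) x f hz
      (Real.sqrt_pos.2 hn1) (Real.sqrt_pos.2 hn2) (Real.sq_sqrt hn1.le).symm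
      (Real.sq_sqrt hn2.le).symm).symm

theorem tendsto_sqrt_rbmStep_div_rbmSigma (hγ : 0 < γ) (hγ1 : γ ≤ 1) (hx0 : 0 < x)
    (hx1 : x < 1) (hm0 : ∀ᶠ n in atTop, 0 < m n)
    (hm : Tendsto (fun n => rbmRate n γ / m n) atTop (𝓝 0))
    (hv : ∀ n : ℕ,
      IsOrderedEigenbasis (kernelMatrix (rbmKernel n γ) (designPoint n)) (μ n) (v n)) :
    Tendsto (fun n => √(rbmStep n γ) / rbmSigma γ v m x n) atTop (𝓝 √2) := by
  have h := (tendsto_sgprCov hγ hγ1 hx0 hx1 hm0 hm hv).sqrt.inv₀ (by positivity)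
  rw [← Real.sqrt_inv] at h
  norm_num at h
  refine h.congr fun n => ?_
  rw [Real.sqrt_div' _ (rbmStep_pos n γ).le, inv_div, rbmSigma]

/-- The bias over the posterior standard deviation, split into the normalised bias, the ratio of
the rates of bias and standard deviation, and a bounded factor. -/
theorem rbmBias_div_rbmSigma (hγ : 0 < γ) (α : ℝ) (f : unitInterval → ℝ) (n : ℕ) :
    rbmBias γ μ v m f x n / rbmSigma γ v m x n =
      rbmRate n γ ^ (γ - α) * ((rbmRate n γ ^ α * rbmBias γ μ v m f x n) *
        (√(rbmStep n γ) / rbmSigma γ v m x n)) := by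
  have hJ := rbmRate_pos n γ
  have h : rbmRate n γ ^ (γ - α) * rbmRate n γ ^ α * √(rbmStep n γ) = 1 := by
    rw [sqrt_rbmStep hγ, ← Real.rpow_add hJ, ← Real.rpow_add hJ]
    ring_nf
    exact Real.rpow_zero _
  calc _ = (rbmRate n γ ^ (γ - α) * rbmRate n γ ^ α * √(rbmStep n γ)) *
        (rbmBias γ μ v m f x n / rbmSigma γ v m x n) := by rw [h, one_mul]
    _ = _ := by ring

/-- For the one-sided power function, the normalised bias has a nonzero limit. -/
theorem tendsto_rbmBias_oneSidedPower {α : ℝ} (hα0 : 0 < α) (hα1 : α ≤ 1) (lam : ℝ) (hγ : 0 < γ)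
    (hγ1 : γ ≤ 1) (hx0 : 0 < x) (hx1 : x < 1) (hm0 : ∀ᶠ n in atTop, 0 < m n)
    (hm : Tendsto (fun n => rbmRate n γ ^ ((2 + α) / (1 + α)) / m n) atTop (𝓝 0))
    (hv : ∀ n : ℕ,
      IsOrderedEigenbasis (kernelMatrix (rbmKernel n γ) (designPoint n)) (μ n) (v n)) :
    Tendsto (fun n => rbmRate n γ ^ α * rbmBias γ μ v m (oneSidedPower α lam x) x n) atTop
      (𝓝 (lam * (Real.Gamma (α + 1) / 2))) := by
  obtain ⟨F, H, hF0, hH0, hF, hH⟩ :=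
    exists_bounds_of_mem_holderClass hα0 (oneSidedPower_mem_holderClass hα0 hα1 lam x)
  have h := (tendsto_meanWeights_sub_smoothing hα0 hα1 hγ hγ1 hx0 hx1 hm0 hm hv hF0 hH0 hF
    hH).add (tendsto_smoothing_oneSidedPower hα0 hα1 lam hγ hx0 hx1)
  rw [zero_add] at h
  refine h.congr fun n => ?_
  have hfx : oneSidedPower α lam x x = 0 := by
    simp [oneSidedPower, Real.zero_rpow hα0.ne']
  rw [rbmBias, hfx]
  ring

theorem tendsto_rbmBias_div_rbmSigma_zero {α : ℝ} (hα1 : α ≤ 1) (hγ : 0 < γ)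
    (hγ1 : γ ≤ 1) (hγα : γ < α) (hx0 : 0 < x) (hx1 : x < 1) (hm0 : ∀ᶠ n in atTop, 0 < m n)
    (hm : Tendsto (fun n => rbmRate n γ ^ ((2 + α) / (1 + α)) / m n) atTop (𝓝 0))
    (hm' : Tendsto (fun n => rbmRate n γ / m n) atTop (𝓝 0))
    (hv : ∀ n : ℕ,
      IsOrderedEigenbasis (kernelMatrix (rbmKernel n γ) (designPoint n)) (μ n) (v n))
    {f : unitInterval → ℝ} (hf : f ∈ holderClass α) :
    Tendsto (fun n => rbmBias γ μ v m f x n / rbmSigma γ v m x n) atTop (𝓝 0) := by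
  have hα0 : 0 < α := hγ.trans hγα
  obtain ⟨F, H, hF0, hH0, hF, hH⟩ := exists_bounds_of_mem_holderClass hα0 hf
  have h1 := tendsto_meanWeights_sub_smoothing hα0 hα1 hγ hγ1 hx0 hx1 hm0 hm hv hF0 hH0 hF hH
  have h2 := eventually_abs_smoothing_bias_le hα0 hα1 hγ hγ1 hx0 hx1 hF0 hH0 hF hH
  have hb : ∀ᶠ n in atTop, |rbmRate n γ ^ α * rbmBias γ μ v m f x n| ≤ 10 * H + 2 := by
    filter_upwards [h1.abs.eventually (gt_mem_nhds (show |(0 : ℝ)| < 1 by simp)), h2]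
      with n hn1 hn2
    have e : rbmRate n γ ^ α * rbmBias γ μ v m f x n =
        rbmRate n γ ^ α * ((meanWeights (rbmKernel n γ) (designPoint n) (μ n) (v n) (m n) x ⬝ᵥ
          fun i => f (designPoint n i)) - ∑ i : Fin n, interpKernel (rbmRatio n γ)
          (designFloor n x) (designFract n x) (i.val + 1) * f (designPoint n i)) +
        rbmRate n γ ^ α * ((∑ i : Fin n, interpKernel (rbmRatio n γ) (designFloor n x)
          (designFract n x) (i.val + 1) * f (designPoint n i)) - f x) := by
      rw [rbmBias]; ring
    rw [e]
    refine (abs_add_le _ _).trans ?_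
    linarith
  have hrate : Tendsto (fun n => rbmRate n γ ^ (γ - α)) atTop (𝓝 0) := by
    have := (tendsto_rpow_neg_atTop (sub_pos.2 hγα)).comp (tendsto_rbmRate hγ)
    simpa [Function.comp_def] using this
  have hσ := tendsto_sqrt_rbmStep_div_rbmSigma hγ hγ1 hx0 hx1 hm0 hm' hv
  have h3 := ((hrate.mul hσ).abs).const_mul (10 * H + 2)
  rw [zero_mul, abs_zero, mul_zero] at h3
  refine squeeze_zero_norm' ?_ h3
  filter_upwards [hb] with n hn
  rw [rbmBias_div_rbmSigma hγ α, Real.norm_eq_abs, mul_left_comm, abs_mul]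
  gcongr

end Coverage

theorem theorem3p2 (α γ δ z : ℝ) (hα : 0 < α) (hα1 : α ≤ 1) (hγ : 0 < γ) (hγ1 : γ ≤ 1)
    (hδ : 0 < δ) (hδ1 : δ < 1)
    -- `z = z_{1-δ}`
    (hz : gaussianAbsLe 1 z = 1 - δ)
    (x : unitInterval) (hx0 : 0 < x) (hx1 : x < 1)
    -- `m_n ≫ n^{(2+α)/((1+2γ)(1+α))}`
    (m : ℕ → ℕ)
    (hm : Tendsto
      (fun n : ℕ => (m n : ℝ) / (n : ℝ) ^ (1 / (1 + 2 * γ) * ((2 + α) / (1 + α)))) atTop atTop)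
    -- ordered eigenvalues and orthonormal eigenvectors of the prior covariance matrix
    (μ : ∀ n : ℕ, Fin n → ℝ) (v : ∀ n : ℕ, Fin n → EuclideanSpace ℝ (Fin n))
    (hv : ∀ n : ℕ,
      IsOrderedEigenbasis (kernelMatrix (rbmKernel n γ) (designPoint n)) (μ n) (v n)) :
    1 - δ < gaussianAbsLe (1 / 2) z ∧
    (γ < α → ∀ f ∈ holderClass α,
      Tendsto (fun n => coverage n γ (v n) (m n) z f x) atTop (𝓝 (gaussianAbsLe (1 / 2) z))) ∧
    (α = γ → ∀ p : ℝ, 0 < p → p ≤ gaussianAbsLe (1 / 2) z → ∃ f ∈ holderClass α,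
      Tendsto (fun n => coverage n γ (v n) (m n) z f x) atTop (𝓝 p)) ∧
    (α < γ → ∃ f ∈ holderClass α,
      Tendsto (fun n => coverage n γ (v n) (m n) z f x) atTop (𝓝 0)) := by
  have hz0 : 0 < z := pos_of_gaussianAbsLe_pos one_ne_zero (by rw [hz]; linarith)
  have hm0 := eventually_pos_of_tendsto_div hm
  have hmα := tendsto_rbmRate_rpow_div hα hγ hm
  have hm1 := tendsto_rbmRate_div hα hγ hm
  have hσ := tendsto_sqrt_rbmStep_div_rbmSigma hγ hγ1 hx0 hx1 hm0 hm1 hv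
  obtain ⟨r, hr, hcov⟩ := exists_coverage_eventuallyEq hγ hγ1 hz0.le hx0 hx1 hm0 hm1 hv
  have hΓ : 0 < Real.Gamma (α + 1) := Real.Gamma_pos_of_pos (by linarith)
  have h2 : 0 < √(2 : ℝ) := by positivity
  refine ⟨?_, fun hγα f hf => ?_, fun hαγ p hp hp' => ?_, fun hαγ => ?_⟩
  · rw [← hz]; exact gaussianAbsLe_one_lt_half hz0
  · rw [gaussianAbsLe_half_eq hz0.le]
    exact (tendsto_normalIntervalProb (tendsto_rbmBias_div_rbmSigma_zero hα1 hγ hγ1 hγα hx0 hx1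
      hm0 hmα hm1 hv hf) hr).congr' (hcov f)
  · rw [gaussianAbsLe_half_eq hz0.le] at hp'
    obtain ⟨β, hβ⟩ := exists_normalIntervalProb_eq h2 hp hp'
    -- With this factor the ratio of the bias to the posterior standard deviation tends to `β`.
    set lam := β / (Real.Gamma (α + 1) / 2 * √2) with hlam
    refine ⟨oneSidedPower α lam x, oneSidedPower_mem_holderClass hα hα1 lam x, ?_⟩
    rw [← hβ]
    refine (tendsto_normalIntervalProb ?_ hr).congr' (hcov _)
    have h := (tendsto_rbmBias_oneSidedPower hα hα1 lam hγ hγ1 hx0 hx1 hm0 hmα hv).mul hσ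
    have e : lam * (Real.Gamma (α + 1) / 2) * √2 = β := by
      rw [hlam, mul_assoc, div_mul_cancel₀ _ (by positivity)]
    rw [e] at h
    refine h.congr fun n => ?_
    rw [rbmBias_div_rbmSigma hγ α, hαγ, sub_self, Real.rpow_zero, one_mul]
  · refine ⟨oneSidedPower α 1 x, oneSidedPower_mem_holderClass hα hα1 1 x, ?_⟩
    refine (tendsto_normalIntervalProb_zero ?_ hr h2).congr' (hcov _)
    have h := (tendsto_rbmBias_oneSidedPower hα hα1 1 hγ hγ1 hx0 hx1 hm0 hmα hv).mul hσ
    have hrate : Tendsto (fun n => rbmRate n γ ^ (γ - α)) atTop atTop :=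
      (tendsto_rpow_atTop (sub_pos.2 hαγ)).comp (tendsto_rbmRate hγ)
    refine (hrate.atTop_mul_pos (by positivity) h).congr fun n => ?_
    rw [rbmBias_div_rbmSigma hγ α]
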